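/- Let $\beta>0$, $a^\pm=(\pm1,0)\in\mathbb R^2$. For $\epsilon\in(0,1)$ let $\phi\in C^\infty(\mathbb R,[0,\infty))$ be any function with $\phi(t)=0$ for $t\le\sqrt{1-\epsilon}$ and $\phi(t)=1$ for $t\ge\sqrt{1-\epsilon/2}$, and set, for $u=(u_1,u_2)\in\mathbb R^2$, $$W_\epsilon(u)=\frac{(|u|^2-1)^2}{4}+u_2^2\,\phi(|u|^2).$$ (a) For every $\epsilon\in(0,1)$ and every such $\phi$, the function $W_\epsilon$ is a nondegenerate double well potential: $W_\epsilon\in C^2(\mathbb R^2;\mathbb R)$ is nonnegative and has exactly the two zeros $a^-$ and $a^+$; there are $r,c>0$ such that $\nabla^2W_\epsilon(u)(\nu,\nu)\ge c$ for all $u$ with $|u-a^-|\le r$ or $|u-a^+|\le r$ and all $\nu\in\mathbb R^2$ with $|\nu|=1$; and $\liminf_{|u|\to\infty}W_\epsilon(u)>0$ (possibly $+\infty$). (b) There is $\epsilon_0\in(0,1]$, depending only on $\beta$, such that for every $\epsilon\in(0,\epsilon_0)$ and every such $\phi$ the following separation condition holds. Let $F$ be the set of minimal heteroclinics, i.e.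 of all $e\in C^4(\mathbb R;\mathbb R^2)$ such that $e''''-\beta e''+\nabla W_\epsilon(e)=0$ on $\mathbb R$, $\lim_{x\to\pm\infty}(e,e',e'',e''')(x)=(a^\pm,0,0,0)$, and $e$ minimizes $$J_{\mathbb R}(u)=\int_{\mathbb R}\Big[\tfrac12|u''|^2+\tfrac\beta2|u'|^2+W_\epsilon(u)\Big]dx\in[0,\infty]$$ among all $u\in H^2_{\rm loc}(\mathbb R;\mathbb R^2)$ with $\lim_{x\to\pm\infty}u(x)=a^\pm$. Let $F^+$ (resp. $F^-$) be the set of those $e\in F$ that connect $a^-$ to $a^+$ in the clockwise (resp. counterclockwise) direction around the origin, i.e. $e(x)\ne0$ for all $x$ and a continuous determination $\theta$ of the polar angle of $e$ has limits at $\pm\infty$ with $\theta(+\infty)-\theta(-\infty)<0$ (resp. $>0$). Then $$F=F^-\cup F^+,\qquad F^-\ne\varnothing,\qquad F^+\ne\varnothing,$$ $e^--e^+\in L^2(\mathbb R;\mathbb R^2)$ for all $e^\pm\in F^\pm$, and $$\inf\{\|e^--e^+\|_{L^2(\mathbb R;\mathbb R^2)}:\ e^-\in F^-,\ e^+\in F^+\}>0.$$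 -/

import Mathlib

open Set Filter Topology MeasureTheory
open scoped ENNReal ContDiff

noncomputable section

/-- `ℝᵐ` with its Euclidean norm and inner product. -/
abbrev RVec (m : ℕ) : Type := EuclideanSpace ℝ (Fin m)

/-! ### Double well potentials -/

/-- `W` is a nondegenerate double well potential with wells `am`, `ap`: it is `C²`, nonnegative,
has exactly the two zeros `am`, `ap`, its Hessian is uniformly positive definite near both zeros,
and `liminf W > 0` at infinity (the liminf is taken in `EReal`, since `W` may tend to `+∞`). -/
structure IsDoubleWell {m : ℕ} (W : RVec m → ℝ) (am ap : RVec m) : Prop where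
  contDiff : ContDiff ℝ 2 W
  nonneg : ∀ u, 0 ≤ W u
  ne : am ≠ ap
  zero_iff : ∀ u, W u = 0 ↔ u = am ∨ u = ap
  hessian : ∃ r > 0, ∃ c > 0, ∀ u : RVec m, (‖u - am‖ ≤ r ∨ ‖u - ap‖ ≤ r) →
    ∀ ν : RVec m, ‖ν‖ = 1 → c ≤ iteratedFDeriv ℝ 2 W u ![ν, ν]
  liminf_pos : 0 < liminf (fun u => (W u : EReal)) (Bornology.cobounded (RVec m))

/-! ### The space `H²_loc(ℝ; ℝᵐ)` and the action functional -/

/-- `f ∈ L²_loc(ℝ; ℝᵐ)`. -/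
def MemL2loc {m : ℕ} (f : ℝ → RVec m) : Prop :=
  ∀ K : Set ℝ, IsCompact K → MemLp f 2 (volume.restrict K)

/-- `v` is the weak (distributional) derivative of `u` on `ℝ`, both being locally integrable. -/
structure HasWeakDeriv {m : ℕ} (u v : ℝ → RVec m) : Prop where
  locallyIntegrable : LocallyIntegrable u
  locallyIntegrable_deriv : LocallyIntegrable v
  integral_eq : ∀ η : ℝ → ℝ, ContDiff ℝ ∞ η → HasCompactSupport η →
    ∫ x, deriv η x • u x = -∫ x, η x • v x

/-- `u ∈ H²_loc(ℝ; ℝᵐ)`, with weak derivatives `u' = u₁` and `u'' = u₂`. As usual in one dimension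
`u` stands for its continuous representative. -/
structure IsH2loc {m : ℕ} (u u₁ u₂ : ℝ → RVec m) : Prop where
  continuous : Continuous u
  memL2loc : MemL2loc u
  memL2loc₁ : MemL2loc u₁
  memL2loc₂ : MemL2loc u₂
  weakDeriv₁ : HasWeakDeriv u u₁
  weakDeriv₂ : HasWeakDeriv u₁ u₂

/-- `u` belongs to the class `A` of `H²_loc` maps with limits `am` at `-∞` and `ap` at `+∞`;
`u₁`, `u₂` are its first and second weak derivatives. -/
structure IsAdmissible {m : ℕ} (am ap : RVec m) (u u₁ u₂ : ℝ → RVec m) : Prop where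
  isH2loc : IsH2loc u u₁ u₂
  tendsto_atBot : Tendsto u atBot (𝓝 am)
  tendsto_atTop : Tendsto u atTop (𝓝 ap)

/-- The action `∫ ½|u''|² + (β/2)|u'|² + W(u)` over `ℝ`, with value in `[0, ∞]`, of a map `u`
with derivatives `u' = u₁` and `u'' = u₂`. (It is used for `β > 0` and `W ≥ 0`.) -/
def action {m : ℕ} (β : ℝ) (W : RVec m → ℝ) (u u₁ u₂ : ℝ → RVec m) : ℝ≥0∞ :=
  ∫⁻ x, ENNReal.ofReal (1 / 2 * ‖u₂ x‖ ^ 2 + β / 2 * ‖u₁ x‖ ^ 2 + W (u x))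

/-! ### Heteroclinic orbits -/

/-- A heteroclinic orbit: a `C⁴` solution of `e'''' - β e'' + ∇W(e) = 0` such that
`(e, e', e'', e''')` tends to `(am, 0, 0, 0)` at `-∞` and to `(ap, 0, 0, 0)` at `+∞`. -/
structure IsHeteroclinic {m : ℕ} (β : ℝ) (W : RVec m → ℝ) (am ap : RVec m)
    (e : ℝ → RVec m) : Prop where
  contDiff : ContDiff ℝ 4 e
  ode : ∀ x, iteratedDeriv 4 e x - β • iteratedDeriv 2 e x + gradient W (e x) = 0
  tendsto_atBot : Tendsto e atBot (𝓝 am)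
  tendsto_atTop : Tendsto e atTop (𝓝 ap)
  deriv_atBot : ∀ k : ℕ, 1 ≤ k → k ≤ 3 → Tendsto (iteratedDeriv k e) atBot (𝓝 0)
  deriv_atTop : ∀ k : ℕ, 1 ≤ k → k ≤ 3 → Tendsto (iteratedDeriv k e) atTop (𝓝 0)

/-- The set of minimal heteroclinics: heteroclinic orbits that minimize the action in the
class `A`. -/
def minimalHeteroclinics {m : ℕ} (β : ℝ) (W : RVec m → ℝ) (am ap : RVec m) :
    Set (ℝ → RVec m) :=
  {e | IsHeteroclinic β W am ap e ∧ IsAdmissible am ap e (deriv e) (iteratedDeriv 2 e) ∧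
    ∀ u u₁ u₂ : ℝ → RVec m, IsAdmissible am ap u u₁ u₂ →
      action β W e (deriv e) (iteratedDeriv 2 e) ≤ action β W u u₁ u₂}

/-- The `L²(ℝ; ℝᵐ)` distance `inf {‖e - e'‖ : e ∈ S, e' ∈ T}` between two sets of maps. -/
def l2SetDist {m : ℕ} (S T : Set (ℝ → RVec m)) : ℝ≥0∞ :=
  ⨅ e ∈ S, ⨅ e' ∈ T, eLpNorm (e - e') 2 volume

/-- The separation condition for a set `F` of maps, with the decomposition `F = Fm ∪ Fp` made
explicit: both parts are nonempty, differences of their elements lie in `L²(ℝ; ℝᵐ)`, and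
their `L²` distance is positive. -/
structure SeparatedInto {m : ℕ} (F Fm Fp : Set (ℝ → RVec m)) : Prop where
  eq_union : F = Fm ∪ Fp
  nonempty_m : Fm.Nonempty
  nonempty_p : Fp.Nonempty
  memLp_sub : ∀ e ∈ Fm, ∀ e' ∈ Fp, MemLp (e - e') 2 volume
  dist_pos : 0 < l2SetDist Fm Fp

/-! ### Turning around the origin of the plane -/

/-- The planar map `e` never vanishes, and `θ` is a continuous determination of its polar angle,
with limit `θm` at `-∞` and `θp` at `+∞`. -/
structure HasAngle (e : ℝ → RVec 2) (θ : ℝ → ℝ) (θm θp : ℝ) : Prop where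
  ne_zero : ∀ x, e x ≠ 0
  continuous : Continuous θ
  polar : ∀ x, e x = !₂[‖e x‖ * Real.cos (θ x), ‖e x‖ * Real.sin (θ x)]
  tendsto_atBot : Tendsto θ atBot (𝓝 θm)
  tendsto_atTop : Tendsto θ atTop (𝓝 θp)

/-- `e` avoids the origin and its polar angle has a negative total variation
`θ(+∞) - θ(-∞)`. -/
def TurnsClockwise (e : ℝ → RVec 2) : Prop :=
  ∃ (θ : ℝ → ℝ) (θm θp : ℝ), HasAngle e θ θm θp ∧ θp < θm

/-- `e` avoids the origin and its polar angle has a positive total variation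
`θ(+∞) - θ(-∞)`. -/
def TurnsCounterclockwise (e : ℝ → RVec 2) : Prop :=
  ∃ (θ : ℝ → ℝ) (θm θp : ℝ), HasAngle e θ θm θp ∧ θm < θp

/-! ### The perturbed Ginzburg–Landau potential -/

/-- `φ ∈ C^∞(ℝ; [0, ∞))` vanishes on `(-∞, √(1-ε)]` and equals `1` on `[√(1-ε/2), ∞)`. -/
structure IsCutoff (ε : ℝ) (φ : ℝ → ℝ) : Prop where
  contDiff : ContDiff ℝ ∞ φ
  nonneg : ∀ t, 0 ≤ φ t
  eq_zero : ∀ t, t ≤ Real.sqrt (1 - ε) → φ t = 0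
  eq_one : ∀ t, Real.sqrt (1 - ε / 2) ≤ t → φ t = 1

/-- `(|u|² - 1)² / 4 + u₂² φ(|u|²)` for `u = (u₁, u₂)`, which has the coordinates `u 0`, `u 1`. -/
def glPotential (φ : ℝ → ℝ) (u : RVec 2) : ℝ :=
  (‖u‖ ^ 2 - 1) ^ 2 / 4 + (u 1) ^ 2 * φ (‖u‖ ^ 2)

/-- The well `(-1, 0)`. -/
def wellMinus : RVec 2 := !₂[-1, 0]

/-- The well `(1, 0)`. -/
def wellPlus : RVec 2 := !₂[1, 0]

end

/-! The proof combines an energy comparison with the topology of the punctured plane.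

Near the unit circle the potential is `(|u|² - 1)² / 4 + u₂²`, which gives the nondegeneracy of the
wells `(±1, 0)` (`isDoubleWell_glPotential`). For small `ε` the term `u₂² φ(|u|²)` leaves a cheap way
from one well to the other: shrink the radius until `φ` vanishes, make a slow half turn along that
circle, and move out again. Its action is `O(ε)` (`infAction_glPotential_le`). A path that comes
within distance `1 / 2` of the origin has to cross an annulus in which the potential is bounded
below independently of `φ`, at a cost of at least a constant `originCost β`. Below a threshold `ε₀`
that depends on `β` only, minimizers therefore stay outside the disc of radius `1 / 2`
(`Connects.half_le_norm`).

A connection that avoids the origin has a polar angle with limits in `π + 2πℤ` at `-∞` and in `2πℤ`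
at `+∞`, so it turns in one of the two directions (`Connects.turns`). The reflection
`(u₁, u₂) ↦ (u₁, -u₂)` preserves the action and exchanges the directions; hence both classes are
nonempty as soon as there is a minimizer. If two minimizers in different classes were at distance
less than `1 / 2` at all times, the difference of their angles would stay within `π / 2` of one
multiple of `2π`, and the total variations of the two angles would be equal
(`HasAngle.sub_eq_sub`). So they are apart at some time, and since paths of bounded action are
equicontinuous, they are apart on an interval of fixed length, which bounds their `L²` distance from
below (`IsH2Path.le_eLpNorm_sub`). Their difference is in `L²` because `W` grows quadratically at
the wells (`Connects.memLp_sub`).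

The remaining ingredient holds for any nondegenerate double well: the action is minimized over the
paths that connect the wells, and the minimizers are the minimal heteroclinics. Existence is the
direct method (`IsDoubleWell.exists_minimizer`). Compactness could fail by a splitting of the
transition; but an almost optimal path that comes near a well with small velocity is trapped there,
as one sees by comparison with a Hermite interpolation to the well, and hence the transition time of
almost optimal paths is bounded (`IsDoubleWell.exists_transition_time`). The first variation,
integrated twice by parts, shows that `u''` of a minimizer is `βu` minus a second primitive of
`∇W(u)` plus an affine function, whence `u ∈ C⁴` solves the equation (`Connects.exists_regular`);
the equation and the limits of `u` force the derivatives to vanish at `±∞`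
(`tendsto_deriv_zero_atTop`, `Connects.mem_minimalHeteroclinics`).
-/

noncomputable section

variable {m : ℕ}

/-! ### Paths with a locally integrable second derivative -/

/-- `u` is differentiable with derivative `v`, and `v` is a primitive of the locally integrable
map `w`. This pointwise form of `u ∈ W^{2,1}_loc` replaces weak derivatives in the arguments below;
square integrability of `w` follows from finiteness of the action. -/
structure IsH2Path (u v w : ℝ → RVec m) : Prop where
  hasDerivAt : ∀ x, HasDerivAt u (v x) x
  locallyIntegrable : LocallyIntegrable w
  sub_eq : ∀ x y, v y - v x = ∫ t in x..y, w t

namespace IsH2Path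

variable {u v w p q r : ℝ → RVec m}

lemma continuous (h : IsH2Path u v w) : Continuous u :=
  continuous_iff_continuousAt.2 fun x => (h.hasDerivAt x).continuousAt

lemma intervalIntegrable (h : IsH2Path u v w) (x y : ℝ) : IntervalIntegrable w volume x y :=
  (h.locallyIntegrable.integrableOn_isCompact isCompact_uIcc).intervalIntegrable

lemma eq_add (h : IsH2Path u v w) (x y : ℝ) : v y = v x + ∫ t in x..y, w t := by
  rw [← h.sub_eq x y]; abel

lemma continuous_deriv (h : IsH2Path u v w) : Continuous v := by
  have : v = fun y => v 0 + ∫ t in (0 : ℝ)..y, w t := funext fun y => h.eq_add 0 y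
  rw [this]
  exact continuous_const.add
    (intervalIntegral.continuous_primitive (fun a b => h.intervalIntegrable a b) 0)

lemma aestronglyMeasurable (h : IsH2Path u v w) : AEStronglyMeasurable w volume :=
  h.locallyIntegrable.aestronglyMeasurable

lemma sub_eq_integral (h : IsH2Path u v w) (x y : ℝ) : u y - u x = ∫ t in x..y, v t :=
  (intervalIntegral.integral_eq_sub_of_hasDerivAt (fun t _ => h.hasDerivAt t)
    (h.continuous_deriv.intervalIntegrable x y)).symm

lemma of_base (s : ℝ) (hd : ∀ x, HasDerivAt u (v x) x) (hw : LocallyIntegrable w)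
    (hv : ∀ y, v y - v s = ∫ t in s..y, w t) : IsH2Path u v w where
  hasDerivAt := hd
  locallyIntegrable := hw
  sub_eq x y := by
    have hi : ∀ c d, IntervalIntegrable w volume c d := fun c d =>
      (hw.integrableOn_isCompact isCompact_uIcc).intervalIntegrable
    rw [← intervalIntegral.integral_interval_sub_left (hi s y) (hi s x), ← hv x, ← hv y]
    abel

lemma of_hasDerivAt (hd : ∀ x, HasDerivAt u (v x) x) (hv : ∀ x, HasDerivAt v (w x) x)
    (hw : Continuous w) : IsH2Path u v w where
  hasDerivAt := hd
  locallyIntegrable := hw.locallyIntegrable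
  sub_eq x y := (intervalIntegral.integral_eq_sub_of_hasDerivAt (fun t _ => hv t)
    (hw.intervalIntegrable x y)).symm

lemma const (a : RVec m) : IsH2Path (fun _ => a) (fun _ => 0) (fun _ => 0) :=
  of_hasDerivAt (fun x => hasDerivAt_const x a) (fun x => hasDerivAt_const x 0) continuous_const

lemma comp_add (h : IsH2Path u v w) (s : ℝ) :
    IsH2Path (fun x => u (x + s)) (fun x => v (x + s)) (fun x => w (x + s)) where
  hasDerivAt x := (h.hasDerivAt (x + s)).comp_add_const x s
  locallyIntegrable := by
    rw [locallyIntegrable_iff]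
    intro K hK
    have h1 : IntegrableOn w ((fun x => x + s) '' K) :=
      h.locallyIntegrable.integrableOn_isCompact (hK.image (by fun_prop))
    exact ((measurePreserving_add_right volume s).integrableOn_image
      (Homeomorph.addRight s).measurableEmbedding).1 h1
  sub_eq x y := by
    rw [intervalIntegral.integral_comp_add_right (fun t => w t) s]
    exact h.sub_eq _ _

lemma comp_neg (h : IsH2Path u v w) :
    IsH2Path (fun x => u (-x)) (fun x => -v (-x)) (fun x => w (-x)) where
  hasDerivAt x := by
    simpa [Function.comp_def] using! (h.hasDerivAt (-x)).scomp x (hasDerivAt_neg x)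
  locallyIntegrable := by
    rw [locallyIntegrable_iff]
    intro K hK
    have h1 : IntegrableOn w ((fun x => -x) '' K) :=
      h.locallyIntegrable.integrableOn_isCompact (hK.image (by fun_prop))
    exact ((Measure.measurePreserving_neg volume).integrableOn_image
      (Homeomorph.neg ℝ).measurableEmbedding).1 h1
  sub_eq x y := by
    rw [intervalIntegral.integral_comp_neg (fun t => w t), ← h.sub_eq]
    abel

lemma add (h : IsH2Path u v w) (h' : IsH2Path p q r) :
    IsH2Path (fun x => u x + p x) (fun x => v x + q x) (fun x => w x + r x) where
  hasDerivAt x := (h.hasDerivAt x).add (h'.hasDerivAt x)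
  locallyIntegrable := h.locallyIntegrable.add h'.locallyIntegrable
  sub_eq x y := by
    rw [intervalIntegral.integral_add (h.intervalIntegrable x y) (h'.intervalIntegrable x y),
      ← h.sub_eq, ← h'.sub_eq]
    abel

lemma map (h : IsH2Path u v w) (L : RVec m →L[ℝ] RVec m) :
    IsH2Path (fun x => L (u x)) (fun x => L (v x)) (fun x => L (w x)) where
  hasDerivAt x := L.hasFDerivAt.comp_hasDerivAt x (h.hasDerivAt x)
  locallyIntegrable := by
    rw [locallyIntegrable_iff]
    intro K hK
    exact L.integrable_comp (h.locallyIntegrable.integrableOn_isCompact hK)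
  sub_eq x y := by
    rw [L.intervalIntegral_comp_comm (h.intervalIntegrable x y), ← h.sub_eq, map_sub]

lemma const_smul (h : IsH2Path u v w) (t : ℝ) :
    IsH2Path (fun x => t • u x) (fun x => t • v x) (fun x => t • w x) :=
  h.map (t • ContinuousLinearMap.id ℝ (RVec m))

/-- Two paths with the same position and velocity at time `s` can be glued there. -/
lemma glue (h : IsH2Path u v w) (h' : IsH2Path p q r) {s : ℝ} (h0 : u s = p s) (h1 : v s = q s) :
    IsH2Path (fun x => if x ≤ s then u x else p x) (fun x => if x ≤ s then v x else q x)
      (fun x => if x ≤ s then w x else r x) := by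
  refine of_base s (fun x => ?_) ?_ (fun y => ?_)
  · rcases lt_trichotomy x s with hx | rfl | hx
    · simp only [hx.le, if_true]
      refine (h.hasDerivAt x).congr_of_eventuallyEq ?_
      filter_upwards [Iio_mem_nhds hx] with y hy
      simp [le_of_lt (mem_Iio.1 hy)]
    · simp only [le_refl, if_true]
      have hl : HasDerivWithinAt (fun y => if y ≤ x then u y else p y) (v x) (Iic x) x :=
        (h.hasDerivAt x).hasDerivWithinAt.congr (fun y hy => by simp [mem_Iic.1 hy]) (by simp)
      have hr : HasDerivWithinAt (fun y => if y ≤ x then u y else p y) (v x) (Ici x) x := by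
        rw [h1]
        refine (h'.hasDerivAt x).hasDerivWithinAt.congr (fun y hy => ?_) (by simp [h0])
        rcases (mem_Ici.1 hy).eq_or_lt with rfl | hy
        · simp [h0]
        · simp [not_le.2 hy]
      simpa using hl.union hr
    · simp only [not_le.2 hx, if_false]
      refine (h'.hasDerivAt x).congr_of_eventuallyEq ?_
      filter_upwards [Ioi_mem_nhds hx] with y hy
      simp [not_le.2 (mem_Ioi.1 hy)]
  · rw [locallyIntegrable_iff]
    intro K hK
    exact Integrable.piecewise (s := Iic s) measurableSet_Iic
      (h.locallyIntegrable.integrableOn_isCompact hK).integrableOn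
      (h'.locallyIntegrable.integrableOn_isCompact hK).integrableOn
  · rcases le_or_gt y s with hy | hy
    · simp only [hy, le_refl, if_true]
      rw [h.sub_eq]
      refine intervalIntegral.integral_congr fun t ht => ?_
      rw [uIcc_of_ge hy] at ht
      simp [ht.2]
    · simp only [not_le.2 hy, le_refl, if_true, if_false]
      rw [h1, h'.sub_eq]
      refine intervalIntegral.integral_congr_ae (Eventually.of_forall fun t ht => ?_)
      rw [uIoc_of_le hy.le] at ht
      simp [not_le.2 ht.1]

end IsH2Path

/-! ### Integration by parts -/

/-- The `i`-th coordinate as a continuous linear form. -/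
abbrev coordL (i : Fin m) : RVec m →L[ℝ] ℝ := EuclideanSpace.proj i

lemma coord_intervalIntegral {g : ℝ → RVec m} {a b : ℝ} (hg : IntervalIntegrable g volume a b)
    (i : Fin m) : (∫ t in a..b, g t) i = ∫ t in a..b, g t i :=
  ((coordL i).intervalIntegral_comp_comm hg).symm

lemma IntervalIntegrable.coord {g : ℝ → RVec m} {a b : ℝ} (hg : IntervalIntegrable g volume a b)
    (i : Fin m) : IntervalIntegrable (fun t => g t i) volume a b :=
  ⟨(coordL i).integrable_comp hg.1,
    (coordL i).integrable_comp hg.2⟩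

/-- Integration by parts for a `C¹` function and a primitive of an integrable function. -/
lemma integral_deriv_mul_primitive {p p' Q g : ℝ → ℝ} {a b : ℝ} (hab : a ≤ b)
    (hp : ∀ x, HasDerivAt p (p' x) x)
    (hp' : Continuous p') (hg : IntervalIntegrable g volume a b)
    (hQ : ∀ x ∈ Icc a b, Q x = Q a + ∫ t in a..x, g t) :
    ∫ x in a..b, p' x * Q x = p b * Q b - p a * Q a - ∫ x in a..b, p x * g x := by
  have hpc : ContDiff ℝ 1 p := by
    rw [contDiff_one_iff_deriv]
    refine ⟨fun x => (hp x).differentiableAt, ?_⟩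
    rwa [show deriv p = p' from funext fun x => (hp x).deriv]
  have hpac : AbsolutelyContinuousOnInterval p a b :=
    hpc.contDiffOn.absolutelyContinuousOnInterval
  set G : ℝ → ℝ := fun x => ∫ t in a..x, g t
  have hG : AbsolutelyContinuousOnInterval G a b :=
    hg.absolutelyContinuousOnInterval_intervalIntegral (by simp)
  have h1 := AbsolutelyContinuousOnInterval.integral_mul_deriv_eq_deriv_mul hpac hG
  have h2 : ∫ x in a..b, p x * deriv G x = ∫ x in a..b, p x * g x := by
    refine intervalIntegral.integral_congr_ae ?_
    filter_upwards [hg.ae_hasDerivAt_integral] with x hx hx'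
    rw [(hx (uIoc_subset_uIcc hx') a (by simp)).deriv]
  have h3 : ∫ x in a..b, deriv p x * G x = ∫ x in a..b, p' x * G x := by
    simp_rw [show deriv p = p' from funext fun x => (hp x).deriv]
  have h4 : ∫ x in a..b, p' x * Q x = ∫ x in a..b, (p' x * Q a + p' x * G x) := by
    refine intervalIntegral.integral_congr fun x hx => ?_
    rw [uIcc_of_le hab] at hx
    simp only [hQ x hx]; ring
  have hGc : ContinuousOn G (uIcc a b) := hG.continuousOn
  have h5 : ∫ x in a..b, p' x = p b - p a :=
    intervalIntegral.integral_eq_sub_of_hasDerivAt (fun t _ => hp t)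
      (hp'.intervalIntegrable a b)
  have i1 : IntervalIntegrable (fun x => p' x * Q a) volume a b :=
    (hp'.mul continuous_const).intervalIntegrable a b
  have i2 : IntervalIntegrable (fun x => p' x * G x) volume a b :=
    ContinuousOn.intervalIntegrable (hp'.continuousOn.mul hGc)
  rw [h4, intervalIntegral.integral_add i1 i2, intervalIntegral.integral_mul_const, h5]
  rw [h2, h3] at h1
  have hQb := hQ b ⟨hab, le_rfl⟩
  have hGa : G a = 0 := by simp [G]
  have hGb : Q b = Q a + G b := hQb
  rw [hGb]
  rw [hGa] at h1
  linarith

/-- Integration by parts, in the form of inner products of vector valued functions. -/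
lemma integral_inner_deriv_primitive {p p' Q g : ℝ → RVec m} {a b : ℝ} (hab : a ≤ b)
    (hp : ∀ x, HasDerivAt p (p' x) x) (hp' : Continuous p') (hg : IntervalIntegrable g volume a b)
    (hQ : ∀ x ∈ Icc a b, Q x = Q a + ∫ t in a..x, g t) :
    ∫ x in a..b, inner ℝ (p' x) (Q x) =
      inner ℝ (p b) (Q b) - inner ℝ (p a) (Q a) - ∫ x in a..b, inner ℝ (p x) (g x) := by
  have hpc : Continuous p := continuous_iff_continuousAt.2 fun x => (hp x).continuousAt
  have hQc : ContinuousOn Q (uIcc a b) := by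
    refine ContinuousOn.congr (f := fun x => Q a + ∫ t in a..x, g t) ?_
      (fun x hx => hQ x (by rwa [uIcc_of_le hab] at hx))
    exact continuousOn_const.add
      (intervalIntegral.continuousOn_primitive_interval' hg (by simp))
  have key : ∀ i : Fin m, ∫ x in a..b, p' x i * Q x i =
      p b i * Q b i - p a i * Q a i - ∫ x in a..b, p x i * g x i := by
    intro i
    refine integral_deriv_mul_primitive (p := fun x => p x i) (p' := fun x => p' x i) hab
      (fun x => ?_) (by fun_prop) (hg.coord i) ?_
    · exact (coordL i).hasFDerivAt.comp_hasDerivAt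
        x (hp x)
    · intro x hx
      rw [← coord_intervalIntegral (hg.mono_set (by
        rw [uIcc_of_le hab, uIcc_of_le hx.1]; exact Icc_subset_Icc le_rfl hx.2)), hQ x hx]
      rfl
  have hin : ∀ y z : RVec m, inner ℝ y z = ∑ i, y i * z i := by
    intro y z
    simp [PiLp.inner_apply, mul_comm]
  simp only [hin]
  rw [intervalIntegral.integral_finsetSum, intervalIntegral.integral_finsetSum,
    ← Finset.sum_sub_distrib, ← Finset.sum_sub_distrib]
  · exact Finset.sum_congr rfl fun i _ => key i
  · intro i _
    have : Continuous fun x => p x i := by fun_prop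
    exact (hg.coord i).continuousOn_mul this.continuousOn
  · intro i _
    refine ContinuousOn.intervalIntegrable ?_
    have : Continuous fun x => p' x i := by fun_prop
    exact this.continuousOn.mul
      ((coordL i).continuous.comp_continuousOn hQc)

/-- Integration by parts for a scalar `C¹` factor. -/
lemma integral_deriv_smul_primitive {p p' : ℝ → ℝ} {Q g : ℝ → RVec m} {a b : ℝ} (hab : a ≤ b)
    (hp : ∀ x, HasDerivAt p (p' x) x) (hp' : Continuous p') (hg : IntervalIntegrable g volume a b)
    (hQ : ∀ x ∈ Icc a b, Q x = Q a + ∫ t in a..x, g t) :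
    ∫ x in a..b, p' x • Q x = p b • Q b - p a • Q a - ∫ x in a..b, p x • g x := by
  have hpc : Continuous p := continuous_iff_continuousAt.2 fun x => (hp x).continuousAt
  have hQc : ContinuousOn Q (uIcc a b) := by
    refine ContinuousOn.congr (f := fun x => Q a + ∫ t in a..x, g t) ?_
      (fun x hx => hQ x (by rwa [uIcc_of_le hab] at hx))
    exact continuousOn_const.add
      (intervalIntegral.continuousOn_primitive_interval' hg (by simp))
  ext i
  have key : ∫ x in a..b, p' x * Q x i =
      p b * Q b i - p a * Q a i - ∫ x in a..b, p x * g x i := by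
    refine integral_deriv_mul_primitive hab hp hp' (hg.coord i) ?_
    intro x hx
    rw [← coord_intervalIntegral (hg.mono_set (by
      rw [uIcc_of_le hab, uIcc_of_le hx.1]; exact Icc_subset_Icc le_rfl hx.2)), hQ x hx]
    rfl
  simp only [PiLp.sub_apply, PiLp.smul_apply, smul_eq_mul]
  rw [coord_intervalIntegral, coord_intervalIntegral]
  · exact key
  · exact hg.continuousOn_smul hpc.continuousOn
  · exact ContinuousOn.intervalIntegrable (hp'.continuousOn.smul hQc)

/-! ### Weak derivatives -/

lemma integral_eq_intervalIntegral_of_support {E : Type*} [NormedAddCommGroup E] [NormedSpace ℝ E]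
    {f : ℝ → E} {R : ℝ} (hf : ∀ x, R ≤ |x| → f x = 0) :
    ∫ x, f x = ∫ x in (-R)..R, f x := by
  rcases le_or_gt R 0 with hR | hR
  · have : f = 0 := funext fun x => hf x (hR.trans (abs_nonneg x))
    simp [this]
  refine (intervalIntegral.integral_eq_integral_of_support_subset ?_).symm
  intro x hx
  by_contra hn
  refine hx (hf x ?_)
  by_contra hlt
  have := abs_lt.1 (not_le.1 hlt)
  exact hn ⟨this.1, this.2.le⟩

lemma exists_bound_of_hasCompactSupport {E : Type*} [Zero E] {f : ℝ → E}
    (hf : HasCompactSupport f) : ∃ R > 0, ∀ x, R ≤ |x| → f x = 0 := by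
  obtain ⟨R, hR⟩ := hf.isCompact.isBounded.subset_ball 0
  refine ⟨max R 1, by positivity, fun x hx => ?_⟩
  by_contra hne
  have := hR (subset_tsupport f hne)
  rw [mem_ball_zero_iff, Real.norm_eq_abs] at this
  exact absurd ((le_max_left R 1).trans hx) (not_le.2 this)

/-- The du Bois-Reymond lemma: a locally integrable function that is orthogonal to the derivatives
of all test functions is constant. -/
lemma ae_eq_const_of_integral_deriv_smul_eq_zero {f : ℝ → RVec m} (hf : LocallyIntegrable f)
    (h : ∀ η : ℝ → ℝ, ContDiff ℝ ∞ η → HasCompactSupport η → ∫ x, deriv η x • f x = 0) :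
    ∃ c : RVec m, ∀ᵐ x, f x = c := by
  let ψ₀ : ContDiffBump (0 : ℝ) := ⟨1, 2, one_pos, one_lt_two⟩
  set ψ : ℝ → ℝ := ψ₀.normed volume
  have hψ : ContDiff ℝ ∞ ψ := ψ₀.contDiff_normed
  have hψs : HasCompactSupport ψ := ψ₀.hasCompactSupport_normed
  have hψ1 : ∫ x, ψ x = 1 := ψ₀.integral_normed
  have hint : ∀ g : ℝ → ℝ, Continuous g → HasCompactSupport g →
      Integrable (fun x => g x • f x) := fun g hg hgs =>
    hf.integrable_smul_left_of_hasCompactSupport hg hgs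
  set c : RVec m := ∫ x, ψ x • f x
  refine ⟨c, ?_⟩
  have hsub : LocallyIntegrable (fun x => f x - c) := hf.sub (locallyIntegrable_const c)
  refine (ae_eq_zero_of_integral_contDiff_smul_eq_zero hsub ?_).mono
    fun x hx => sub_eq_zero.1 hx
  intro ζ hζ hζs
  -- `ζ - (∫ ζ) ψ` has mean zero, so it is the derivative of a test function
  set I : ℝ := ∫ x, ζ x
  set g : ℝ → ℝ := fun x => ζ x - I * ψ x
  have hg : ContDiff ℝ ∞ g := hζ.sub (contDiff_const.mul hψ)
  obtain ⟨R, hR0, hR⟩ := exists_bound_of_hasCompactSupport hζs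
  obtain ⟨R', hR'0, hR'⟩ := exists_bound_of_hasCompactSupport hψs
  set S := max R R'
  have hgS : ∀ x, S ≤ |x| → g x = 0 := fun x hx => by
    simp [g, hR x ((le_max_left _ _).trans hx), hR' x ((le_max_right _ _).trans hx)]
  have hζi : Integrable ζ := hζ.continuous.integrable_of_hasCompactSupport hζs
  have hψi : Integrable ψ := hψ.continuous.integrable_of_hasCompactSupport hψs
  have hg0 : ∫ x in (-S)..S, g x = 0 := by
    rw [← integral_eq_intervalIntegral_of_support hgS,
      integral_sub hζi (hψi.const_mul I), integral_const_mul, hψ1]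
    simp [I]
  set η : ℝ → ℝ := fun x => ∫ t in (-S)..x, g t
  have hηd : ∀ x, HasDerivAt η (g x) x := fun x =>
    intervalIntegral.integral_hasDerivAt_right (hg.continuous.intervalIntegrable _ _)
      hg.continuous.stronglyMeasurable.stronglyMeasurableAtFilter hg.continuous.continuousAt
  have hη : ContDiff ℝ ∞ η := by
    rw [contDiff_infty_iff_deriv]
    refine ⟨fun x => (hηd x).differentiableAt, ?_⟩
    rwa [show deriv η = g from funext fun x => (hηd x).deriv]
  have hηs : HasCompactSupport η := by
    refine HasCompactSupport.intro (K := Icc (-S) S) isCompact_Icc fun x hx => ?_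
    rcases lt_or_ge x (-S) with hx1 | hx1
    · have : ∫ t in x..(-S), g t = ∫ t in x..(-S), (0 : ℝ) := by
        refine intervalIntegral.integral_congr fun t ht => ?_
        rw [uIcc_of_le hx1.le] at ht
        exact hgS t (le_trans (by linarith [ht.2]) (neg_le_abs t))
      simp only [η]
      rw [intervalIntegral.integral_symm, this]; simp
    · have hx2 : S < x := by
        by_contra hn
        exact hx ⟨hx1, not_lt.1 hn⟩
      have h1 : ∫ t in S..x, g t = ∫ t in S..x, (0 : ℝ) := by
        refine intervalIntegral.integral_congr fun t ht => ?_
        rw [uIcc_of_le hx2.le] at ht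
        exact hgS t (ht.1.trans (le_abs_self t))
      simp only [η]
      rw [← intervalIntegral.integral_add_adjacent_intervals
        (hg.continuous.intervalIntegrable _ S) (hg.continuous.intervalIntegrable S _), hg0, h1]
      simp
  have key := h η hη hηs
  rw [show deriv η = g from funext fun x => (hηd x).deriv] at key
  have e1 : ∫ x, g x • f x = (∫ x, ζ x • f x) - I • c := by
    have : ∀ x, g x • f x = ζ x • f x - I • (ψ x • f x) := fun x => by
      simp only [g, sub_smul, mul_smul]
    simp_rw [this]
    have hi : Integrable (fun x => I • ψ x • f x) := (hint ψ hψ.continuous hψs).smul I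
    rw [integral_sub (hint ζ hζ.continuous hζs) hi, integral_smul]
  have e2 : ∫ x, ζ x • (f x - c) = (∫ x, ζ x • f x) - I • c := by
    simp_rw [smul_sub]
    rw [integral_sub (hint ζ hζ.continuous hζs) (hζi.smul_const c), integral_smul_const]
  rw [e2, ← e1, key]

/-- A function with a locally integrable weak derivative is almost everywhere equal to a primitive
of it. -/
lemma HasWeakDeriv.ae_eq {f g : ℝ → RVec m} (h : HasWeakDeriv f g) :
    ∃ c : RVec m, ∀ᵐ x, f x = c + ∫ t in (0 : ℝ)..x, g t := by
  have hgi : ∀ a b, IntervalIntegrable g volume a b := fun a b =>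
    (h.locallyIntegrable_deriv.integrableOn_isCompact isCompact_uIcc).intervalIntegrable
  set G : ℝ → RVec m := fun x => ∫ t in (0 : ℝ)..x, g t
  have hGc : Continuous G := intervalIntegral.continuous_primitive hgi 0
  obtain ⟨c, hc⟩ := ae_eq_const_of_integral_deriv_smul_eq_zero (f := fun x => f x - G x)
    (h.locallyIntegrable.sub hGc.locallyIntegrable) (by
      intro η hη hηs
      have hdη : Continuous (deriv η) := hη.continuous_deriv (by simp)
      have hdηs : HasCompactSupport (deriv η) := hηs.deriv
      obtain ⟨R, hR0, hR⟩ := exists_bound_of_hasCompactSupport hηs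
      obtain ⟨R', -, hR'⟩ := exists_bound_of_hasCompactSupport hdηs
      set S := max R R'
      have hS : ∀ x, S ≤ |x| → η x = 0 := fun x hx => hR x ((le_max_left _ _).trans hx)
      have hS' : ∀ x, S ≤ |x| → deriv η x = 0 := fun x hx => hR' x ((le_max_right _ _).trans hx)
      have hS0 : 0 < S := lt_max_of_lt_left hR0
      simp_rw [smul_sub]
      rw [integral_sub (h.locallyIntegrable.integrable_smul_left_of_hasCompactSupport hdη hdηs)
        (hGc.locallyIntegrable.integrable_smul_left_of_hasCompactSupport hdη hdηs),
        h.integral_eq η hη hηs,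
        integral_eq_intervalIntegral_of_support (f := fun x => deriv η x • G x) (R := S)
          (fun x hx => by simp [hS' x hx]),
        integral_eq_intervalIntegral_of_support (f := fun x => η x • g x) (R := S)
          (fun x hx => by simp [hS x hx]),
        integral_deriv_smul_primitive (p := η) (g := g) (by linarith)
          (fun x => (hη.differentiable (by simp) x).hasDerivAt) hdη (hgi _ _)]
      · rw [hS S (le_abs_self S), hS (-S) (by simpa using le_abs_self S)]
        simp
      · intro x _
        simp only [G]
        rw [intervalIntegral.integral_add_adjacent_intervals (hgi _ _) (hgi _ _)])
  exact ⟨c, hc.mono fun x hx => by rw [← hx]; abel⟩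

/-- An `H²_loc` map is differentiable, and its weak derivatives are, up to null sets, its
derivative and the density of its derivative. -/
lemma IsH2loc.exists_isH2Path {u u₁ u₂ : ℝ → RVec m} (h : IsH2loc u u₁ u₂) :
    ∃ v, u₁ =ᵐ[volume] v ∧ IsH2Path u v u₂ := by
  obtain ⟨c₁, h₁⟩ := h.weakDeriv₂.ae_eq
  obtain ⟨c₀, h₀⟩ := h.weakDeriv₁.ae_eq
  have hi : ∀ a b, IntervalIntegrable u₂ volume a b := fun a b =>
    (h.weakDeriv₂.locallyIntegrable_deriv.integrableOn_isCompact isCompact_uIcc).intervalIntegrable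
  set v : ℝ → RVec m := fun x => c₁ + ∫ t in (0 : ℝ)..x, u₂ t
  have hv : Continuous v := continuous_const.add (intervalIntegral.continuous_primitive hi 0)
  have hprim : ∀ x, HasDerivAt (fun x => c₀ + ∫ t in (0 : ℝ)..x, v t) (v x) x := fun x =>
    (intervalIntegral.integral_hasDerivAt_right (hv.intervalIntegrable _ _)
      hv.stronglyMeasurable.stronglyMeasurableAtFilter hv.continuousAt).const_add c₀
  have hu : u = fun x => c₀ + ∫ t in (0 : ℝ)..x, v t := by
    refine h.continuous.ae_eq_iff_eq volume
      (continuous_iff_continuousAt.2 fun x => (hprim x).continuousAt) |>.1 ?_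
    filter_upwards [h₀] with x hx
    rw [hx]
    congr 1
    refine intervalIntegral.integral_congr_ae ?_
    filter_upwards [h₁] with t ht _ using ht
  refine ⟨v, h₁, IsH2Path.of_base 0 (fun x => ?_) h.weakDeriv₂.locallyIntegrable_deriv ?_⟩
  · rw [hu]; exact hprim x
  · intro y
    simp [v]

lemma HasWeakDeriv.of_hasDerivAt {f g : ℝ → RVec m} (h : ∀ x, HasDerivAt f (g x) x)
    (hg : Continuous g) : HasWeakDeriv f g := by
  have hf : Continuous f := continuous_iff_continuousAt.2 fun x => (h x).continuousAt
  refine ⟨hf.locallyIntegrable, hg.locallyIntegrable, fun η hη hηs => ?_⟩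
  have hdη : Continuous (deriv η) := hη.continuous_deriv (by simp)
  have hdηs : HasCompactSupport (deriv η) := hηs.deriv
  obtain ⟨R, hR0, hR⟩ := exists_bound_of_hasCompactSupport hηs
  obtain ⟨R', -, hR'⟩ := exists_bound_of_hasCompactSupport hdηs
  set S := max R R'
  have hS : ∀ x, S ≤ |x| → η x = 0 := fun x hx => hR x ((le_max_left _ _).trans hx)
  have hS' : ∀ x, S ≤ |x| → deriv η x = 0 := fun x hx => hR' x ((le_max_right _ _).trans hx)
  have hS0 : 0 < S := lt_max_of_lt_left hR0
  rw [integral_eq_intervalIntegral_of_support (f := fun x => deriv η x • f x) (R := S)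
      (fun x hx => by simp [hS' x hx]),
    integral_eq_intervalIntegral_of_support (f := fun x => η x • g x) (R := S)
      (fun x hx => by simp [hS x hx]),
    integral_deriv_smul_primitive (p := η) (g := g) (by linarith)
      (fun x => (hη.differentiable (by simp) x).hasDerivAt) hdη (hg.intervalIntegrable _ _)]
  · rw [hS S (le_abs_self S), hS (-S) (by simpa using le_abs_self S)]
    simp
  · intro x _
    rw [intervalIntegral.integral_eq_sub_of_hasDerivAt (fun t _ => h t)
      (hg.intervalIntegrable _ _)]
    abel

lemma memL2loc_of_continuous {f : ℝ → RVec m} (hf : Continuous f) : MemL2loc f := by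
  intro K hK
  have : IsFiniteMeasure (volume.restrict K) := ⟨by simpa using hK.measure_lt_top⟩
  obtain ⟨C, hC⟩ := hK.exists_bound_of_continuousOn hf.continuousOn
  exact MemLp.of_bound hf.aestronglyMeasurable C
    ((ae_restrict_iff' hK.measurableSet).2 (Eventually.of_forall hC))

/-- A `C²` map lies in `H²_loc`. -/
lemma IsH2loc.of_hasDerivAt {u v w : ℝ → RVec m} (hu : ∀ x, HasDerivAt u (v x) x)
    (hv : ∀ x, HasDerivAt v (w x) x) (hw : Continuous w) : IsH2loc u v w := by
  have hvc : Continuous v := continuous_iff_continuousAt.2 fun x => (hv x).continuousAt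
  have huc : Continuous u := continuous_iff_continuousAt.2 fun x => (hu x).continuousAt
  exact ⟨huc, memL2loc_of_continuous huc, memL2loc_of_continuous hvc, memL2loc_of_continuous hw,
    .of_hasDerivAt hu hvc, .of_hasDerivAt hv hw⟩

/-! ### Nondegenerate double well potentials -/

namespace IsDoubleWell

variable {W : RVec m → ℝ} {a b : RVec m}

lemma symm (h : IsDoubleWell W a b) : IsDoubleWell W b a where
  contDiff := h.contDiff
  nonneg := h.nonneg
  ne := h.ne.symm
  zero_iff u := by rw [h.zero_iff, or_comm]
  hessian := by
    obtain ⟨r, hr, c, hc, H⟩ := h.hessian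
    exact ⟨r, hr, c, hc, fun u hu => H u hu.symm⟩
  liminf_pos := h.liminf_pos

lemma continuous (h : IsDoubleWell W a b) : Continuous W := h.contDiff.continuous

lemma left_eq_zero (h : IsDoubleWell W a b) : W a = 0 := (h.zero_iff a).2 (.inl rfl)

lemma right_eq_zero (h : IsDoubleWell W a b) : W b = 0 := (h.zero_iff b).2 (.inr rfl)

/-- A point where the potential is small is close to one of the wells. -/
lemma exists_near_of_lt (h : IsDoubleWell W a b) {δ : ℝ} (hδ : 0 < δ) :
    ∃ c > 0, ∀ u, W u < c → ‖u - a‖ < δ ∨ ‖u - b‖ < δ := by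
  obtain ⟨l, hl0, hl⟩ := EReal.lt_iff_exists_real_btwn.1 h.liminf_pos
  have hl0' : 0 < l := by exact_mod_cast hl0
  have hev := eventually_lt_of_lt_liminf hl
  rw [Metric.cobounded_eq_cocompact] at hev
  obtain ⟨K, hK, hKl⟩ := mem_cocompact.1 hev
  set S : Set (RVec m) := K ∩ ({u | δ ≤ ‖u - a‖} ∩ {u | δ ≤ ‖u - b‖})
  have hS : IsCompact S := hK.inter_right
    ((isClosed_le continuous_const (by fun_prop)).inter
      (isClosed_le continuous_const (by fun_prop)))
  obtain ⟨c, hc0, hc⟩ : ∃ c > 0, ∀ u ∈ S, c ≤ W u := by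
    rcases S.eq_empty_or_nonempty with hE | hne
    · exact ⟨1, one_pos, by simp [hE]⟩
    · obtain ⟨u₀, hu₀, hmin⟩ := hS.exists_isMinOn hne h.continuous.continuousOn
      refine ⟨W u₀, lt_of_le_of_ne (h.nonneg u₀) fun h0 => ?_, fun u hu => hmin hu⟩
      rcases (h.zero_iff u₀).1 h0.symm with rfl | rfl
      · have := hu₀.2.1; simp at this; linarith
      · have := hu₀.2.2; simp at this; linarith
  refine ⟨min c l, lt_min hc0 hl0', fun u hu => ?_⟩
  by_contra! hn
  by_cases huK : u ∈ K
  · exact absurd (hc u ⟨huK, hn⟩) (not_le.2 (hu.trans_le (min_le_left _ _)))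
  · have : (l : EReal) < (W u : EReal) := hKl huK
    exact absurd (EReal.coe_lt_coe_iff.1 this) (not_lt.2 (hu.le.trans (min_le_right _ _)))

/-- Quadratic growth at a well. -/
lemma exists_quadratic_le (h : IsDoubleWell W a b) :
    ∃ r > 0, ∃ c > 0, ∀ u, ‖u - b‖ ≤ r → c * ‖u - b‖ ^ 2 ≤ W u := by
  obtain ⟨r, hr, c, hc, H⟩ := h.hessian
  refine ⟨r, hr, c / 2, by positivity, fun u hu => ?_⟩
  set ν := u - b
  have hd1 : Differentiable ℝ W := h.contDiff.differentiable (by simp)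
  have hd2 : Differentiable ℝ (fderiv ℝ W) :=
    (h.contDiff.fderiv_right (m := 1) (by norm_num)).differentiable (by simp)
  have hpath : ∀ t : ℝ, HasDerivAt (fun t : ℝ => b + t • ν) ν t := fun t => by
    simpa using ((hasDerivAt_id t).smul_const ν).const_add b
  set g : ℝ → ℝ := fun t => W (b + t • ν)
  set g' : ℝ → ℝ := fun t => fderiv ℝ W (b + t • ν) ν
  have hg : ∀ t, HasDerivAt g (g' t) t := fun t =>
    (hd1 _).hasFDerivAt.comp_hasDerivAt t (hpath t)
  have hg' : ∀ t, HasDerivAt g' (fderiv ℝ (fderiv ℝ W) (b + t • ν) ν ν) t := fun t => by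
    have := (hd2 _).hasFDerivAt.comp_hasDerivAt t (hpath t)
    simpa using! this.clm_apply (hasDerivAt_const t ν)
  have hge : ∀ t ∈ Icc (0 : ℝ) 1, c * ‖ν‖ ^ 2 ≤ fderiv ℝ (fderiv ℝ W) (b + t • ν) ν ν := by
    intro t ht
    rcases eq_or_ne ν 0 with h0 | h0
    · simp [h0]
    have hn : 0 < ‖ν‖ := norm_pos_iff.2 h0
    have hin : ‖(b + t • ν) - b‖ ≤ r := by
      rw [add_sub_cancel_left, norm_smul, Real.norm_eq_abs, abs_of_nonneg ht.1]
      nlinarith [ht.2, hn]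
    have h1 := H (b + t • ν) (.inr hin) (‖ν‖⁻¹ • ν) (by
      rw [norm_smul, norm_inv, norm_norm, inv_mul_cancel₀ hn.ne'])
    rw [iteratedFDeriv_two_apply] at h1
    simp only [Matrix.cons_val_zero, Matrix.cons_val_one, map_smul,
      smul_apply, smul_eq_mul] at h1
    have h2 : ‖ν‖⁻¹ * (‖ν‖⁻¹ * fderiv ℝ (fderiv ℝ W) (b + t • ν) ν ν) * ‖ν‖ ^ 2
        = fderiv ℝ (fderiv ℝ W) (b + t • ν) ν ν := by field_simp
    rw [← h2]
    exact mul_le_mul_of_nonneg_right h1 (by positivity)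
  have hg'0 : g' 0 = 0 := by
    have hmin : IsLocalMin W b := by
      refine Eventually.of_forall fun x => ?_
      rw [h.right_eq_zero]; exact h.nonneg x
    simp [g', hmin.fderiv_eq_zero]
  have hg0 : g 0 = 0 := by simp [g, h.right_eq_zero]
  -- two integrations of the inequality `g'' ≥ c ‖ν‖²`
  have m1 : MonotoneOn (fun t => g' t - c * ‖ν‖ ^ 2 * t) (Icc 0 1) := by
    have hd : ∀ t, HasDerivAt (fun t => g' t - c * ‖ν‖ ^ 2 * t)
        (fderiv ℝ (fderiv ℝ W) (b + t • ν) ν ν - c * ‖ν‖ ^ 2) t := fun t => by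
      simpa using! (hg' t).sub ((hasDerivAt_id t).const_mul (c * ‖ν‖ ^ 2))
    refine monotoneOn_of_deriv_nonneg (convex_Icc 0 1)
      (fun t _ => (hd t).continuousAt.continuousWithinAt)
      (fun t _ => (hd t).differentiableAt.differentiableWithinAt) fun t ht => ?_
    rw [(hd t).deriv, sub_nonneg]
    exact hge t (interior_subset ht)
  have m2 : MonotoneOn (fun t => g t - c / 2 * ‖ν‖ ^ 2 * t ^ 2) (Icc 0 1) := by
    have hd : ∀ t, HasDerivAt (fun t => g t - c / 2 * ‖ν‖ ^ 2 * t ^ 2)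
        (g' t - c * ‖ν‖ ^ 2 * t) t := fun t => by
      convert! (hg t).sub ((hasDerivAt_pow 2 t).const_mul (c / 2 * ‖ν‖ ^ 2)) using 1
      simp; ring
    refine monotoneOn_of_deriv_nonneg (convex_Icc 0 1)
      (fun t _ => (hd t).continuousAt.continuousWithinAt)
      (fun t _ => (hd t).differentiableAt.differentiableWithinAt) fun t ht => ?_
    rw [(hd t).deriv]
    have := m1 (left_mem_Icc.2 zero_le_one) (interior_subset ht) (interior_subset ht).1
    simpa [hg'0] using this
  have := m2 (left_mem_Icc.2 zero_le_one) (right_mem_Icc.2 zero_le_one) zero_le_one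
  simp only [hg0] at this
  have e : g 1 = W u := by simp [g, ν]
  rw [e] at this
  linarith

end IsDoubleWell

/-! ### The energy of a path -/

/-- The integrand of the action. -/
def energyDensity (β : ℝ) (W : RVec m → ℝ) (u v w : ℝ → RVec m) (x : ℝ) : ℝ≥0∞ :=
  ENNReal.ofReal (1 / 2 * ‖w x‖ ^ 2 + β / 2 * ‖v x‖ ^ 2 + W (u x))

lemma action_eq (β : ℝ) (W : RVec m → ℝ) (u v w : ℝ → RVec m) :
    action β W u v w = ∫⁻ x, energyDensity β W u v w x := rfl

lemma setLIntegral_energyDensity_le (β : ℝ) (W : RVec m → ℝ) (u v w : ℝ → RVec m) (s : Set ℝ) :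
    ∫⁻ x in s, energyDensity β W u v w x ≤ action β W u v w :=
  setLIntegral_le_lintegral _ _

lemma le_energyDensity {β : ℝ} {W : RVec m → ℝ} {u v w : ℝ → RVec m} {x c : ℝ}
    (h : c ≤ β / 2 * ‖v x‖ ^ 2 + W (u x)) : ENNReal.ofReal c ≤ energyDensity β W u v w x :=
  ENNReal.ofReal_le_ofReal (by nlinarith [sq_nonneg ‖w x‖])

/-- Moving a distance `d` through a region where `W ≥ c` costs at least `d √(2βc)`. -/
lemma IsH2Path.crossing_cost_le {β c : ℝ} (hβ : 0 < β) (hc : 0 ≤ c) {W : RVec m → ℝ}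
    {u v w : ℝ → RVec m} (h : IsH2Path u v w) {x y : ℝ} (hxy : x ≤ y)
    (hW : ∀ t ∈ Icc x y, c ≤ W (u t)) :
    ENNReal.ofReal (√(2 * β * c) * ‖u y - u x‖) ≤
      ∫⁻ t in Icc x y, energyDensity β W u v w t := by
  set k := √(2 * β * c)
  have hk : k ^ 2 = 2 * β * c := Real.sq_sqrt (by positivity)
  have h1 : ENNReal.ofReal ‖u y - u x‖ ≤ ∫⁻ t in Icc x y, ENNReal.ofReal ‖v t‖ := by
    rw [h.sub_eq_integral, intervalIntegral.integral_of_le hxy, ← integral_Icc_eq_integral_Ioc]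
    simp only [ofReal_norm]
    exact enorm_integral_le_lintegral_enorm _
  calc ENNReal.ofReal (k * ‖u y - u x‖)
      = ENNReal.ofReal k * ENNReal.ofReal ‖u y - u x‖ := ENNReal.ofReal_mul (Real.sqrt_nonneg _)
    _ ≤ ENNReal.ofReal k * ∫⁻ t in Icc x y, ENNReal.ofReal ‖v t‖ := by gcongr
    _ = ∫⁻ t in Icc x y, ENNReal.ofReal k * ENNReal.ofReal ‖v t‖ := by
        rw [lintegral_const_mul' _ _ ENNReal.ofReal_ne_top]
    _ ≤ ∫⁻ t in Icc x y, energyDensity β W u v w t := by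
        refine setLIntegral_mono' measurableSet_Icc fun t ht => ?_
        rw [← ENNReal.ofReal_mul (Real.sqrt_nonneg _)]
        refine le_energyDensity ?_
        have h2 := hW t ht
        have h3 : β * (k * ‖v t‖) ≤ β * (β / 2 * ‖v t‖ ^ 2 + c) := by
          nlinarith [sq_nonneg (β * ‖v t‖ - k)]
        linarith [le_of_mul_le_mul_left h3 hβ]

/-- Between a time where a continuous function is at most `p` and a later time where it is at
least `q > p`, there is an interval on which it goes from `p` to `q` within `[p, q]`. -/
lemma exists_crossing {f : ℝ → ℝ} (hf : Continuous f) {x y p q : ℝ} (hxy : x ≤ y) (hpq : p < q)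
    (hx : f x ≤ p) (hy : q ≤ f y) :
    ∃ s t, x ≤ s ∧ s ≤ t ∧ t ≤ y ∧ f s = p ∧ f t = q ∧ ∀ z ∈ Icc s t, f z ∈ Icc p q := by
  set T : Set ℝ := Icc x y ∩ {z | q ≤ f z}
  have hTc : IsCompact T := isCompact_Icc.inter_right (isClosed_le continuous_const hf)
  obtain ⟨t, ht, htmin⟩ := hTc.exists_isLeast ⟨y, ⟨hxy, le_rfl⟩, hy⟩
  set S : Set ℝ := Icc x t ∩ {z | f z ≤ p}
  have hSc : IsCompact S := isCompact_Icc.inter_right (isClosed_le hf continuous_const)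
  obtain ⟨s, hs, hsmax⟩ := hSc.exists_isGreatest ⟨x, ⟨le_rfl, ht.1.1⟩, hx⟩
  have hlt : ∀ z, x ≤ z → z < t → f z < q := fun z hz hzt => by
    by_contra hn
    exact absurd (htmin ⟨⟨hz, hzt.le.trans ht.1.2⟩, not_lt.1 hn⟩) (not_le.2 hzt)
  have hgt : ∀ z, s < z → z ≤ t → p < f z := fun z hz hzt => by
    by_contra hn
    exact absurd (hsmax ⟨⟨hs.1.1.trans hz.le, hzt⟩, not_lt.1 hn⟩) (not_le.2 hz)
  have hst : s < t := lt_of_le_of_ne hs.1.2 fun e => by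
    have h1 := hs.2; have h2 := ht.2
    simp only [mem_ofPred_eq] at h1 h2
    rw [e] at h1; linarith
  have hft : f t = q := by
    refine le_antisymm ?_ ht.2
    refine le_of_tendsto (hf.continuousWithinAt (s := Iio t) (x := t)) ?_
    filter_upwards [Ioo_mem_nhdsLT hst] with z hz
    exact (hlt z (hs.1.1.trans hz.1.le) hz.2).le
  have hfs : f s = p := by
    refine le_antisymm hs.2 ?_
    refine ge_of_tendsto (hf.continuousWithinAt (s := Ioi s) (x := s)) ?_
    filter_upwards [Ioo_mem_nhdsGT hst] with z hz
    exact (hgt z hz.1 hz.2.le).le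
  refine ⟨s, t, hs.1.1, hst.le, ht.1.2, hfs, hft, fun z hz => ⟨?_, ?_⟩⟩
  · rcases hz.1.eq_or_lt with rfl | h
    · exact hfs.ge
    · exact (hgt z h hz.2).le
  · rcases hz.2.eq_or_lt with rfl | h
    · exact hft.le
    · exact (hlt z (hs.1.1.trans hz.1) h).le

/-- A long interval with small energy contains a time with small kinetic and potential energy. -/
lemma exists_energy_lt {β : ℝ} {W : RVec m → ℝ} {u v w : ℝ → RVec m} {x L c : ℝ}
    (hL : 0 ≤ L)
    (h : ∫⁻ t in Icc x (x + L), energyDensity β W u v w t < ENNReal.ofReal (c * L)) :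
    ∃ t ∈ Icc x (x + L), β / 2 * ‖v t‖ ^ 2 + W (u t) < c := by
  by_contra! hn
  refine absurd h (not_lt.2 ?_)
  calc ENNReal.ofReal (c * L) = ∫⁻ _ in Icc x (x + L), ENNReal.ofReal c := by
        rw [setLIntegral_const, Real.volume_Icc, ENNReal.ofReal_mul' hL]; simp
    _ ≤ _ := setLIntegral_mono' measurableSet_Icc fun t ht => le_energyDensity (hn t ht)

/-! ### Connecting paths, gluing and the infimum of the action -/

/-- `u` is an `H²` path that tends to `a` at `-∞` and to `b` at `+∞`. -/
structure Connects (a b : RVec m) (u v w : ℝ → RVec m) : Prop where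
  path : IsH2Path u v w
  tendsto_atBot : Tendsto u atBot (𝓝 a)
  tendsto_atTop : Tendsto u atTop (𝓝 b)

/-- The infimum of the action over the paths from `a` to `b`. -/
def infAction (β : ℝ) (W : RVec m → ℝ) (a b : RVec m) : ℝ≥0∞ :=
  ⨅ (u : ℝ → RVec m) (v : ℝ → RVec m) (w : ℝ → RVec m) (_ : Connects a b u v w), action β W u v w

section

variable {β : ℝ} {W : RVec m → ℝ} {a b : RVec m} {u v w p q r : ℝ → RVec m}

lemma Connects.infAction_le (h : Connects a b u v w) : infAction β W a b ≤ action β W u v w :=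
  iInf_le_of_le u (iInf_le_of_le v (iInf_le_of_le w (iInf_le _ h)))

lemma exists_connects_action_lt {K : ℝ≥0∞} (h : infAction β W a b < K) :
    ∃ u v w, Connects a b u v w ∧ action β W u v w < K := by
  simp only [infAction, iInf_lt_iff] at h
  obtain ⟨u, v, w, h, hK⟩ := h
  exact ⟨u, v, w, h, hK⟩

lemma action_comp_neg :
    action β W (fun x => u (-x)) (fun x => -v (-x)) (fun x => w (-x)) = action β W u v w := by
  simp only [action, norm_neg]
  exact lintegral_neg_eq_self
    (fun x => ENNReal.ofReal (1 / 2 * ‖w x‖ ^ 2 + β / 2 * ‖v x‖ ^ 2 + W (u x)))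

lemma action_comp_add (s : ℝ) :
    action β W (fun x => u (x + s)) (fun x => v (x + s)) (fun x => w (x + s)) =
      action β W u v w := by
  simp only [action]
  exact lintegral_add_right_eq_self
    (fun x => ENNReal.ofReal (1 / 2 * ‖w x‖ ^ 2 + β / 2 * ‖v x‖ ^ 2 + W (u x))) s

lemma Connects.comp_neg (h : Connects a b u v w) :
    Connects b a (fun x => u (-x)) (fun x => -v (-x)) (fun x => w (-x)) :=
  ⟨h.path.comp_neg, h.tendsto_atTop.comp tendsto_neg_atBot_atTop,
    h.tendsto_atBot.comp tendsto_neg_atTop_atBot⟩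

lemma Connects.comp_add (h : Connects a b u v w) (s : ℝ) :
    Connects a b (fun x => u (x + s)) (fun x => v (x + s)) (fun x => w (x + s)) :=
  ⟨h.path.comp_add s, h.tendsto_atBot.comp (tendsto_atBot_add_const_right _ s tendsto_id),
    h.tendsto_atTop.comp (tendsto_atTop_add_const_right _ s tendsto_id)⟩

variable (β W a b) in
lemma infAction_symm : infAction β W b a = infAction β W a b := by
  have key : ∀ a b : RVec m, infAction β W b a ≤ infAction β W a b := fun a b => by
    refine le_iInf fun u => le_iInf fun v => le_iInf fun w => le_iInf fun h => ?_
    rw [← action_comp_neg]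
    exact h.comp_neg.infAction_le
  exact le_antisymm (key a b) (key b a)

/-- The action of two paths glued at time `s`. -/
lemma action_glue (s : ℝ) :
    action β W (fun x => if x ≤ s then u x else p x) (fun x => if x ≤ s then v x else q x)
      (fun x => if x ≤ s then w x else r x) =
    (∫⁻ x in Iic s, energyDensity β W u v w x) + ∫⁻ x in Ioi s, energyDensity β W p q r x := by
  rw [action_eq, ← lintegral_add_compl _ measurableSet_Iic (A := Iic s), compl_Iic]
  congr 1
  · refine setLIntegral_congr_fun measurableSet_Iic fun x hx => ?_
    simp [energyDensity, mem_Iic.1 hx]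
  · refine setLIntegral_congr_fun measurableSet_Ioi fun x hx => ?_
    simp [energyDensity, not_le.2 (mem_Ioi.1 hx)]

lemma action_eq_add (s : ℝ) : action β W u v w =
    (∫⁻ x in Iic s, energyDensity β W u v w x) + ∫⁻ x in Ioi s, energyDensity β W u v w x := by
  rw [action_eq, ← lintegral_add_compl _ measurableSet_Iic (A := Iic s), compl_Iic]

lemma Connects.glue_right (h : Connects a b u v w) (h' : IsH2Path p q r)
    (hp : Tendsto p atTop (𝓝 b)) {s : ℝ} (h0 : u s = p s) (h1 : v s = q s) :
    Connects a b (fun x => if x ≤ s then u x else p x) (fun x => if x ≤ s then v x else q x)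
      (fun x => if x ≤ s then w x else r x) := by
  refine ⟨h.path.glue h' h0 h1, h.tendsto_atBot.congr' ?_, hp.congr' ?_⟩
  · filter_upwards [eventually_le_atBot s] with x hx
    simp [hx]
  · filter_upwards [eventually_gt_atTop s] with x hx
    simp [not_le.2 hx]

/-- Cubic Hermite interpolation: from position `z` with velocity `y` at time `s` one can reach `b`
at rest at time `s + 1`, at a cost which is small with `‖z - b‖`, `‖y‖` and the potential on the
way. -/
lemma exists_hermite {δ M : ℝ} (hβ : 0 < β) (s : ℝ) {z y : RVec m} (hz : ‖z - b‖ ≤ δ) (hy : ‖y‖ ≤ δ)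
    (hWb : W b = 0)
    (hM : ∀ c ∈ Icc (0 : ℝ) 1, ∀ d ∈ Icc (0 : ℝ) 1, W (b + (c • (z - b) + d • y)) ≤ M) :
    ∃ p q r, IsH2Path p q r ∧ p s = z ∧ q s = y ∧ (∀ x, s + 1 ≤ x → p x = b) ∧
      ∫⁻ x in Ioi s, energyDensity β W p q r x ≤
        ENNReal.ofReal (50 * δ ^ 2 + 5 * β * δ ^ 2 + M) := by
  set A := z - b
  have hδ : 0 ≤ δ := (norm_nonneg _).trans hy
  set P : ℝ → RVec m := fun x =>
    b + (((1 + 2 * (x - s)) * (1 - (x - s)) ^ 2) • A + ((x - s) * (1 - (x - s)) ^ 2) • y)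
  set Q : ℝ → RVec m := fun x =>
    (-6 * (x - s) * (1 - (x - s))) • A + ((1 - (x - s)) * (1 - 3 * (x - s))) • y
  set R : ℝ → RVec m := fun x => (-6 + 12 * (x - s)) • A + (-4 + 6 * (x - s)) • y
  have hPQ : ∀ x, HasDerivAt P (Q x) x := fun x => by
    have h1 : HasDerivAt (fun x : ℝ => (1 + 2 * (x - s)) * (1 - (x - s)) ^ 2)
        (-6 * (x - s) * (1 - (x - s))) x := by
      have e := ((((hasDerivAt_id x).sub_const s).const_mul 2).const_add 1).mul
        ((((hasDerivAt_id x).sub_const s).const_sub 1).pow 2)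
      convert! e using 1
      simp; ring
    have h2 : HasDerivAt (fun x : ℝ => (x - s) * (1 - (x - s)) ^ 2)
        ((1 - (x - s)) * (1 - 3 * (x - s))) x := by
      have e := ((hasDerivAt_id x).sub_const s).mul
        ((((hasDerivAt_id x).sub_const s).const_sub 1).pow 2)
      convert! e using 1
      simp; ring
    exact ((h1.smul_const A).add (h2.smul_const y)).const_add b
  have hQR : ∀ x, HasDerivAt Q (R x) x := fun x => by
    have h1 : HasDerivAt (fun x : ℝ => -6 * (x - s) * (1 - (x - s))) (-6 + 12 * (x - s)) x := by
      have e := (((hasDerivAt_id x).sub_const s).const_mul (-6)).mul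
        (((hasDerivAt_id x).sub_const s).const_sub 1)
      convert! e using 1
      simp; ring
    have h2 : HasDerivAt (fun x : ℝ => (1 - (x - s)) * (1 - 3 * (x - s)))
        (-4 + 6 * (x - s)) x := by
      have e := (((hasDerivAt_id x).sub_const s).const_sub 1).mul
        ((((hasDerivAt_id x).sub_const s).const_mul 3).const_sub 1)
      convert! e using 1
      simp; ring
    exact (h1.smul_const A).add (h2.smul_const y)
  have hpath : IsH2Path P Q R := .of_hasDerivAt hPQ hQR (by fun_prop)
  have e0 : P (s + 1) = b := by simp [P]
  have e1 : Q (s + 1) = 0 := by simp [Q]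
  refine ⟨_, _, _, hpath.glue (IsH2Path.const b) (s := s + 1) e0 e1, ?_, ?_, ?_, ?_⟩
  · simp [P, A]
  · simp [Q]
  · intro x hx
    rcases hx.eq_or_lt with rfl | hx
    · simp [e0]
    · simp [not_le.2 hx]
  · have hpt : ∀ x ∈ Icc s (s + 1), energyDensity β W P Q R x ≤
        ENNReal.ofReal (50 * δ ^ 2 + 5 * β * δ ^ 2 + M) := by
      intro x hx
      set t := x - s
      have ht0 : 0 ≤ t := by simp only [t]; linarith [hx.1]
      have ht1 : t ≤ 1 := by simp only [t]; linarith [hx.2]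
      have hnorm : ∀ c d k l : ℝ, |c| ≤ k → |d| ≤ l → ‖c • A + d • y‖ ≤ (k + l) * δ := by
        intro c d k l hc hd
        refine (norm_add_le _ _).trans ?_
        rw [norm_smul, norm_smul, Real.norm_eq_abs, Real.norm_eq_abs, add_mul]
        gcongr
        · exact (abs_nonneg c).trans hc
        · exact (abs_nonneg d).trans hd
      have hR' : ‖R x‖ ≤ (6 + 4) * δ :=
        hnorm _ _ _ _ (abs_le.2 ⟨by linarith, by linarith⟩) (abs_le.2 ⟨by linarith, by linarith⟩)
      have hQ' : ‖Q x‖ ≤ (3 / 2 + 1) * δ := by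
        refine hnorm _ _ _ _ (abs_le.2 ⟨?_, ?_⟩) (abs_le.2 ⟨?_, ?_⟩)
        · nlinarith [sq_nonneg (t - 1 / 2)]
        · nlinarith
        · nlinarith [sq_nonneg (t - 2 / 3)]
        · nlinarith
      have hP' : W (P x) ≤ M := by
        refine hM _ ⟨by positivity, ?_⟩ _ ⟨by positivity, ?_⟩
        · nlinarith [mul_nonneg (sq_nonneg t) (by linarith : (0 : ℝ) ≤ 3 - 2 * t)]
        · nlinarith [mul_nonneg ht0 (by linarith : (0 : ℝ) ≤ 1 - t), sq_nonneg t,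
            mul_nonneg (mul_nonneg ht0 (by linarith : (0 : ℝ) ≤ 1 - t)) ht0]
      refine ENNReal.ofReal_le_ofReal ?_
      have b1 : ‖R x‖ ^ 2 ≤ ((6 + 4) * δ) ^ 2 := by gcongr
      have b2 : ‖Q x‖ ^ 2 ≤ ((3 / 2 + 1) * δ) ^ 2 := by gcongr
      have b3 : β / 2 * ‖Q x‖ ^ 2 ≤ β / 2 * ((3 / 2 + 1) * δ) ^ 2 := by gcongr
      nlinarith [mul_nonneg hβ.le (sq_nonneg δ)]
    have hsplit : Ioi s = Ioc s (s + 1) ∪ Ioi (s + 1) := by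
      rw [Ioc_union_Ioi_eq_Ioi (by linarith)]
    rw [hsplit, lintegral_union measurableSet_Ioi
      (disjoint_left.2 fun x hx hx' => absurd hx.2 (not_le.2 hx'))]
    have hz : ∫⁻ x in Ioi (s + 1), energyDensity β W (fun x => if x ≤ s + 1 then P x else b)
        (fun x => if x ≤ s + 1 then Q x else 0) (fun x => if x ≤ s + 1 then R x else 0) x = 0 := by
      rw [setLIntegral_congr_fun (g := fun _ => 0) measurableSet_Ioi fun x hx => ?_]
      · simp
      · simp [energyDensity, not_le.2 (mem_Ioi.1 hx), hWb]
    rw [hz, add_zero]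
    refine (setLIntegral_mono' (g := fun _ => ENNReal.ofReal (50 * δ ^ 2 + 5 * β * δ ^ 2 + M))
      measurableSet_Ioc fun x hx => ?_).trans (by simp)
    refine le_trans (le_of_eq ?_) (hpt x (Ioc_subset_Icc_self hx))
    simp [energyDensity, hx.2]

/-- An almost optimal path which at time `s` is close to `b` with small velocity spends little
energy after `s`, since otherwise interpolating to `b` would be better. -/
lemma Connects.tail_le {δ M η : ℝ} (hβ : 0 < β) (hWb : W b = 0) (h : Connects a b u v w)
    (hfin : infAction β W a b ≠ ⊤)
    (hact : action β W u v w ≤ infAction β W a b + ENNReal.ofReal η) {s : ℝ}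
    (hu : ‖u s - b‖ ≤ δ) (hv : ‖v s‖ ≤ δ) (hη : 0 ≤ η) (hM0 : 0 ≤ M)
    (hM : ∀ z, ‖z - b‖ ≤ 2 * δ → W z ≤ M) :
    ∫⁻ x in Ioi s, energyDensity β W u v w x ≤
      ENNReal.ofReal (50 * δ ^ 2 + 5 * β * δ ^ 2 + M + η) := by
  obtain ⟨p, q, r, hp, h0, h1, hb, hc⟩ := exists_hermite (W := W) (M := M) hβ s hu hv hWb (by
    intro c hc d hd
    refine hM _ ?_
    rw [add_sub_cancel_left]
    refine (norm_add_le _ _).trans ?_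
    rw [norm_smul, norm_smul, Real.norm_eq_abs, Real.norm_eq_abs, abs_of_nonneg hc.1,
      abs_of_nonneg hd.1]
    nlinarith [norm_nonneg (u s - b), norm_nonneg (v s), hc.2, hd.2])
  have hglue := (h.glue_right hp (tendsto_const_nhds.congr' (by
    filter_upwards [eventually_ge_atTop (s + 1)] with x hx using (hb x hx).symm))
    h0.symm h1.symm).infAction_le (β := β) (W := W)
  rw [action_glue] at hglue
  rw [action_eq_add s] at hact
  set A := ∫⁻ x in Iic s, energyDensity β W u v w x
  set B := ∫⁻ x in Ioi s, energyDensity β W u v w x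
  have hA : A ≠ ⊤ := ne_top_of_le_ne_top (ENNReal.add_ne_top.2 ⟨hfin, ENNReal.ofReal_ne_top⟩)
    (le_self_add.trans hact)
  rw [ENNReal.ofReal_add (by positivity) hη]
  refine (ENNReal.add_le_add_iff_left hA).1 ?_
  calc A + B ≤ infAction β W a b + ENNReal.ofReal η := hact
    _ ≤ A + ENNReal.ofReal (50 * δ ^ 2 + 5 * β * δ ^ 2 + M) + ENNReal.ofReal η := by
        gcongr
        exact hglue.trans (by gcongr)
    _ = _ := by rw [add_assoc]

end

/-! ### Tightness of almost minimal paths -/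

section

variable {β : ℝ} {W : RVec m → ℝ} {a b : RVec m} {u v w : ℝ → RVec m}

/-- Moving away from a well, from distance `ρ / 2` to distance `ρ`, has a positive cost. -/
lemma IsH2Path.escape_cost_le {ρ c : ℝ} (hβ : 0 < β) (hc : 0 < c) (hρ : 0 < ρ)
    (h : IsH2Path u v w) (hW : ∀ z, ‖z - b‖ ≤ ρ → c * ‖z - b‖ ^ 2 ≤ W z) {x y : ℝ} (hxy : x ≤ y)
    (hx : ‖u x - b‖ ≤ ρ / 2) (hy : ρ ≤ ‖u y - b‖) :
    ENNReal.ofReal (√(2 * β * (c * (ρ / 2) ^ 2)) * (ρ / 2)) ≤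
      ∫⁻ t in Icc x y, energyDensity β W u v w t := by
  have hcont : Continuous fun t => ‖u t - b‖ := (h.continuous.sub continuous_const).norm
  obtain ⟨s, t, hxs, hst, hty, hs, ht, hz⟩ := exists_crossing hcont hxy (half_lt_self hρ) hx hy
  have h1 := h.crossing_cost_le (β := β) (c := c * (ρ / 2) ^ 2) (W := W) hβ (by positivity) hst
    (fun z hzm => (by have := (hz z hzm).1; gcongr : _ ≤ c * ‖u z - b‖ ^ 2).trans
      (hW _ (hz z hzm).2))
  refine le_trans (ENNReal.ofReal_le_ofReal ?_) (h1.trans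
    (lintegral_mono_set (Icc_subset_Icc hxs hty)))
  gcongr
  have : ‖u t - b‖ - ‖u s - b‖ ≤ ‖u t - u s‖ := by
    simpa using norm_sub_norm_le (u t - b) (u s - b)
  linarith

/-- Once an almost optimal path is close to `b` with small velocity, it stays near `b`: leaving
the neighbourhood would cost more than the energy that is left. -/
lemma IsDoubleWell.exists_trap_right (hW : IsDoubleWell W a b) (hβ : 0 < β)
    (hfin : infAction β W a b ≠ ⊤) {ρ : ℝ} (hρ : 0 < ρ) :
    ∃ δ > 0, ∃ η > 0, ∀ u v w, Connects a b u v w →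
      action β W u v w ≤ infAction β W a b + ENNReal.ofReal η →
      ∀ s, ‖u s - b‖ ≤ δ → ‖v s‖ ≤ δ → ∀ t, s ≤ t → ‖u t - b‖ ≤ ρ := by
  obtain ⟨r, hr, c, hc, hq⟩ := hW.exists_quadratic_le
  set ρ' := min ρ r
  have hρ' : 0 < ρ' := lt_min hρ hr
  set κ := √(2 * β * (c * (ρ' / 2) ^ 2)) * (ρ' / 2)
  have hκ : 0 < κ := by positivity
  obtain ⟨δ₀, hδ₀, hδW⟩ := Metric.continuousAt_iff.1 (hW.continuous.continuousAt (x := b)) (κ / 4)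
    (by positivity : 0 < κ / 4)
  set δ := min (min (ρ' / 2) (δ₀ / 3)) (min 1 (κ / (4 * (51 + 5 * β))))
  have hδ : 0 < δ := by positivity
  have d1 : δ ≤ ρ' / 2 := (min_le_left _ _).trans (min_le_left _ _)
  have d2 : δ ≤ δ₀ / 3 := (min_le_left _ _).trans (min_le_right _ _)
  have d3 : δ ≤ 1 := (min_le_right _ _).trans (min_le_left _ _)
  have d4 : δ ≤ κ / (4 * (51 + 5 * β)) := (min_le_right _ _).trans (min_le_right _ _)
  refine ⟨δ, hδ, κ / 4, by positivity, fun u v w h hact s hus hvs t hst => ?_⟩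
  by_contra! hn
  have htail := h.tail_le hβ hW.right_eq_zero hfin hact hus hvs (by positivity)
    (M := κ / 4) (by positivity) (by
      intro z hz
      have := hδW (x := z) (by rw [dist_eq_norm]; linarith)
      rw [hW.right_eq_zero, Real.dist_eq, sub_zero] at this
      exact (le_abs_self _).trans this.le)
  have hesc := h.path.escape_cost_le hβ hc hρ'
    (fun z hz => hq z (hz.trans (min_le_right _ _))) hst (hus.trans d1)
    ((min_le_left _ _).trans hn.le)
  have hle : ∫⁻ x in Icc s t, energyDensity β W u v w x ≤
      ∫⁻ x in Ioi s, energyDensity β W u v w x := by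
    rw [setLIntegral_congr Ioc_ae_eq_Icc.symm]
    exact lintegral_mono_set Ioc_subset_Ioi_self
  have hfinal := (hesc.trans hle).trans htail
  rw [ENNReal.ofReal_le_ofReal_iff (by positivity)] at hfinal
  have d5 : (50 + 5 * β) * δ ^ 2 ≤ (50 + 5 * β) * δ := by
    gcongr
    nlinarith
  rw [le_div_iff₀ (by positivity)] at d4
  have hκ' : κ = √(2 * β * (c * (ρ' / 2) ^ 2)) * (ρ' / 2) := rfl
  rw [← hκ'] at hfinal
  nlinarith

lemma IsDoubleWell.exists_trap_left (hW : IsDoubleWell W a b) (hβ : 0 < β)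
    (hfin : infAction β W a b ≠ ⊤) {ρ : ℝ} (hρ : 0 < ρ) :
    ∃ δ > 0, ∃ η > 0, ∀ u v w, Connects a b u v w →
      action β W u v w ≤ infAction β W a b + ENNReal.ofReal η →
      ∀ s, ‖u s - a‖ ≤ δ → ‖v s‖ ≤ δ → ∀ t, t ≤ s → ‖u t - a‖ ≤ ρ := by
  obtain ⟨δ, hδ, η, hη, H⟩ :=
    hW.symm.exists_trap_right hβ (by rwa [infAction_symm]) hρ
  refine ⟨δ, hδ, η, hη, fun u v w h hact s hus hvs t hts => ?_⟩
  have := H _ _ _ h.comp_neg (by rwa [action_comp_neg, infAction_symm]) (-s) (by simpa using hus)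
    (by simpa using hvs) (-t) (by linarith)
  simpa using this

/-- Almost optimal paths cross from one well to the other within a time which is bounded
uniformly. -/
lemma IsDoubleWell.exists_transition_time (hW : IsDoubleWell W a b) (hβ : 0 < β)
    (hfin : infAction β W a b ≠ ⊤) {ρ : ℝ} (hρ : 0 < ρ) :
    ∃ η > 0, ∃ L : ℝ, ∀ u v w, Connects a b u v w →
      action β W u v w ≤ infAction β W a b + ENNReal.ofReal η →
      ∃ s, ‖v s‖ ≤ ρ ∧ (∀ t, t ≤ s → ‖u t - a‖ ≤ ρ) ∧ ∀ t, s + L ≤ t → ‖u t - b‖ ≤ ρ := by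
  have hab : 0 < ‖a - b‖ := norm_pos_iff.2 (sub_ne_zero.2 hW.ne)
  set ρ' := min ρ (‖a - b‖ / 3)
  have hρ' : 0 < ρ' := by positivity
  obtain ⟨δ₁, hδ₁, η₁, hη₁, H₁⟩ := hW.exists_trap_left hβ hfin hρ'
  obtain ⟨δ₂, hδ₂, η₂, hη₂, H₂⟩ := hW.exists_trap_right hβ hfin hρ'
  set δ := min (min δ₁ δ₂) ρ'
  have hδ : 0 < δ := by positivity
  have dd1 : δ ≤ δ₁ := (min_le_left _ _).trans (min_le_left _ _)
  have dd2 : δ ≤ δ₂ := (min_le_left _ _).trans (min_le_right _ _)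
  have dd3 : δ ≤ ρ' := min_le_right _ _
  have hdisj : ∀ z : RVec m, ‖z - a‖ ≤ ρ' → ‖z - b‖ ≤ ρ' → False := fun z h1 h2 => by
    have h3 : ‖a - b‖ ≤ ‖z - a‖ + ‖z - b‖ := by
      rw [norm_sub_rev z a]
      simpa using norm_add_le (a - z) (z - b)
    have : ρ' ≤ ‖a - b‖ / 3 := min_le_right _ _
    linarith
  obtain ⟨c₀, hc₀, hnear⟩ := hW.exists_near_of_lt hδ
  set c := min c₀ (β / 2 * δ ^ 2)
  have hc : 0 < c := by positivity
  set η := min η₁ η₂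
  have hη : 0 < η := lt_min hη₁ hη₂
  set K := (infAction β W a b + ENNReal.ofReal η).toReal
  have hKtop : infAction β W a b + ENNReal.ofReal η ≠ ⊤ :=
    ENNReal.add_ne_top.2 ⟨hfin, ENNReal.ofReal_ne_top⟩
  set L := (K + 1) / c
  have hK0 : 0 ≤ K := ENNReal.toReal_nonneg
  have hL : 0 ≤ L := by positivity
  refine ⟨η, hη, 1 + L, fun u v w h hact => ?_⟩
  -- by the bound on the action, such times are at most `L` apart
  have hgood : ∀ x, ∃ t ∈ Icc x (x + L), ‖v t‖ ≤ δ ∧ (‖u t - a‖ ≤ δ ∨ ‖u t - b‖ ≤ δ) := by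
    intro x
    obtain ⟨t, ht, hlt⟩ := exists_energy_lt (β := β) (W := W) (u := u) (v := v) (w := w) (x := x)
      (c := c) hL (by
        refine (setLIntegral_energyDensity_le β W u v w _).trans_lt (hact.trans_lt ?_)
        rw [← ENNReal.ofReal_toReal hKtop]
        refine (ENNReal.ofReal_lt_ofReal_iff (by positivity)).2 ?_
        have : c * L = K + 1 := by simp only [L]; field_simp
        rw [this]; exact lt_add_one _)
    refine ⟨t, ht, ?_, ?_⟩
    · by_contra! hn
      have h1 : β / 2 * δ ^ 2 ≤ β / 2 * ‖v t‖ ^ 2 := by gcongr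
      have h2 : c ≤ β / 2 * δ ^ 2 := min_le_right _ _
      linarith [hW.nonneg (u t)]
    · have h2 : c ≤ c₀ := min_le_left _ _
      have h3 : 0 ≤ β / 2 * ‖v t‖ ^ 2 := by positivity
      exact (hnear (u t) (by linarith)).imp le_of_lt le_of_lt
  have hact₁ : action β W u v w ≤ infAction β W a b + ENNReal.ofReal η₁ :=
    hact.trans (by gcongr; exact min_le_left _ _)
  have hact₂ : action β W u v w ≤ infAction β W a b + ENNReal.ofReal η₂ :=
    hact.trans (by gcongr; exact min_le_right _ _)
  -- the times at which the path is close to `a` with small velocity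
  set S : Set ℝ := {t | ‖u t - a‖ ≤ δ} ∩ {t | ‖v t‖ ≤ δ}
  have hSne : S.Nonempty := by
    have hev := (tendsto_iff_norm_sub_tendsto_zero.1 h.tendsto_atBot).eventually
      (gt_mem_nhds hρ')
    obtain ⟨X, hX⟩ := eventually_atBot.1 hev
    obtain ⟨t, ht, hv, hu⟩ := hgood (X - L)
    rcases hu with hu | hu
    · exact ⟨t, hu, hv⟩
    · exact (hdisj (u t) (hX t (by linarith [ht.2])).le (hu.trans dd3)).elim
  have hSbdd : BddAbove S := by
    have hev := (tendsto_iff_norm_sub_tendsto_zero.1 h.tendsto_atTop).eventually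
      (gt_mem_nhds hρ')
    obtain ⟨X, hX⟩ := eventually_atTop.1 hev
    refine ⟨X, fun t ht => ?_⟩
    by_contra! hn
    exact hdisj (u t) (ht.1.trans dd3) (hX t hn.le).le
  -- less than one time unit before the end of `S`, the path is still trapped near `a` in the past,
  -- and the next good time after the end of `S` traps it near `b` in the future
  obtain ⟨s, hs, hlt⟩ := exists_lt_of_lt_csSup hSne (sub_one_lt (sSup S))
  refine ⟨s, hs.2.trans (dd3.trans (min_le_left _ _)), fun t ht => ?_, fun t ht => ?_⟩
  · exact (H₁ u v w h hact₁ s (hs.1.trans dd1) (hs.2.trans dd1) t ht).trans (min_le_left _ _)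
  · obtain ⟨t₀, ht₀, hv, hu⟩ := hgood (s + 1)
    have hnot : ¬ ‖u t₀ - a‖ ≤ δ := fun hua => by
      have := le_csSup hSbdd (show t₀ ∈ S from ⟨hua, hv⟩)
      linarith [ht₀.1]
    exact (H₂ u v w h hact₂ t₀ ((hu.resolve_left hnot).trans dd2) (hv.trans dd2) t
      (by linarith [ht₀.2])).trans (min_le_left _ _)

end

/-! ### Paths of finite action -/

section

variable {β : ℝ} {W : RVec m → ℝ} {u v w : ℝ → RVec m}

lemma IsH2Path.integrable_energy (hβ : 0 < β) (hWc : Continuous W) (hW0 : ∀ z, 0 ≤ W z)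
    (h : IsH2Path u v w) (hfin : action β W u v w ≠ ⊤) :
    Integrable fun x => 1 / 2 * ‖w x‖ ^ 2 + β / 2 * ‖v x‖ ^ 2 + W (u x) := by
  have hm : AEStronglyMeasurable
      (fun x => 1 / 2 * ‖w x‖ ^ 2 + β / 2 * ‖v x‖ ^ 2 + W (u x)) volume :=
    (((h.aestronglyMeasurable.norm.pow 2).const_mul _).add
      ((h.continuous_deriv.norm.pow 2).aestronglyMeasurable.const_mul _)).add
      (hWc.comp h.continuous).aestronglyMeasurable
  refine (lintegral_ofReal_ne_top_iff_integrable hm (Eventually.of_forall fun x => ?_)).1 hfin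
  have := hW0 (u x)
  simp only [Pi.zero_apply]
  positivity

lemma IsH2Path.integrable_norm_sq_snd (hβ : 0 < β) (hWc : Continuous W) (hW0 : ∀ z, 0 ≤ W z)
    (h : IsH2Path u v w) (hfin : action β W u v w ≠ ⊤) : Integrable fun x => ‖w x‖ ^ 2 := by
  refine ((h.integrable_energy hβ hWc hW0 hfin).const_mul 2).mono'
    (h.aestronglyMeasurable.norm.pow 2) (Eventually.of_forall fun x => ?_)
  rw [Real.norm_of_nonneg (by positivity)]
  have := hW0 (u x)
  have : 0 ≤ β / 2 * ‖v x‖ ^ 2 := by positivity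
  linarith

lemma IsH2Path.integrable_norm_sq_fst (hβ : 0 < β) (hWc : Continuous W) (hW0 : ∀ z, 0 ≤ W z)
    (h : IsH2Path u v w) (hfin : action β W u v w ≠ ⊤) : Integrable fun x => ‖v x‖ ^ 2 := by
  refine ((h.integrable_energy hβ hWc hW0 hfin).const_mul (2 / β)).mono'
    ((h.continuous_deriv.norm.pow 2).aestronglyMeasurable) (Eventually.of_forall fun x => ?_)
  rw [Real.norm_of_nonneg (by positivity)]
  have h1 := hW0 (u x)
  have h2 : ‖v x‖ ^ 2 = 2 / β * (β / 2 * ‖v x‖ ^ 2) := by field_simp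
  have h3 : 0 ≤ 1 / 2 * ‖w x‖ ^ 2 := by positivity
  calc ‖v x‖ ^ 2 = 2 / β * (β / 2 * ‖v x‖ ^ 2) := h2
    _ ≤ _ := by gcongr; linarith

lemma IsH2Path.integrable_potential (hβ : 0 < β) (hWc : Continuous W) (hW0 : ∀ z, 0 ≤ W z)
    (h : IsH2Path u v w) (hfin : action β W u v w ≠ ⊤) : Integrable fun x => W (u x) := by
  refine (h.integrable_energy hβ hWc hW0 hfin).mono'
    (hWc.comp h.continuous).aestronglyMeasurable (Eventually.of_forall fun x => ?_)
  rw [Real.norm_of_nonneg (hW0 _)]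
  have : 0 ≤ 1 / 2 * ‖w x‖ ^ 2 + β / 2 * ‖v x‖ ^ 2 := by positivity
  linarith

lemma IsH2Path.integral_energy_le (hβ : 0 < β) (hWc : Continuous W) (hW0 : ∀ z, 0 ≤ W z)
    (h : IsH2Path u v w) {K : ℝ} (hK0 : 0 ≤ K) (hK : action β W u v w ≤ ENNReal.ofReal K) :
    ∫ x, (1 / 2 * ‖w x‖ ^ 2 + β / 2 * ‖v x‖ ^ 2 + W (u x)) ≤ K := by
  have hfin := ne_top_of_le_ne_top ENNReal.ofReal_ne_top hK
  rw [← ENNReal.ofReal_le_ofReal_iff hK0, ofReal_integral_eq_lintegral_ofReal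
    (h.integrable_energy hβ hWc hW0 hfin)]
  · exact hK
  · refine Eventually.of_forall fun x => ?_
    have := hW0 (u x)
    simp only [Pi.zero_apply]
    positivity

lemma IsH2Path.integral_norm_sq_snd_le (hβ : 0 < β) (hWc : Continuous W) (hW0 : ∀ z, 0 ≤ W z)
    (h : IsH2Path u v w) {K : ℝ} (hK0 : 0 ≤ K) (hK : action β W u v w ≤ ENNReal.ofReal K) :
    ∫ x, ‖w x‖ ^ 2 ≤ 2 * K := by
  have hfin := ne_top_of_le_ne_top ENNReal.ofReal_ne_top hK
  have h1 := h.integral_energy_le hβ hWc hW0 hK0 hK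
  have h2 : ∫ x, 1 / 2 * ‖w x‖ ^ 2 ≤
      ∫ x, (1 / 2 * ‖w x‖ ^ 2 + β / 2 * ‖v x‖ ^ 2 + W (u x)) := by
    refine integral_mono ((h.integrable_norm_sq_snd hβ hWc hW0 hfin).const_mul _)
      (h.integrable_energy hβ hWc hW0 hfin) fun x => ?_
    have := hW0 (u x)
    have : 0 ≤ β / 2 * ‖v x‖ ^ 2 := by positivity
    simp only; linarith
  rw [integral_const_mul] at h2
  linarith

lemma IsH2Path.integral_norm_sq_fst_le (hβ : 0 < β) (hWc : Continuous W) (hW0 : ∀ z, 0 ≤ W z)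
    (h : IsH2Path u v w) {K : ℝ} (hK0 : 0 ≤ K) (hK : action β W u v w ≤ ENNReal.ofReal K) :
    β * ∫ x, ‖v x‖ ^ 2 ≤ 2 * K := by
  have hfin := ne_top_of_le_ne_top ENNReal.ofReal_ne_top hK
  have h1 := h.integral_energy_le hβ hWc hW0 hK0 hK
  have h2 : ∫ x, β / 2 * ‖v x‖ ^ 2 ≤
      ∫ x, (1 / 2 * ‖w x‖ ^ 2 + β / 2 * ‖v x‖ ^ 2 + W (u x)) := by
    refine integral_mono ((h.integrable_norm_sq_fst hβ hWc hW0 hfin).const_mul _)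
      (h.integrable_energy hβ hWc hW0 hfin) fun x => ?_
    have := hW0 (u x)
    have : 0 ≤ 1 / 2 * ‖w x‖ ^ 2 := by positivity
    simp only; linarith
  rw [integral_const_mul] at h2
  linarith

end

/-- A quantitative form of uniform continuity for primitives of square integrable functions, with
a free parameter `l` in place of the optimal one provided by the Cauchy–Schwarz inequality. -/
lemma norm_intervalIntegral_le {f : ℝ → RVec m} (hf : AEStronglyMeasurable f volume)
    (hf2 : Integrable fun x => ‖f x‖ ^ 2) {l : ℝ} (hl : 0 < l) (x y : ℝ) :
    ‖∫ t in x..y, f t‖ ≤ |y - x| / (4 * l) + l * ∫ t, ‖f t‖ ^ 2 := by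
  have hpt : ∀ t, ‖f t‖ ≤ 1 / (4 * l) + l * ‖f t‖ ^ 2 := fun t => by
    have : 0 ≤ l * (‖f t‖ - 1 / (2 * l)) ^ 2 := by positivity
    have e : l * (‖f t‖ - 1 / (2 * l)) ^ 2 = 1 / (4 * l) + l * ‖f t‖ ^ 2 - ‖f t‖ := by
      field_simp; ring
    linarith
  have hfin : volume (uIoc x y) ≠ ⊤ := by simp [uIoc]
  have hi : IntegrableOn (fun t => 1 / (4 * l) + l * ‖f t‖ ^ 2) (uIoc x y) :=
    (integrableOn_const hfin).add (hf2.const_mul l).integrableOn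
  have hfi : IntegrableOn f (uIoc x y) := hi.mono' hf.restrict (Eventually.of_forall hpt)
  have hci : IntegrableOn (fun _ : ℝ => 1 / (4 * l)) (uIoc x y) := integrableOn_const hfin
  calc ‖∫ t in x..y, f t‖ ≤ ∫ t in uIoc x y, ‖f t‖ :=
        intervalIntegral.norm_integral_le_integral_norm_uIoc
    _ ≤ ∫ t in uIoc x y, (1 / (4 * l) + l * ‖f t‖ ^ 2) := integral_mono hfi.norm hi hpt
    _ = |y - x| / (4 * l) + l * ∫ t in uIoc x y, ‖f t‖ ^ 2 := by
        rw [integral_add hci (hf2.const_mul l).integrableOn, integral_const_mul]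
        simp [measureReal_def, uIoc, abs_sub_comm, div_eq_mul_inv, max_sub_min_eq_abs]
    _ ≤ |y - x| / (4 * l) + l * ∫ t, ‖f t‖ ^ 2 := by
        refine add_le_add le_rfl (mul_le_mul_of_nonneg_left ?_ hl.le)
        exact setIntegral_le_integral hf2 (Eventually.of_forall fun t => by positivity)

/-! ### Weak compactness and lower semicontinuity -/

/-- Bounded sequences in a separable Hilbert space have weakly convergent subsequences. -/
lemma exists_weakly_convergent_subseq {H : Type*} [NormedAddCommGroup H] [InnerProductSpace ℝ H]
    [CompleteSpace H] [TopologicalSpace.SeparableSpace H] {f : ℕ → H} {C : ℝ}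
    (hf : ∀ n, ‖f n‖ ≤ C) :
    ∃ (g : H) (ψ : ℕ → ℕ), StrictMono ψ ∧
      ∀ y, Tendsto (fun n => inner ℝ (f (ψ n)) y) atTop (𝓝 (inner ℝ g y)) := by
  have hcomp := WeakDual.isSeqCompact_closedBall ℝ H 0 C
  set F : ℕ → WeakDual ℝ H := fun n =>
    WeakDual.toStrongDual.symm (InnerProductSpace.toDual ℝ H (f n))
  obtain ⟨G, -, ψ, hψ, hlim⟩ := hcomp (x := F) (fun n => by
    simpa [F] using! hf n)
  refine ⟨(InnerProductSpace.toDual ℝ H).symm (WeakDual.toStrongDual G), ψ, hψ, fun y => ?_⟩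
  have := (tendsto_iff_forall_eval_tendsto_topDualPairing.1 hlim) y
  rw [InnerProductSpace.toDual_symm_apply]
  exact this

lemma tendsto_of_tendsto_inner {f : ℕ → RVec m} {g : RVec m}
    (h : ∀ c : RVec m, Tendsto (fun n => inner ℝ c (f n)) atTop (𝓝 (inner ℝ c g))) :
    Tendsto f atTop (𝓝 g) := by
  have h1 : Tendsto (fun n => WithLp.ofLp (f n)) atTop (𝓝 (WithLp.ofLp g)) := by
    refine tendsto_pi_nhds.2 fun i => ?_
    have := h (EuclideanSpace.single i 1)
    simpa [EuclideanSpace.inner_single_left] using this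
  exact ((PiLp.continuous_toLp 2 fun _ : Fin m => ℝ).tendsto _).comp h1

/-- Compactness and lower semicontinuity: a sequence of paths with convergent action and bounded
initial data has a subsequence that converges pointwise to a path whose action is no larger than
the limit of the actions. -/
lemma exists_limit_path {β : ℝ} {W : RVec m → ℝ} (hβ : 0 < β) (hWc : Continuous W)
    (hW0 : ∀ z, 0 ≤ W z) {u v w : ℕ → ℝ → RVec m} (hp : ∀ n, IsH2Path (u n) (v n) (w n))
    {A : ℝ≥0∞} {K C : ℝ} (hK0 : 0 ≤ K) (hact : ∀ n, action β W (u n) (v n) (w n) ≤ ENNReal.ofReal K)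
    (hA : Tendsto (fun n => action β W (u n) (v n) (w n)) atTop (𝓝 A))
    (hu0 : ∀ n, ‖u n 0‖ ≤ C) (hv0 : ∀ n, ‖v n 0‖ ≤ C) :
    ∃ U V Z, IsH2Path U V Z ∧ action β W U V Z ≤ A ∧
      ∃ ψ : ℕ → ℕ, StrictMono ψ ∧ ∀ x, Tendsto (fun n => u (ψ n) x) atTop (𝓝 (U x)) := by
  have hfin : ∀ n, action β W (u n) (v n) (w n) ≠ ⊤ := fun n =>
    ne_top_of_le_ne_top ENNReal.ofReal_ne_top (hact n)
  have hw2 : ∀ n, Integrable fun x => ‖w n x‖ ^ 2 := fun n =>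
    (hp n).integrable_norm_sq_snd hβ hWc hW0 (hfin n)
  have hmem : ∀ n, MemLp (w n) 2 volume := fun n =>
    (memLp_two_iff_integrable_sq_norm (hp n).aestronglyMeasurable).2 (hw2 n)
  set f : ℕ → Lp (RVec m) 2 (volume : Measure ℝ) := fun n => (hmem n).toLp (w n)
  have hfnorm : ∀ n, ‖f n‖ ≤ √(2 * K) := fun n => by
    refine Real.le_sqrt_of_sq_le ?_
    rw [← real_inner_self_eq_norm_sq, L2.inner_def]
    refine le_trans (le_of_eq ?_) ((hp n).integral_norm_sq_snd_le hβ hWc hW0 hK0 (hact n))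
    refine integral_congr_ae ?_
    filter_upwards [(hmem n).coeFn_toLp] with x hx
    rw [hx, real_inner_self_eq_norm_sq]
  have : Fact ((2 : ℝ≥0∞) ≠ ⊤) := ⟨ENNReal.ofNat_ne_top⟩
  obtain ⟨g, ψ₁, hψ₁, hweak₁⟩ := exists_weakly_convergent_subseq hfnorm
  obtain ⟨u₀, -, ψ₂, hψ₂, hlim₂⟩ := tendsto_subseq_of_bounded
    (x := fun n => u (ψ₁ n) 0) (s := Metric.closedBall 0 C) Metric.isBounded_closedBall
    (fun n => by simpa using hu0 _)
  obtain ⟨v₀, -, ψ₃, hψ₃, hlim₃⟩ := tendsto_subseq_of_bounded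
    (x := fun n => v (ψ₁ (ψ₂ n)) 0) (s := Metric.closedBall 0 C) Metric.isBounded_closedBall
    (fun n => by simpa using hv0 _)
  set ψ : ℕ → ℕ := fun n => ψ₁ (ψ₂ (ψ₃ n))
  have hψ : StrictMono ψ := hψ₁.comp (hψ₂.comp hψ₃)
  have hweak : ∀ y, Tendsto (fun n => inner ℝ (f (ψ n)) y) atTop (𝓝 (inner ℝ g y)) := fun y =>
    (hweak₁ y).comp (hψ₂.comp hψ₃).tendsto_atTop
  have hu0' : Tendsto (fun n => u (ψ n) 0) atTop (𝓝 u₀) := hlim₂.comp hψ₃.tendsto_atTop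
  have hv0' : Tendsto (fun n => v (ψ n) 0) atTop (𝓝 v₀) := hlim₃
  -- convergence of integrals over sets of finite measure
  have hset : ∀ s : Set ℝ, MeasurableSet s → volume s ≠ ⊤ →
      Tendsto (fun n => ∫ x in s, w (ψ n) x) atTop (𝓝 (∫ x in s, g x)) := by
    intro s hs hfs
    refine tendsto_of_tendsto_inner fun c => ?_
    have h1 := hweak (indicatorConstLp 2 hs hfs c)
    simp only [fun h : Lp (RVec m) 2 (volume : Measure ℝ) =>
      real_inner_comm (indicatorConstLp 2 hs hfs c) h] at h1
    simp only [L2.inner_indicatorConstLp_eq_inner_setIntegral] at h1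
    refine h1.congr fun n => ?_
    congr 1
    refine integral_congr_ae ?_
    filter_upwards [ae_restrict_of_ae (hmem (ψ n)).coeFn_toLp] with x hx using hx
  have hgm : MemLp g 2 volume := Lp.memLp g
  have hgl : LocallyIntegrable g := hgm.locallyIntegrable (by norm_num)
  have hgi : ∀ x y, IntervalIntegrable g volume x y := fun x y =>
    (hgl.integrableOn_isCompact isCompact_uIcc).intervalIntegrable
  set V : ℝ → RVec m := fun x => v₀ + ∫ t in (0 : ℝ)..x, g t
  have hVc : Continuous V := continuous_const.add (intervalIntegral.continuous_primitive hgi 0)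
  set U : ℝ → RVec m := fun x => u₀ + ∫ t in (0 : ℝ)..x, V t
  have hUd : ∀ x, HasDerivAt U (V x) x := fun x =>
    (intervalIntegral.integral_hasDerivAt_right (hVc.intervalIntegrable _ _)
      hVc.stronglyMeasurable.stronglyMeasurableAtFilter hVc.continuousAt).const_add u₀
  have hUc : Continuous U := continuous_iff_continuousAt.2 fun x => (hUd x).continuousAt
  have hpath : IsH2Path U V g := .of_base 0 hUd hgl fun y => by simp [V]
  have hVlim : ∀ x, Tendsto (fun n => v (ψ n) x) atTop (𝓝 (V x)) := by
    intro x
    have h1 : Tendsto (fun n => ∫ t in (0 : ℝ)..x, w (ψ n) t) atTop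
        (𝓝 (∫ t in (0 : ℝ)..x, g t)) :=
      (hset _ measurableSet_Ioc (by simp)).sub (hset _ measurableSet_Ioc (by simp))
    exact (hv0'.add h1).congr fun n => ((hp (ψ n)).eq_add 0 x).symm
  have hvb : ∀ n x, ‖v n x‖ ≤ C + (|x| / (4 * 1) + 1 * (2 * K)) := by
    intro n x
    rw [(hp n).eq_add 0 x]
    refine (norm_add_le _ _).trans (add_le_add (hv0 n) ?_)
    refine (norm_intervalIntegral_le (hp n).aestronglyMeasurable (hw2 n) one_pos 0 x).trans ?_
    rw [sub_zero]
    gcongr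
    exact (hp n).integral_norm_sq_snd_le hβ hWc hW0 hK0 (hact n)
  have hvbR : ∀ R n x, |x| ≤ R → ‖v n x‖ ≤ C + (R / (4 * 1) + 1 * (2 * K)) := fun R n x hx =>
    (hvb n x).trans (by gcongr)
  have hUlim : ∀ x, Tendsto (fun n => u (ψ n) x) atTop (𝓝 (U x)) := by
    intro x
    have h1 : Tendsto (fun n => ∫ t in (0 : ℝ)..x, v (ψ n) t) atTop
        (𝓝 (∫ t in (0 : ℝ)..x, V t)) := by
      refine intervalIntegral.tendsto_integral_filter_of_dominated_convergence
        (fun _ => C + (|x| / (4 * 1) + 1 * (2 * K)))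
        (Eventually.of_forall fun n => (hp _).continuous_deriv.aestronglyMeasurable)
        (Eventually.of_forall fun n => Eventually.of_forall fun t ht => ?_)
        intervalIntegrable_const (Eventually.of_forall fun t _ => hVlim t)
      refine hvbR _ _ _ ?_
      have := uIoc_subset_uIcc ht
      rcases le_total 0 x with h0 | h0
      · rw [uIcc_of_le h0] at this
        rw [abs_of_nonneg this.1, abs_of_nonneg h0]; exact this.2
      · rw [uIcc_of_ge h0] at this
        rw [abs_of_nonpos this.2, abs_of_nonpos h0]; linarith [this.1]
    refine (hu0'.add h1).congr fun n => ?_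
    rw [← (hp (ψ n)).sub_eq_integral]; abel
  have hub : ∀ R n x, |x| ≤ R → ‖u n x‖ ≤ C + (C + (R / (4 * 1) + 1 * (2 * K))) * R := by
    intro R n x hx
    have e : u n x = u n 0 + ∫ t in (0 : ℝ)..x, v n t := by
      rw [← (hp n).sub_eq_integral]; abel
    have hR0 : 0 ≤ R := (abs_nonneg x).trans hx
    have hC0 : 0 ≤ C := (norm_nonneg _).trans (hu0 0)
    rw [e]
    refine (norm_add_le _ _).trans (add_le_add (hu0 n) ?_)
    refine (intervalIntegral.norm_integral_le_of_norm_le_const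
      (C := C + (R / (4 * 1) + 1 * (2 * K))) fun t ht => ?_).trans ?_
    · refine hvbR _ _ _ (le_trans ?_ hx)
      have := uIoc_subset_uIcc ht
      rcases le_total 0 x with h0 | h0
      · rw [uIcc_of_le h0] at this
        rw [abs_of_nonneg this.1, abs_of_nonneg h0]; exact this.2
      · rw [uIcc_of_ge h0] at this
        rw [abs_of_nonpos this.2, abs_of_nonpos h0]; linarith [this.1]
    · rw [sub_zero]; gcongr
  refine ⟨U, V, g, hpath, ?_, ψ, hψ, hUlim⟩
  have hA' : A ≠ ⊤ := ne_top_of_le_ne_top ENNReal.ofReal_ne_top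
    (le_of_tendsto' hA hact)
  have hg2 : Integrable fun x => ‖g x‖ ^ 2 :=
    (memLp_two_iff_integrable_sq_norm hgm.aestronglyMeasurable).1 hgm
  -- lower semicontinuity of the action on bounded intervals
  have hloc : ∀ R : ℝ, 0 ≤ R → ∫⁻ x in Ioc (-R) R, energyDensity β W U V g x ≤ A := by
    intro R hR
    set I := Ioc (-R) R
    have hIm : MeasurableSet I := measurableSet_Ioc
    have hbound : Tendsto (fun n => ∫ x in (-R)..R,
        (β / 2 * ‖v (ψ n) x‖ ^ 2 + W (u (ψ n) x))) atTop
        (𝓝 (∫ x in (-R)..R, (β / 2 * ‖V x‖ ^ 2 + W (U x)))) := by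
      obtain ⟨B, hB⟩ := (isCompact_closedBall (0 : RVec m)
        (C + (C + (R / (4 * 1) + 1 * (2 * K))) * R)).exists_bound_of_continuousOn hWc.continuousOn
      refine intervalIntegral.tendsto_integral_filter_of_dominated_convergence
        (fun _ => β / 2 * (C + (R / (4 * 1) + 1 * (2 * K))) ^ 2 + B)
        (Eventually.of_forall fun n => ?_)
        (Eventually.of_forall fun n => Eventually.of_forall fun t ht => ?_)
        intervalIntegrable_const (Eventually.of_forall fun t _ => ?_)
      · have h1 := (hp (ψ n)).continuous_deriv
        have h2 := hWc.comp (hp (ψ n)).continuous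
        exact ((continuous_const.mul (h1.norm.pow 2)).add h2).aestronglyMeasurable
      · have ht' : |t| ≤ R := by
          have := uIoc_subset_uIcc ht
          rw [uIcc_of_le (by linarith)] at this
          exact abs_le.2 this
        refine (norm_add_le _ _).trans (add_le_add ?_ ?_)
        · rw [Real.norm_of_nonneg (by positivity)]
          gcongr
          exact hvbR R _ t ht'
        · exact hB _ (by simpa using hub R _ t ht')
      · exact (((hVlim t).norm.pow 2).const_mul _).add ((hWc.tendsto _).comp (hUlim t))
    have hcross : Tendsto (fun n => ∫ x in I, inner ℝ (w (ψ n) x) (g x)) atTop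
        (𝓝 (∫ x in I, ‖g x‖ ^ 2)) := by
      have h1 := hweak ((hgm.indicator hIm).toLp _)
      have h2 : ∀ h : Lp (RVec m) 2 (volume : Measure ℝ),
          inner ℝ h ((hgm.indicator hIm).toLp (I.indicator g)) =
            ∫ x in I, inner ℝ (h x) (g x) := by
        intro h
        rw [L2.inner_def, ← integral_indicator hIm]
        refine integral_congr_ae ?_
        filter_upwards [(hgm.indicator hIm).coeFn_toLp] with x hx
        rw [hx]
        by_cases hxI : x ∈ I <;> simp [hxI]
      simp only [h2] at h1
      have e1 : ∫ x in I, inner ℝ (g x) (g x) = ∫ x in I, ‖g x‖ ^ 2 := by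
        simp only [real_inner_self_eq_norm_sq]
      rw [e1] at h1
      refine h1.congr fun n => integral_congr_ae ?_
      filter_upwards [ae_restrict_of_ae (hmem (ψ n)).coeFn_toLp] with x hx
      rw [hx]
    have hlimr : Tendsto (fun n => (∫ x in I, inner ℝ (w (ψ n) x) (g x)) -
        1 / 2 * (∫ x in I, ‖g x‖ ^ 2) + ∫ x in (-R)..R,
        (β / 2 * ‖v (ψ n) x‖ ^ 2 + W (u (ψ n) x))) atTop
        (𝓝 ((∫ x in I, ‖g x‖ ^ 2) - 1 / 2 * (∫ x in I, ‖g x‖ ^ 2) + ∫ x in (-R)..R,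
        (β / 2 * ‖V x‖ ^ 2 + W (U x)))) := (hcross.sub_const _).add hbound
    -- `|w|² / 2 ≥ ⟨w, g⟩ - |g|² / 2`, and the right side passes to the weak limit
    have hle : ∀ n, (∫ x in I, inner ℝ (w (ψ n) x) (g x)) -
        1 / 2 * (∫ x in I, ‖g x‖ ^ 2) + ∫ x in (-R)..R,
        (β / 2 * ‖v (ψ n) x‖ ^ 2 + W (u (ψ n) x)) ≤
        (action β W (u (ψ n)) (v (ψ n)) (w (ψ n))).toReal := by
      intro n
      have hE := (hp (ψ n)).integrable_energy hβ hWc hW0 (hfin (ψ n))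
      have hpos : ∀ x, 0 ≤ 1 / 2 * ‖w (ψ n) x‖ ^ 2 + β / 2 * ‖v (ψ n) x‖ ^ 2 + W (u (ψ n) x) :=
        fun x => by have := hW0 (u (ψ n) x); positivity
      have e1 : (action β W (u (ψ n)) (v (ψ n)) (w (ψ n))).toReal =
          ∫ x, (1 / 2 * ‖w (ψ n) x‖ ^ 2 + β / 2 * ‖v (ψ n) x‖ ^ 2 + W (u (ψ n) x)) := by
        rw [action, ← ofReal_integral_eq_lintegral_ofReal hE (Eventually.of_forall hpos),
          ENNReal.toReal_ofReal (integral_nonneg hpos)]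
      have i1 : IntegrableOn (fun x => inner ℝ (w (ψ n) x) (g x)) I := by
        refine Integrable.integrableOn ?_
        refine ((hw2 (ψ n)).add hg2).mono'
          ((hp (ψ n)).aestronglyMeasurable.inner hgm.aestronglyMeasurable)
          (Eventually.of_forall fun x => ?_)
        refine (norm_inner_le_norm _ _).trans ?_
        simp only [Pi.add_apply]
        nlinarith [sq_nonneg (‖w (ψ n) x‖ - ‖g x‖), sq_nonneg ‖w (ψ n) x‖, sq_nonneg ‖g x‖]
      have i2 : IntegrableOn (fun x => ‖g x‖ ^ 2) I := hg2.integrableOn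
      have i3 : IntegrableOn (fun x => β / 2 * ‖v (ψ n) x‖ ^ 2 + W (u (ψ n) x)) I := by
        have h1 := (hp (ψ n)).continuous_deriv
        have h2 := hWc.comp (hp (ψ n)).continuous
        exact ((continuous_const.mul (h1.norm.pow 2)).add h2).integrableOn_Ioc
      rw [e1, intervalIntegral.integral_of_le (by linarith), ← integral_const_mul]
      have i12 : IntegrableOn (fun x => inner ℝ (w (ψ n) x) (g x) - 1 / 2 * ‖g x‖ ^ 2) I :=
        i1.sub (i2.const_mul _)
      rw [← integral_sub i1 (i2.const_mul _), ← integral_add i12 i3]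
      refine le_trans (integral_mono (i12.add i3) hE.integrableOn fun x => ?_)
        (setIntegral_le_integral hE (Eventually.of_forall hpos))
      have hsq : 0 ≤ ‖w (ψ n) x - g x‖ ^ 2 := by positivity
      rw [norm_sub_sq_real] at hsq
      simp only
      linarith
    have hAr : Tendsto (fun n => (action β W (u (ψ n)) (v (ψ n)) (w (ψ n))).toReal) atTop
        (𝓝 A.toReal) := (ENNReal.tendsto_toReal hA').comp (hA.comp hψ.tendsto_atTop)
    have hfinal := le_of_tendsto_of_tendsto' hlimr hAr hle
    have j1 : IntegrableOn (fun x => 1 / 2 * ‖g x‖ ^ 2) I := (hg2.const_mul _).integrableOn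
    have j2 : IntegrableOn (fun x => β / 2 * ‖V x‖ ^ 2 + W (U x)) I :=
      ((continuous_const.mul (hVc.norm.pow 2)).add (hWc.comp hUc)).integrableOn_Ioc
    have e2 : ∫⁻ x in I, energyDensity β W U V g x =
        ENNReal.ofReal (∫ x in I, (1 / 2 * ‖g x‖ ^ 2 + (β / 2 * ‖V x‖ ^ 2 + W (U x)))) := by
      have j3 : IntegrableOn (fun x => 1 / 2 * ‖g x‖ ^ 2 + (β / 2 * ‖V x‖ ^ 2 + W (U x))) I :=
        j1.add j2
      rw [ofReal_integral_eq_lintegral_ofReal j3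
        (Eventually.of_forall fun x => by
          have := hW0 (U x)
          simp only [Pi.zero_apply]
          positivity)]
      simp only [energyDensity, add_assoc]
    rw [e2, ← ENNReal.ofReal_toReal hA']
    refine ENNReal.ofReal_le_ofReal (le_trans (le_of_eq ?_) hfinal)
    rw [integral_add j1 j2, integral_const_mul, intervalIntegral.integral_of_le (by linarith)]
    ring
  have hmeas : AEMeasurable (energyDensity β W U V g) volume := by
    refine AEMeasurable.ennreal_ofReal ?_
    exact (((hgm.aestronglyMeasurable.norm.pow 2).const_mul _).add
      ((hVc.norm.pow 2).aestronglyMeasurable.const_mul _)).add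
      (hWc.comp hUc).aestronglyMeasurable |>.aemeasurable
  refine le_of_tendsto' (AECover.lintegral_tendsto_of_nat
    (aecover_Ioc (a := fun n : ℕ => -(n : ℝ)) (b := fun n : ℕ => (n : ℝ))
      (tendsto_neg_atTop_atBot.comp tendsto_natCast_atTop_atTop)
      tendsto_natCast_atTop_atTop) hmeas) fun n => hloc n (Nat.cast_nonneg n)

/-! ### Existence of a minimizer -/

/-- A function which is square integrable near `+∞` together with its derivative tends to zero. -/
lemma tendsto_zero_of_integrableOn_norm_sq {f f' : ℝ → RVec m} {T : ℝ}
    (hf : ∀ x, HasDerivAt f (f' x) x) (hc : Continuous f')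
    (h1 : IntegrableOn (fun x => ‖f x‖ ^ 2) (Ioi T))
    (h2 : IntegrableOn (fun x => ‖f' x‖ ^ 2) (Ioi T)) : Tendsto f atTop (𝓝 0) := by
  have hfc : Continuous f := continuous_iff_continuousAt.2 fun x => (hf x).continuousAt
  have h3 : IntegrableOn (fun x => 2 * inner ℝ (f x) (f' x)) (Ioi T) := by
    refine Integrable.mono' (h1.add h2) (by fun_prop) (Eventually.of_forall fun x => ?_)
    rw [norm_mul, Real.norm_of_nonneg zero_le_two]
    have := norm_inner_le_norm (𝕜 := ℝ) (f x) (f' x)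
    simp only [Pi.add_apply]
    nlinarith [sq_nonneg (‖f x‖ - ‖f' x‖)]
  have h4 := tendsto_zero_of_hasDerivAt_of_integrableOn_Ioi (fun x _ => (hf x).norm_sq) h3 h1
  rw [tendsto_zero_iff_norm_tendsto_zero]
  have h5 := (Real.continuous_sqrt.tendsto 0).comp h4
  simpa [Function.comp_def, Real.sqrt_sq (norm_nonneg _)] using h5

section

variable {β : ℝ} {W : RVec m → ℝ} {a b : RVec m} {u v w : ℝ → RVec m}

lemma IsH2Path.integrableOn_of_trapped (hβ : 0 < β) (hWc : Continuous W) (hW0 : ∀ z, 0 ≤ W z)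
    (h : IsH2Path u v w) (hfin : action β W u v w ≠ ⊤) {r c T : ℝ} (hc : 0 < c)
    (hq : ∀ z, ‖z - b‖ ≤ r → c * ‖z - b‖ ^ 2 ≤ W z) (ht : ∀ t, T ≤ t → ‖u t - b‖ ≤ r) :
    IntegrableOn (fun x => ‖u x - b‖ ^ 2) (Ioi T) := by
  have hc' := h.continuous
  refine Integrable.mono' ((h.integrable_potential hβ hWc hW0 hfin).const_mul c⁻¹).integrableOn
    (by fun_prop) ?_
  refine (ae_restrict_iff' measurableSet_Ioi).2 (Eventually.of_forall fun x hx => ?_)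
  rw [Real.norm_of_nonneg (by positivity)]
  have := hq (u x) (ht x (le_of_lt hx))
  rw [inv_mul_eq_div, le_div_iff₀ hc]
  linarith

lemma IsH2Path.tendsto_of_trapped (hβ : 0 < β) (hWc : Continuous W) (hW0 : ∀ z, 0 ≤ W z)
    (h : IsH2Path u v w) (hfin : action β W u v w ≠ ⊤) {r c T : ℝ} (hc : 0 < c)
    (hq : ∀ z, ‖z - b‖ ≤ r → c * ‖z - b‖ ^ 2 ≤ W z) (ht : ∀ t, T ≤ t → ‖u t - b‖ ≤ r) :
    Tendsto u atTop (𝓝 b) := by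
  have := tendsto_zero_of_integrableOn_norm_sq (f := fun x => u x - b)
    (fun x => (h.hasDerivAt x).sub_const b)
    h.continuous_deriv (h.integrableOn_of_trapped hβ hWc hW0 hfin hc hq ht)
    (h.integrable_norm_sq_fst hβ hWc hW0 hfin).integrableOn
  simpa using this.add_const b

/-- A path of finite action is square integrably close to its limit at `+∞`. -/
lemma Connects.exists_integrableOn_norm_sq (hW : IsDoubleWell W a b) (hβ : 0 < β)
    (h : Connects a b u v w) (hfin : action β W u v w ≠ ⊤) :
    ∃ T, IntegrableOn (fun x => ‖u x - b‖ ^ 2) (Ioi T) := by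
  obtain ⟨r, hr, c, hc, hq⟩ := hW.exists_quadratic_le
  have hev := (tendsto_iff_norm_sub_tendsto_zero.1 h.tendsto_atTop).eventually (gt_mem_nhds hr)
  obtain ⟨T, hT⟩ := eventually_atTop.1 hev
  exact ⟨T, h.path.integrableOn_of_trapped hβ hW.continuous hW.nonneg hfin hc hq
    fun t ht => (hT t ht).le⟩

/-- The direct method: the action attains its infimum over the paths from `a` to `b`. The paths of
a minimizing sequence are translated so that their transitions take place in one bounded interval,
which is what ensures that the limit connects `a` to `b`. -/
theorem IsDoubleWell.exists_minimizer (hW : IsDoubleWell W a b) (hβ : 0 < β)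
    (hfin : infAction β W a b ≠ ⊤) :
    ∃ u v w, Connects a b u v w ∧ action β W u v w = infAction β W a b := by
  obtain ⟨r₁, hr₁, c₁, hc₁, hq₁⟩ := hW.symm.exists_quadratic_le
  obtain ⟨r₂, hr₂, c₂, hc₂, hq₂⟩ := hW.exists_quadratic_le
  set ρ := min r₁ r₂
  have hρ : 0 < ρ := lt_min hr₁ hr₂
  obtain ⟨η, hη, L, hL⟩ := hW.exists_transition_time hβ hfin hρ
  set I := infAction β W a b
  have hex : ∀ n : ℕ, ∃ u v w, Connects a b u v w ∧
      action β W u v w < I + ENNReal.ofReal (min η (1 / (n + 1))) := fun n => by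
    refine exists_connects_action_lt (ENNReal.lt_add_right hfin ?_)
    have : 0 < min η (1 / ((n : ℝ) + 1)) := by positivity
    simpa using this
  choose u v w hconn hact using hex
  have hact' : ∀ n, action β W (u n) (v n) (w n) ≤ I + ENNReal.ofReal η := fun n =>
    (hact n).le.trans (by gcongr; exact min_le_left _ _)
  choose s hs hleft hright using fun n => hL _ _ _ (hconn n) (hact' n)
  have htend : Tendsto (fun n => action β W (u n) (v n) (w n)) atTop (𝓝 I) := by
    refine tendsto_of_tendsto_of_tendsto_of_le_of_le tendsto_const_nhds
      (h := fun n : ℕ => I + ENNReal.ofReal (1 / ((n : ℝ) + 1))) ?_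
      (fun n => (hconn n).infAction_le)
      (fun n => (hact n).le.trans
        (add_le_add le_rfl (ENNReal.ofReal_le_ofReal (min_le_right _ _))))
    have h1 := ENNReal.tendsto_ofReal (tendsto_one_div_add_atTop_nhds_zero_nat (𝕜 := ℝ))
    simpa using h1.const_add I
  have hKtop : I + ENNReal.ofReal η ≠ ⊤ := ENNReal.add_ne_top.2 ⟨hfin, ENNReal.ofReal_ne_top⟩
  obtain ⟨U, V, Z, hpath, hle, ψ, hψ, hlim⟩ := exists_limit_path hβ hW.continuous hW.nonneg
    (fun n => ((hconn n).comp_add (s n)).path) (A := I) (K := (I + ENNReal.ofReal η).toReal)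
    (C := ‖a‖ + ρ) ENNReal.toReal_nonneg
    (fun n => by rw [action_comp_add, ENNReal.ofReal_toReal hKtop]; exact hact' n)
    (by simpa only [action_comp_add] using htend)
    (fun n => by
      have h1 := hleft n (s n) le_rfl
      have h2 : u n (s n) = a + (u n (s n) - a) := by abel
      rw [zero_add, h2]
      exact (norm_add_le _ _).trans (add_le_add le_rfl h1))
    (fun n => by
      rw [zero_add]
      exact (hs n).trans (le_add_of_nonneg_left (norm_nonneg a)))
  have hUfin : action β W U V Z ≠ ⊤ := ne_top_of_le_ne_top hfin hle
  have hUl : ∀ t, t ≤ 0 → ‖U t - a‖ ≤ r₁ := fun t ht => by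
    refine le_of_tendsto' ((hlim t).sub_const a).norm fun n => ?_
    exact (hleft (ψ n) _ (by linarith)).trans (min_le_left _ _)
  have hUr : ∀ t, L ≤ t → ‖U t - b‖ ≤ r₂ := fun t ht => by
    refine le_of_tendsto' ((hlim t).sub_const b).norm fun n => ?_
    exact (hright (ψ n) _ (by linarith)).trans (min_le_right _ _)
  have hbot : Tendsto U atBot (𝓝 a) := by
    have h1 := hpath.comp_neg.tendsto_of_trapped hβ hW.continuous hW.nonneg
      (by rwa [action_comp_neg]) hc₁ hq₁ (T := 0) (fun t ht => hUl (-t) (by linarith))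
    simpa [Function.comp_def] using h1.comp tendsto_neg_atBot_atTop
  have hconnU : Connects a b U V Z := ⟨hpath, hbot,
    hpath.tendsto_of_trapped hβ hW.continuous hW.nonneg hUfin hc₂ hq₂ hUr⟩
  exact ⟨U, V, Z, hconnU, le_antisymm hle hconnU.infAction_le⟩

end

/-! ### The Euler–Lagrange equation -/

section

variable {β : ℝ} {W : RVec m → ℝ} {a b : RVec m} {u v w η η' g : ℝ → RVec m}

lemma norm_inner_add_smul_le {x y : RVec m} {t : ℝ} (ht : t ∈ Icc (-1 : ℝ) 1) :
    ‖inner ℝ (x + t • y) y‖ ≤ ‖x‖ ^ 2 + 2 * ‖y‖ ^ 2 := by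
  refine (norm_inner_le_norm _ _).trans ?_
  have h1 : ‖x + t • y‖ ≤ ‖x‖ + ‖y‖ := by
    refine (norm_add_le _ _).trans (add_le_add le_rfl ?_)
    rw [norm_smul]
    exact mul_le_of_le_one_left (norm_nonneg _) (abs_le.2 ht)
  nlinarith [norm_nonneg x, norm_nonneg y, sq_nonneg (‖x‖ - ‖y‖),
    mul_le_mul_of_nonneg_right h1 (norm_nonneg y)]

lemma integrable_norm_add_smul_sq {s : Set ℝ} {f g : ℝ → RVec m}
    (hf : AEStronglyMeasurable f (volume.restrict s))
    (hg : AEStronglyMeasurable g (volume.restrict s))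
    (hf2 : IntegrableOn (fun x => ‖f x‖ ^ 2) s) (hg2 : IntegrableOn (fun x => ‖g x‖ ^ 2) s)
    (t : ℝ) : IntegrableOn (fun x => ‖f x + t • g x‖ ^ 2) s :=
  (memLp_two_iff_integrable_sq_norm (hf.add (hg.const_smul t))).1
    (((memLp_two_iff_integrable_sq_norm hf).2 hf2).add
      (((memLp_two_iff_integrable_sq_norm hg).2 hg2).const_smul t))

/-- The first variation of the action vanishes at a minimizer, for compactly supported
perturbations. -/
lemma Connects.first_variation (hβ : 0 < β) (hW : IsDoubleWell W a b) (h : Connects a b u v w)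
    (hmin : action β W u v w = infAction β W a b) (hfin : infAction β W a b ≠ ⊤) {R : ℝ}
    (hp : IsH2Path η η' g) (hg2 : Integrable fun x => ‖g x‖ ^ 2) (hη0 : ∀ x, R ≤ |x| → η x = 0)
    (hη0' : ∀ x, R ≤ |x| → η' x = 0) (hg0 : ∀ x ∉ Ioc (-R) R, g x = 0) :
    ∫ x in Ioc (-R) R, (inner ℝ (w x) (g x) + β * inner ℝ (v x) (η' x) +
      inner ℝ (gradient W (u x)) (η x)) = 0 := by
  set I := Ioc (-R) R
  have hIm : MeasurableSet I := measurableSet_Ioc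
  have hout : ∀ x ∉ I, R ≤ |x| := fun x hx => by
    by_contra! hn
    have := abs_lt.1 hn
    exact hx ⟨this.1, this.2.le⟩
  have hufin : action β W u v w ≠ ⊤ := by rwa [hmin]
  have hu := h.path.continuous
  have hv := h.path.continuous_deriv
  have hη := hp.continuous
  have hη' := hp.continuous_deriv
  have hWc := hW.continuous
  have hdW : Continuous (fderiv ℝ W) := hW.contDiff.continuous_fderiv (by simp)
  have hw2 := h.path.integrable_norm_sq_snd hβ hWc hW.nonneg hufin
  set F : ℝ → ℝ → ℝ := fun t x =>
    1 / 2 * ‖w x + t • g x‖ ^ 2 + β / 2 * ‖v x + t • η' x‖ ^ 2 + W (u x + t • η x)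
  set F' : ℝ → ℝ → ℝ := fun t x =>
    inner ℝ (w x + t • g x) (g x) + β * inner ℝ (v x + t • η' x) (η' x) +
      fderiv ℝ W (u x + t • η x) (η x)
  have hFint : ∀ t, IntegrableOn (F t) I := fun t => by
    have i1 : IntegrableOn (fun x => ‖w x + t • g x‖ ^ 2) I :=
      integrable_norm_add_smul_sq h.path.aestronglyMeasurable.restrict
        hp.aestronglyMeasurable.restrict hw2.integrableOn hg2.integrableOn t
    have i2 : IntegrableOn (fun x => β / 2 * ‖v x + t • η' x‖ ^ 2 + W (u x + t • η x)) I :=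
      Continuous.integrableOn_Ioc (by fun_prop)
    refine ((i1.const_mul (1 / 2)).add i2).congr (Eventually.of_forall fun x => ?_)
    simp only [F, Pi.add_apply, add_assoc]
  have hF0 : ∀ t x, 0 ≤ F t x := fun t x => by
    have := hW.nonneg (u x + t • η x)
    simp only [F]
    positivity
  -- the action of the perturbed path
  have hsplit : ∀ t, action β W (fun x => u x + t • η x) (fun x => v x + t • η' x)
      (fun x => w x + t • g x) =
      ENNReal.ofReal (∫ x in I, F t x) + ∫⁻ x in Iᶜ, energyDensity β W u v w x := by
    intro t
    rw [action_eq, ← lintegral_add_compl _ hIm, ofReal_integral_eq_lintegral_ofReal (hFint t)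
      (Eventually.of_forall (hF0 t))]
    congr 1
    refine setLIntegral_congr_fun hIm.compl fun x hx => ?_
    simp [energyDensity, hη0 x (hout x hx), hη0' x (hout x hx), hg0 x hx]
  have hlocmin : ∀ t, ∫ x in I, F 0 x ≤ ∫ x in I, F t x := by
    intro t
    have hconn : Connects a b (fun x => u x + t • η x) (fun x => v x + t • η' x)
        (fun x => w x + t • g x) := by
      refine ⟨h.path.add (hp.const_smul t), h.tendsto_atBot.congr' ?_, h.tendsto_atTop.congr' ?_⟩
      · filter_upwards [eventually_le_atBot (-R)] with x hx
        rw [hη0 x (le_trans (by linarith) (neg_le_abs x)), smul_zero, add_zero]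
      · filter_upwards [eventually_ge_atTop R] with x hx
        rw [hη0 x (hx.trans (le_abs_self x)), smul_zero, add_zero]
    have h1 := hconn.infAction_le (β := β) (W := W)
    have h2 := hsplit 0
    simp only [zero_smul, add_zero] at h2
    rw [← hmin, h2, hsplit t] at h1
    have hne : ∫⁻ x in Iᶜ, energyDensity β W u v w x ≠ ⊤ :=
      ne_top_of_le_ne_top hufin (setLIntegral_energyDensity_le ..)
    have h3 := (ENNReal.add_le_add_iff_right hne).1 h1
    exact (ENNReal.ofReal_le_ofReal_iff (integral_nonneg (hF0 t))).1 h3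
  obtain ⟨B, hB⟩ := (isCompact_Icc.prod isCompact_Icc : IsCompact
    (Icc (-1 : ℝ) 1 ×ˢ Icc (-R) R)).exists_bound_of_continuousOn
    (f := fun z : ℝ × ℝ => fderiv ℝ W (u z.2 + z.1 • η z.2) (η z.2))
    (by
      refine Continuous.continuousOn ?_
      exact (hdW.comp (by fun_prop)).clm_apply (by fun_prop))
  have hder := hasDerivAt_integral_of_dominated_loc_of_deriv_le (μ := volume.restrict I) (F := F)
    (F' := F') (x₀ := (0 : ℝ)) (s := Icc (-1 : ℝ) 1)
    (bound := fun x => (‖w x‖ ^ 2 + 2 * ‖g x‖ ^ 2) + β * (‖v x‖ ^ 2 + 2 * ‖η' x‖ ^ 2) + B)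
    (Icc_mem_nhds (by norm_num) (by norm_num))
    (Eventually.of_forall fun t => (hFint t).aestronglyMeasurable) (hFint 0)
    (by
      simp only [F', zero_smul, add_zero]
      refine ((h.path.aestronglyMeasurable.inner hp.aestronglyMeasurable).restrict.add ?_).add ?_
      · exact Continuous.aestronglyMeasurable (by fun_prop)
      · exact Continuous.aestronglyMeasurable ((hdW.comp hu).clm_apply hη))
    ((ae_restrict_iff' hIm).2 (Eventually.of_forall fun x hx t ht => by
      refine (norm_add_le _ _).trans (add_le_add ((norm_add_le _ _).trans (add_le_add ?_ ?_)) ?_)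
      · exact norm_inner_add_smul_le ht
      · rw [norm_mul, Real.norm_of_nonneg hβ.le]
        gcongr
        exact norm_inner_add_smul_le ht
      · exact hB (t, x) ⟨ht, Ioc_subset_Icc_self hx⟩))
    (by
      have i1 : IntegrableOn (fun x => ‖w x‖ ^ 2 + 2 * ‖g x‖ ^ 2) I :=
        (hw2.add (hg2.const_mul 2)).integrableOn
      have i2 : IntegrableOn (fun x => β * (‖v x‖ ^ 2 + 2 * ‖η' x‖ ^ 2) + B) I :=
        Continuous.integrableOn_Ioc (by fun_prop)
      refine (i1.add i2).congr (Eventually.of_forall fun x => ?_)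
      simp only [Pi.add_apply, add_assoc])
    (Eventually.of_forall fun x t _ => by
      have hl : ∀ y z : RVec m, HasDerivAt (fun t : ℝ => y + t • z) z t := fun y z => by
        simpa using ((hasDerivAt_id t).smul_const z).const_add y
      have h1 := ((hl (w x) (g x)).norm_sq.const_mul (1 / 2)).add
        ((hl (v x) (η' x)).norm_sq.const_mul (β / 2))
      have h2 := ((hW.contDiff.differentiable (by simp) (u x + t • η x)).hasFDerivAt).comp_hasDerivAt
        t (hl (u x) (η x))
      convert! h1.add h2 using 1
      simp only [F']
      ring)
  have hz := IsLocalMin.hasDerivAt_eq_zero (Eventually.of_forall hlocmin) hder.2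
  rw [← hz]
  refine integral_congr_ae (Eventually.of_forall fun x => ?_)
  simp [F', inner_gradient_left]

end

section

variable {β : ℝ} {W : RVec m → ℝ} {a b : RVec m} {u v w g G G₁ : ℝ → RVec m}

/-- Two integrations of a function supported in `(-R, R]` whose first two moments vanish give a
path which vanishes outside of `(-R, R)`. -/
lemma exists_compactly_supported_path {R : ℝ} (hR : 0 < R) (hg : Integrable g)
    (hg0 : ∀ x ∉ Ioc (-R) R, g x = 0) (hm0 : ∫ x in (-R)..R, g x = 0)
    (hm1 : ∫ x in (-R)..R, x • g x = 0) :
    ∃ η η', IsH2Path η η' g ∧ (∀ x, R ≤ |x| → η x = 0) ∧ ∀ x, R ≤ |x| → η' x = 0 := by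
  have hgi : ∀ x y, IntervalIntegrable g volume x y := fun x y => hg.intervalIntegrable
  set η' : ℝ → RVec m := fun x => ∫ t in (-R)..x, g t
  have hη'c : Continuous η' := intervalIntegral.continuous_primitive hgi (-R)
  set η : ℝ → RVec m := fun x => ∫ t in (-R)..x, η' t
  have hηd : ∀ x, HasDerivAt η (η' x) x := fun x =>
    intervalIntegral.integral_hasDerivAt_right (hη'c.intervalIntegrable _ _)
      hη'c.stronglyMeasurable.stronglyMeasurableAtFilter hη'c.continuousAt
  have hpath : IsH2Path η η' g := .of_base (-R) hηd hg.locallyIntegrable fun y => by simp [η']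
  have hzero : ∀ x, R ≤ |x| → η' x = 0 := by
    intro x hx
    rcases le_abs'.1 hx with hx | hx
    · have : ∫ t in x..(-R), g t = ∫ t in x..(-R), (0 : RVec m) := by
        refine intervalIntegral.integral_congr fun t ht => ?_
        rw [uIcc_of_le hx] at ht
        exact hg0 t fun h => absurd h.1 (not_lt.2 ht.2)
      simp only [η']
      rw [intervalIntegral.integral_symm, this]; simp
    · have : ∫ t in R..x, g t = ∫ t in R..x, (0 : RVec m) := by
        refine intervalIntegral.integral_congr_ae (Eventually.of_forall fun t ht => ?_)
        rw [uIoc_of_le hx] at ht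
        exact hg0 t fun h => absurd h.2 (not_le.2 ht.1)
      simp only [η']
      rw [← intervalIntegral.integral_add_adjacent_intervals (hgi _ R) (hgi R _), hm0, this]
      simp
  have hηR : η R = 0 := by
    have h1 := integral_deriv_smul_primitive (p := fun x => x) (p' := fun _ => 1) (Q := η')
      (g := g) (a := -R) (b := R) (by linarith) (fun x => hasDerivAt_id x) continuous_const
      (hgi _ _) (fun x _ => by simp [η'])
    simpa [hm1, hzero R (le_abs_self R), hzero (-R) (by simp [le_abs_self]), η] using h1
  refine ⟨η, η', hpath, fun x hx => ?_, hzero⟩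
  rcases le_abs'.1 hx with hx | hx
  · have h1 := hpath.sub_eq_integral x (-R)
    have h2 : ∫ t in x..(-R), η' t = ∫ t in x..(-R), (0 : RVec m) := by
      refine intervalIntegral.integral_congr fun t ht => ?_
      rw [uIcc_of_le hx] at ht
      exact hzero t (le_trans (by linarith [ht.2]) (neg_le_abs t))
    rw [h2] at h1
    have h3 : η (-R) = 0 := by simp [η]
    rw [h3] at h1
    simpa using h1
  · have h1 := hpath.sub_eq_integral R x
    have h2 : ∫ t in R..x, η' t = ∫ t in R..x, (0 : RVec m) := by
      refine intervalIntegral.integral_congr fun t ht => ?_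
      rw [uIcc_of_le hx] at ht
      exact hzero t (ht.1.trans (le_abs_self t))
    rw [h2, hηR] at h1
    simpa using h1

/-- The integrated Euler–Lagrange equation: `w - βu + G`, with `G'' = ∇W(u)`, is orthogonal to all
functions with vanishing first two moments. -/
lemma Connects.integral_inner_eq_zero (hβ : 0 < β) (hW : IsDoubleWell W a b)
    (h : Connects a b u v w) (hmin : action β W u v w = infAction β W a b)
    (hfin : infAction β W a b ≠ ⊤)
    (hG : ∀ x, HasDerivAt G (G₁ x) x) (hG₁ : ∀ x, HasDerivAt G₁ (gradient W (u x)) x)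
    {R : ℝ} (hR : 0 < R) (hg : Integrable g) (hg2 : Integrable fun x => ‖g x‖ ^ 2)
    (hg0 : ∀ x ∉ Ioc (-R) R, g x = 0) (hm0 : ∫ x in (-R)..R, g x = 0)
    (hm1 : ∫ x in (-R)..R, x • g x = 0) :
    ∫ x in (-R)..R, inner ℝ (w x - β • u x + G x) (g x) = 0 := by
  obtain ⟨η, η', hp, hη0, hη0'⟩ := exists_compactly_supported_path hR hg hg0 hm0 hm1
  have hvar := h.first_variation hβ hW hmin hfin hp hg2 hη0 hη0' hg0
  rw [← intervalIntegral.integral_of_le (by linarith)] at hvar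
  have hle : -R ≤ R := by linarith
  have hu := h.path.continuous
  have hv := h.path.continuous_deriv
  have hGc : Continuous G := continuous_iff_continuousAt.2 fun x => (hG x).continuousAt
  have hG₁c : Continuous G₁ := continuous_iff_continuousAt.2 fun x => (hG₁ x).continuousAt
  have hgrad : Continuous fun x => gradient W (u x) := by
    have hdW : Continuous (fderiv ℝ W) := hW.contDiff.continuous_fderiv (by simp)
    exact (InnerProductSpace.toDual ℝ (RVec m)).symm.continuous.comp (hdW.comp hu)
  have hη := hp.continuous
  have hη' := hp.continuous_deriv
  have hgi : IntervalIntegrable g volume (-R) R := hg.intervalIntegrable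
  have hη0R : η R = 0 := hη0 R (le_abs_self R)
  have hη0R' : η' R = 0 := hη0' R (le_abs_self R)
  have hη0l : η (-R) = 0 := hη0 (-R) (by simp [le_abs_self])
  have hη0l' : η' (-R) = 0 := hη0' (-R) (by simp [le_abs_self])
  have e1 : ∫ x in (-R)..R, inner ℝ (v x) (η' x) = -∫ x in (-R)..R, inner ℝ (u x) (g x) := by
    rw [integral_inner_deriv_primitive hle h.path.hasDerivAt hv hgi
      (fun x _ => hp.eq_add _ _), hη0R', hη0l']
    simp
  have e2 : ∫ x in (-R)..R, inner ℝ (gradient W (u x)) (η x) =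
      ∫ x in (-R)..R, inner ℝ (G x) (g x) := by
    rw [integral_inner_deriv_primitive (g := η') hle hG₁ hgrad (hη'.intervalIntegrable _ _)
      (fun x _ => by rw [← hp.sub_eq_integral]; abel), hη0R, hη0l,
      integral_inner_deriv_primitive hle hG hG₁c hgi (fun x _ => hp.eq_add _ _), hη0R', hη0l']
    simp
  have hufin : action β W u v w ≠ ⊤ := by rwa [hmin]
  have hw2 := h.path.integrable_norm_sq_snd hβ hW.continuous hW.nonneg hufin
  have i0 : IntervalIntegrable (fun x => inner ℝ (w x) (g x)) volume (-R) R := by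
    refine Integrable.intervalIntegrable ?_
    refine (hw2.add hg2).mono' (h.path.aestronglyMeasurable.inner hg.aestronglyMeasurable)
      (Eventually.of_forall fun x => (norm_inner_le_norm _ _).trans ?_)
    simp only [Pi.add_apply]
    nlinarith [sq_nonneg (‖w x‖ - ‖g x‖), sq_nonneg ‖w x‖, sq_nonneg ‖g x‖]
  have hcont : ∀ f : ℝ → RVec m, Continuous f →
      IntervalIntegrable (fun x => inner ℝ (f x) (g x)) volume (-R) R := by
    intro f hf
    obtain ⟨C, hC⟩ := (isCompact_Icc (a := -R) (b := R)).exists_bound_of_continuousOn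
      hf.continuousOn
    rw [intervalIntegrable_iff_integrableOn_Ioc_of_le hle]
    refine Integrable.mono' (hg.norm.const_mul C).integrableOn
      (hf.aestronglyMeasurable.inner hg.aestronglyMeasurable).restrict
      ((ae_restrict_iff' measurableSet_Ioc).2 (Eventually.of_forall fun x hx => ?_))
    exact (norm_inner_le_norm _ _).trans
      (mul_le_mul_of_nonneg_right (hC x (Ioc_subset_Icc_self hx)) (norm_nonneg _))
  have i1 : IntervalIntegrable (fun x => β * inner ℝ (v x) (η' x)) volume (-R) R :=
    Continuous.intervalIntegrable (by fun_prop) _ _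
  have i2 : IntervalIntegrable (fun x => inner ℝ (gradient W (u x)) (η x)) volume (-R) R :=
    Continuous.intervalIntegrable (hgrad.inner hη) _ _
  rw [intervalIntegral.integral_add (i0.add i1) i2, intervalIntegral.integral_add i0 i1,
    intervalIntegral.integral_const_mul, e1, e2] at hvar
  have e3 : ∀ x, inner ℝ (w x - β • u x + G x) (g x) =
      inner ℝ (w x) (g x) - β * inner ℝ (u x) (g x) + inner ℝ (G x) (g x) := fun x => by
    rw [inner_add_left, inner_sub_left, real_inner_smul_left]
  simp only [e3]
  rw [intervalIntegral.integral_add (i0.sub ((hcont u hu).const_mul β)) (hcont G hGc),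
    intervalIntegral.integral_sub i0 ((hcont u hu).const_mul β),
    intervalIntegral.integral_const_mul]
  linarith

/-- A square integrable function on `(-R, R]` which is orthogonal to all functions with vanishing
first two moments is affine: test with its own difference to the affine function that has the same
moments. -/
lemma ae_eq_affine_of_orthogonal {f : ℝ → RVec m} {R : ℝ} (hR : 0 < R)
    (hf : AEStronglyMeasurable f volume)
    (hf2 : IntegrableOn (fun x => ‖f x‖ ^ 2) (Ioc (-R) R))
    (h : ∀ g : ℝ → RVec m, Integrable g → Integrable (fun x => ‖g x‖ ^ 2) →
      (∀ x ∉ Ioc (-R) R, g x = 0) → ∫ x in (-R)..R, g x = 0 → ∫ x in (-R)..R, x • g x = 0 →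
      ∫ x in (-R)..R, inner ℝ (f x) (g x) = 0) :
    ∃ c d : RVec m, ∀ᵐ x, x ∈ Ioc (-R) R → f x = c + x • d := by
  have hle : -R ≤ R := by linarith
  set I := Ioc (-R) R
  have hIm : MeasurableSet I := measurableSet_Ioc
  have hfI : MemLp f 2 (volume.restrict I) :=
    (memLp_two_iff_integrable_sq_norm hf.restrict).2 hf2
  set c : RVec m := (2 * R)⁻¹ • ∫ x in (-R)..R, f x
  set d : RVec m := (2 * R ^ 3 / 3)⁻¹ • ∫ x in (-R)..R, x • f x
  refine ⟨c, d, ?_⟩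
  set k : ℝ → RVec m := fun x => f x - (c + x • d)
  have hkI : MemLp k 2 (volume.restrict I) := by
    refine hfI.sub ?_
    have hc : Continuous fun x : ℝ => c + x • d := by fun_prop
    exact (memL2loc_of_continuous hc (Icc (-R) R) isCompact_Icc).mono_measure
      (Measure.restrict_mono Ioc_subset_Icc_self le_rfl)
  set g : ℝ → RVec m := I.indicator k
  have hg2 : MemLp g 2 volume := (memLp_indicator_iff_restrict hIm).2 hkI
  have hgI : ∀ x ∈ I, g x = k x := fun x hx => indicator_of_mem hx k
  have hg0 : ∀ x ∉ I, g x = 0 := fun x hx => indicator_of_notMem hx k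
  have hki : IntegrableOn k I := hkI.integrable one_le_two
  have hg1 : Integrable g := (integrable_indicator_iff hIm).2 hki
  have hg2' : Integrable fun x => ‖g x‖ ^ 2 :=
    (memLp_two_iff_integrable_sq_norm hg2.aestronglyMeasurable).1 hg2
  have hfi : IntervalIntegrable f volume (-R) R :=
    (intervalIntegrable_iff_integrableOn_Ioc_of_le hle).2 (hfI.integrable one_le_two)
  have hgi : IntervalIntegrable g volume (-R) R := hg1.intervalIntegrable
  have hcongr : ∀ {E : Type} [NormedAddCommGroup E] [NormedSpace ℝ E] (p : ℝ → RVec m → E),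
      ∫ x in (-R)..R, p x (g x) = ∫ x in (-R)..R, p x (k x) := by
    intro E _ _ p
    refine intervalIntegral.integral_congr_ae (Eventually.of_forall fun x hx => ?_)
    rw [uIoc_of_le hle] at hx
    simp only [hgI x hx]
  have hx1 : ∫ x in (-R)..R, x = 0 := by simp
  have hx2 : ∫ x in (-R)..R, x ^ 2 = 2 * R ^ 3 / 3 := by
    rw [integral_pow]; norm_num; ring
  have hxc : ∫ x in (-R)..R, x • c = 0 := by
    rw [intervalIntegral.integral_smul_const, hx1, zero_smul]
  have hxd : ∫ x in (-R)..R, x • d = 0 := by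
    rw [intervalIntegral.integral_smul_const, hx1, zero_smul]
  have hm0 : ∫ x in (-R)..R, g x = 0 := by
    rw [hcongr (fun _ z => z)]
    simp only [k]
    rw [intervalIntegral.integral_sub hfi (Continuous.intervalIntegrable (by fun_prop) _ _),
      intervalIntegral.integral_add intervalIntegrable_const
      (Continuous.intervalIntegrable (by fun_prop) _ _), hxd, intervalIntegral.integral_const,
      add_zero, sub_neg_eq_add, ← two_mul]
    simp only [c]
    rw [smul_inv_smul₀ (by positivity), sub_self]
  have hm1 : ∫ x in (-R)..R, x • g x = 0 := by
    rw [hcongr (fun x z => x • z)]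
    simp only [k, smul_sub, smul_add, smul_smul, ← pow_two]
    have hxf : IntervalIntegrable (fun x => x • f x) volume (-R) R :=
      hfi.continuousOn_smul continuousOn_id
    rw [intervalIntegral.integral_sub hxf
      (Continuous.intervalIntegrable (by fun_prop) _ _),
      intervalIntegral.integral_add (Continuous.intervalIntegrable (by fun_prop) _ _)
      (Continuous.intervalIntegrable (by fun_prop) _ _), hxc, zero_add,
      intervalIntegral.integral_smul_const, hx2]
    simp only [d]
    rw [smul_inv_smul₀ (by positivity), sub_self]
  have hfg := h g hg1 hg2' hg0 hm0 hm1
  have hinner : ∀ p : ℝ → ℝ, Continuous p → ∀ z : RVec m,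
      ∫ x in (-R)..R, inner ℝ (p x • z) (g x) = inner ℝ z (∫ x in (-R)..R, p x • g x) := by
    intro p hp z
    have h1 := (innerSL ℝ z).intervalIntegral_comp_comm
      (hgi.continuousOn_smul (f := p) hp.continuousOn)
    simp only [innerSL_apply_apply] at h1
    rw [← h1]
    refine intervalIntegral.integral_congr fun x _ => ?_
    simp only [real_inner_smul_left, real_inner_smul_right]
  have hcg : ∫ x in (-R)..R, inner ℝ c (g x) = 0 := by
    have := hinner (fun _ => 1) continuous_const c
    simpa [hm0] using this
  have hdg : ∫ x in (-R)..R, inner ℝ (x • d) (g x) = 0 := by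
    have := hinner (fun x => x) continuous_id d
    simpa [hm1] using this
  have hI : ∀ p : ℝ → RVec m, MemLp p 2 (volume.restrict I) →
      IntervalIntegrable (fun x => inner ℝ (p x) (g x)) volume (-R) R := by
    intro p hp
    rw [intervalIntegrable_iff_integrableOn_Ioc_of_le hle]
    have h1 := (memLp_two_iff_integrable_sq_norm hp.aestronglyMeasurable).1 hp
    refine (h1.add hg2'.integrableOn).mono'
      (hp.aestronglyMeasurable.inner hg1.aestronglyMeasurable.restrict)
      (Eventually.of_forall fun x => (norm_inner_le_norm _ _).trans ?_)
    simp only [Pi.add_apply]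
    nlinarith [sq_nonneg (‖p x‖ - ‖g x‖), sq_nonneg ‖p x‖, sq_nonneg ‖g x‖]
  have hcm : ∀ p : ℝ → RVec m, Continuous p → MemLp p 2 (volume.restrict I) := fun p hp =>
    (memL2loc_of_continuous hp (Icc (-R) R) isCompact_Icc).mono_measure
      (Measure.restrict_mono Ioc_subset_Icc_self le_rfl)
  have hgg : ∫ x in (-R)..R, ‖g x‖ ^ 2 = 0 := by
    have e : ∫ x in (-R)..R, ‖g x‖ ^ 2 = ∫ x in (-R)..R,
        (inner ℝ (f x) (g x) - (inner ℝ c (g x) + inner ℝ (x • d) (g x))) := by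
      refine intervalIntegral.integral_congr_ae (Eventually.of_forall fun x hx => ?_)
      rw [uIoc_of_le hle] at hx
      rw [← real_inner_self_eq_norm_sq, ← inner_add_left, ← inner_sub_left]
      congr 1
      exact hgI x hx
    rw [e, intervalIntegral.integral_sub (hI f hfI)
      ((hI _ (hcm _ continuous_const)).add (hI _ (hcm _ (by fun_prop)))),
      intervalIntegral.integral_add (hI _ (hcm _ continuous_const)) (hI _ (hcm _ (by fun_prop))),
      hfg, hcg, hdg]
    simp
  rw [intervalIntegral.integral_of_le hle,
    setIntegral_eq_zero_iff_of_nonneg_ae (Eventually.of_forall fun x => by positivity)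
      hg2'.integrableOn] at hgg
  have hae := (ae_restrict_iff' hIm).1 hgg
  filter_upwards [hae] with x hx hxI
  have h1 := hx hxI
  have h2 : g x = 0 := by simpa using h1
  rw [hgI x hxI] at h2
  exact sub_eq_zero.1 h2

/-- Regularity of minimizers: the second derivative of a minimizer is twice differentiable and
satisfies the Euler–Lagrange equation. (As `w` is given up to null sets only, `v` has the continuous
derivative `z₂ = w` almost everywhere.) -/
theorem Connects.exists_regular (hβ : 0 < β) (hW : IsDoubleWell W a b)
    (h : Connects a b u v w) (hmin : action β W u v w = infAction β W a b)
    (hfin : infAction β W a b ≠ ⊤) :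
    ∃ z₂ z₃ : ℝ → RVec m, (∀ x, HasDerivAt v (z₂ x) x) ∧ (∀ x, HasDerivAt z₂ (z₃ x) x) ∧
      (∀ x, HasDerivAt z₃ (β • z₂ x - gradient W (u x)) x) ∧ w =ᵐ[volume] z₂ := by
  have hu := h.path.continuous
  have hgrad : Continuous fun x => gradient W (u x) := by
    have hdW : Continuous (fderiv ℝ W) := hW.contDiff.continuous_fderiv (by simp)
    exact (InnerProductSpace.toDual ℝ (RVec m)).symm.continuous.comp (hdW.comp hu)
  have hprim : ∀ {f : ℝ → RVec m}, Continuous f → ∀ x,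
      HasDerivAt (fun x => ∫ t in (0 : ℝ)..x, f t) (f x) x := fun hf x =>
    intervalIntegral.integral_hasDerivAt_right (hf.intervalIntegrable _ _)
      hf.stronglyMeasurable.stronglyMeasurableAtFilter hf.continuousAt
  set G₁ : ℝ → RVec m := fun x => ∫ t in (0 : ℝ)..x, gradient W (u t)
  have hG₁ : ∀ x, HasDerivAt G₁ (gradient W (u x)) x := hprim hgrad
  have hG₁c : Continuous G₁ := continuous_iff_continuousAt.2 fun x => (hG₁ x).continuousAt
  set G : ℝ → RVec m := fun x => ∫ t in (0 : ℝ)..x, G₁ t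
  have hG : ∀ x, HasDerivAt G (G₁ x) x := hprim hG₁c
  have hGc : Continuous G := continuous_iff_continuousAt.2 fun x => (hG x).continuousAt
  have hufin : action β W u v w ≠ ⊤ := by rwa [hmin]
  have hw2 := h.path.integrable_norm_sq_snd hβ hW.continuous hW.nonneg hufin
  have hwm := h.path.aestronglyMeasurable
  -- on bounded intervals, `w` is the sum of `βu - G` and an affine function
  have haff : ∀ R : ℝ, 0 < R → ∃ c d : RVec m, ∀ᵐ x, x ∈ Ioc (-R) R →
      w x = β • u x - G x + (c + x • d) := by
    intro R hR
    have hc : Continuous fun x => -(β • u x) + G x := by fun_prop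
    have hmem : MemLp (fun x => w x - β • u x + G x) 2 (volume.restrict (Ioc (-R) R)) := by
      have h1 : MemLp w 2 (volume.restrict (Ioc (-R) R)) :=
        (memLp_two_iff_integrable_sq_norm hwm.restrict).2 hw2.integrableOn
      have h2 : MemLp (fun x => -(β • u x) + G x) 2 (volume.restrict (Ioc (-R) R)) :=
        (memL2loc_of_continuous hc (Icc (-R) R) isCompact_Icc).mono_measure
          (Measure.restrict_mono Ioc_subset_Icc_self le_rfl)
      refine (memLp_congr_ae (Eventually.of_forall fun x => ?_)).1 (h1.add h2)
      simp only [Pi.add_apply]; abel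
    obtain ⟨c, d, hcd⟩ := ae_eq_affine_of_orthogonal (f := fun x => w x - β • u x + G x) hR
      ((hwm.sub (by fun_prop)).add hGc.aestronglyMeasurable)
      ((memLp_two_iff_integrable_sq_norm hmem.aestronglyMeasurable).1 hmem)
      (fun g hg hg2 hg0 hm0 hm1 =>
        h.integral_inner_eq_zero hβ hW hmin hfin hG hG₁ hR hg hg2 hg0 hm0 hm1)
    refine ⟨c, d, hcd.mono fun x hx hxI => ?_⟩
    rw [← hx hxI]; abel
  choose! c d hcd using haff
  set q : ℝ → ℝ → RVec m := fun R x => β • u x - G x + (c R + x • d R)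
  have hq : ∀ R, Continuous (q R) := fun R => by fun_prop
  have hv : ∀ R, ∀ x ∈ Ioo (-R) R, HasDerivAt v (q R x) x := by
    intro R x hx
    have hR : 0 < R := by linarith [hx.1, hx.2]
    have h1 : HasDerivAt (fun y => v 0 + ∫ t in (0 : ℝ)..y, q R t) (q R x) x :=
      (hprim (hq R) x).const_add _
    refine h1.congr_of_eventuallyEq ?_
    filter_upwards [isOpen_Ioo.mem_nhds hx] with y hy
    rw [h.path.eq_add 0 y]
    congr 1
    refine intervalIntegral.integral_congr_ae ?_
    filter_upwards [hcd R hR] with t ht ht'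
    refine ht ?_
    have h0 : (0 : ℝ) ∈ Ioc (-R) R := ⟨by linarith, hR.le⟩
    have hy' : y ∈ Ioc (-R) R := ⟨hy.1, hy.2.le⟩
    exact ordConnected_Ioc.uIcc_subset h0 hy' (uIoc_subset_uIcc ht')
  have hmemR : ∀ x : ℝ, x ∈ Ioo (-(|x| + 1)) (|x| + 1) := fun x =>
    abs_lt.1 (lt_add_one |x|)
  have hd2 : ∀ R, ∀ x ∈ Ioo (-R) R, deriv v x = q R x := fun R x hx => (hv R x hx).deriv
  have hz2 : ∀ R, ∀ x ∈ Ioo (-R) R, HasDerivAt (deriv v) (β • v x - G₁ x + d R) x := by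
    intro R x hx
    have h1 : HasDerivAt (q R) (β • v x - G₁ x + d R) x := by
      have e1 : HasDerivAt (fun x : ℝ => c R + x • d R) (d R) x := by
        simpa using ((hasDerivAt_id x).smul_const (d R)).const_add (c R)
      exact (((h.path.hasDerivAt x).const_smul β).sub (hG x)).add e1
    refine h1.congr_of_eventuallyEq ?_
    filter_upwards [isOpen_Ioo.mem_nhds hx] with y hy using hd2 R y hy
  have hz3 : ∀ R, ∀ x ∈ Ioo (-R) R,
      HasDerivAt (deriv (deriv v)) (β • deriv v x - gradient W (u x)) x := by
    intro R x hx
    have h1 : HasDerivAt (fun x => β • v x - G₁ x + d R) (β • deriv v x - gradient W (u x)) x := by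
      rw [hd2 R x hx]
      exact (((hv R x hx).const_smul β).sub (hG₁ x)).add_const _
    refine h1.congr_of_eventuallyEq ?_
    filter_upwards [isOpen_Ioo.mem_nhds hx] with y hy using (hz2 R y hy).deriv
  refine ⟨deriv v, deriv (deriv v), fun x => (hv _ x (hmemR x)).differentiableAt.hasDerivAt,
    fun x => (hz2 _ x (hmemR x)).differentiableAt.hasDerivAt, fun x => hz3 _ x (hmemR x), ?_⟩
  have hall : ∀ᵐ x, ∀ n : ℕ, x ∈ Ioc (-((n : ℝ) + 1)) ((n : ℝ) + 1) → w x = q ((n : ℝ) + 1) x :=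
    ae_all_iff.2 fun n => hcd _ (by positivity)
  filter_upwards [hall] with x hx
  obtain ⟨n, hn⟩ := exists_nat_gt |x|
  have hx' : x ∈ Ioo (-((n : ℝ) + 1)) ((n : ℝ) + 1) := abs_lt.1 (hn.trans (lt_add_one _))
  rw [hx n (Ioo_subset_Ioc_self hx'), hd2 _ x hx']

end

/-! ### Minimizers are minimal heteroclinics -/

lemma norm_sub_le_of_hasDerivAt {f f' : ℝ → RVec m} {C x y : ℝ} (hxy : x ≤ y)
    (hf : ∀ t, HasDerivAt f (f' t) t) (hC : ∀ t ∈ Icc x y, ‖f' t‖ ≤ C) :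
    ‖f y - f x‖ ≤ C * (y - x) :=
  norm_image_sub_le_of_norm_deriv_le_segment' (fun t _ => (hf t).hasDerivWithinAt)
    (fun t ht => hC t (Ico_subset_Icc_self ht)) y (right_mem_Icc.2 hxy)

/-- If `v''' = βv' - n` with `v, n → 0` at `+∞`, then `v', v'' → 0`: on unit intervals `v` is, up
to a small error, the quadratic polynomial with coefficients `v'` and `v'' - βv`. -/
lemma tendsto_deriv_zero_atTop {β : ℝ} (hβ : 0 < β) {v z₂ z₃ n : ℝ → RVec m}
    (h₁ : ∀ x, HasDerivAt v (z₂ x) x) (h₂ : ∀ x, HasDerivAt z₂ (z₃ x) x)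
    (h₃ : ∀ x, HasDerivAt z₃ (β • z₂ x - n x) x) (hv : Tendsto v atTop (𝓝 0))
    (hn : Tendsto n atTop (𝓝 0)) : Tendsto z₂ atTop (𝓝 0) ∧ Tendsto z₃ atTop (𝓝 0) := by
  set y : ℝ → RVec m := fun x => z₃ x - β • v x
  have hy : ∀ x, HasDerivAt y (-n x) x := fun x => by
    convert! (h₃ x).sub ((h₁ x).const_smul β) using 1
    abel
  have hz₂ : ∀ x, z₃ x = y x + β • v x := fun x => by simp [y]
  -- the estimate on unit intervals
  have key : ∀ ε > 0, ∀ᶠ x in atTop, ‖y x‖ ≤ 12 * (3 + β) * ε ∧ ‖z₂ x‖ ≤ 7 * (3 + β) * ε := by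
    intro ε hε
    have ev1 := (tendsto_zero_iff_norm_tendsto_zero.1 hv).eventually (gt_mem_nhds hε)
    have ev2 := (tendsto_zero_iff_norm_tendsto_zero.1 hn).eventually (gt_mem_nhds hε)
    obtain ⟨T, hT⟩ := eventually_atTop.1 (ev1.and ev2)
    filter_upwards [eventually_ge_atTop T] with x hx
    have b1 : ∀ s ∈ Icc x (x + 1), ‖y s - y x‖ ≤ ε := fun s hs => by
      have := norm_sub_le_of_hasDerivAt hs.1 hy (C := ε) fun t ht => by
        rw [norm_neg]; exact (hT t (by linarith [ht.1])).2.le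
      nlinarith [hs.1, hs.2]
    have b2 : ∀ s ∈ Icc x (x + 1), ‖z₂ s - z₂ x - (s - x) • y x‖ ≤ (1 + β) * ε := by
      intro s hs
      have hd : ∀ t, HasDerivAt (fun t => z₂ t - (t - x) • y x) (z₃ t - y x) t := fun t => by
        simpa using! (h₂ t).sub (((hasDerivAt_id t).sub_const x).smul_const (y x))
      have := norm_sub_le_of_hasDerivAt hs.1 hd (C := (1 + β) * ε) fun t ht => by
        have e : z₃ t - y x = (y t - y x) + β • v t := by rw [hz₂]; abel
        rw [e, add_mul, one_mul]
        refine (norm_add_le _ _).trans (add_le_add (b1 t ⟨ht.1, ht.2.trans hs.2⟩) ?_)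
        rw [norm_smul, Real.norm_of_nonneg hβ.le]
        exact mul_le_mul_of_nonneg_left (hT t (by linarith [ht.1])).1.le hβ.le
      have e : z₂ s - (s - x) • y x - (z₂ x - (x - x) • y x) =
          z₂ s - z₂ x - (s - x) • y x := by
        rw [sub_self, zero_smul]; abel
      rw [e] at this
      have h0 : 0 ≤ (1 + β) * ε := by positivity
      nlinarith [hs.1, hs.2]
    have b3 : ∀ s ∈ Icc x (x + 1),
        ‖v s - v x - (s - x) • z₂ x - ((s - x) ^ 2 / 2) • y x‖ ≤ (1 + β) * ε := by
      intro s hs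
      have hd : ∀ t, HasDerivAt (fun t => v t - (t - x) • z₂ x - ((t - x) ^ 2 / 2) • y x)
          (z₂ t - z₂ x - (t - x) • y x) t := fun t => by
        have e1 := ((hasDerivAt_id t).sub_const x).smul_const (z₂ x)
        have e2 := ((((hasDerivAt_id t).sub_const x).pow 2).div_const 2).smul_const (y x)
        convert! ((h₁ t).sub e1).sub e2 using 1
        simp
      have := norm_sub_le_of_hasDerivAt hs.1 hd (C := (1 + β) * ε) fun t ht =>
        b2 t ⟨ht.1, ht.2.trans hs.2⟩
      have e : v s - (s - x) • z₂ x - ((s - x) ^ 2 / 2) • y x -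
          (v x - (x - x) • z₂ x - ((x - x) ^ 2 / 2) • y x) =
          v s - v x - (s - x) • z₂ x - ((s - x) ^ 2 / 2) • y x := by
        simp; abel
      rw [e] at this
      have h0 : 0 ≤ (1 + β) * ε := by positivity
      nlinarith [hs.1, hs.2]
    have b4 : ∀ s ∈ Icc x (x + 1),
        ‖(s - x) • z₂ x + ((s - x) ^ 2 / 2) • y x‖ ≤ (3 + β) * ε := by
      intro s hs
      have e : (s - x) • z₂ x + ((s - x) ^ 2 / 2) • y x = v s - v x -
          (v s - v x - (s - x) • z₂ x - ((s - x) ^ 2 / 2) • y x) := by abel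
      rw [e]
      have := b3 s hs
      have t1 := norm_sub_le (v s - v x)
        (v s - v x - (s - x) • z₂ x - ((s - x) ^ 2 / 2) • y x)
      have t2 := norm_sub_le (v s) (v x)
      linarith [(hT s (by linarith [hs.1])).1, (hT x hx).1]
    have c1 := b4 (x + 1) ⟨by linarith, le_rfl⟩
    have c2 := b4 (x + 1 / 2) ⟨by linarith, by linarith⟩
    simp only [add_sub_cancel_left] at c1 c2
    have ey : (1 / 4 : ℝ) • y x = ((1 : ℝ) • z₂ x + ((1 : ℝ) ^ 2 / 2) • y x) -
        (2 : ℝ) • ((1 / 2 : ℝ) • z₂ x + ((1 / 2 : ℝ) ^ 2 / 2) • y x) := by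
      module
    have ny : ‖y x‖ ≤ 12 * (3 + β) * ε := by
      have h1 := norm_sub_le ((1 : ℝ) • z₂ x + ((1 : ℝ) ^ 2 / 2) • y x)
        ((2 : ℝ) • ((1 / 2 : ℝ) • z₂ x + ((1 / 2 : ℝ) ^ 2 / 2) • y x))
      rw [← ey, norm_smul, norm_smul, Real.norm_of_nonneg (by norm_num),
        Real.norm_of_nonneg (by norm_num)] at h1
      linarith
    refine ⟨ny, ?_⟩
    have ez : z₂ x = ((1 : ℝ) • z₂ x + ((1 : ℝ) ^ 2 / 2) • y x) - (1 / 2 : ℝ) • y x := by module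
    have h1 := norm_sub_le ((1 : ℝ) • z₂ x + ((1 : ℝ) ^ 2 / 2) • y x) ((1 / 2 : ℝ) • y x)
    rw [← ez, norm_smul, Real.norm_of_nonneg (by norm_num)] at h1
    linarith
  have hsmall : ∀ (f : ℝ → RVec m) (C : ℝ), 0 < C → (∀ ε > 0, ∀ᶠ x in atTop, ‖f x‖ ≤ C * ε) →
      Tendsto f atTop (𝓝 0) := by
    intro f C hC hf
    rw [tendsto_zero_iff_norm_tendsto_zero]
    refine Metric.tendsto_nhds.2 fun ε hε => ?_
    filter_upwards [hf (ε / (2 * C)) (by positivity)] with x hx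
    have : C * (ε / (2 * C)) = ε / 2 := by field_simp
    rw [this] at hx
    simpa using lt_of_le_of_lt hx (half_lt_self hε)
  have hy0 := hsmall y (12 * (3 + β)) (by positivity) fun ε hε => (key ε hε).mono fun x hx => hx.1
  have hz0 := hsmall z₂ (7 * (3 + β)) (by positivity) fun ε hε => (key ε hε).mono fun x hx => hx.2
  refine ⟨hz0, ?_⟩
  have := hy0.add (hv.const_smul β)
  simpa [y] using this

section

variable {β : ℝ} {W : RVec m → ℝ} {a b : RVec m} {u v w : ℝ → RVec m}

lemma IsDoubleWell.tendsto_gradient (hW : IsDoubleWell W a b) {l : Filter ℝ}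
    (hu : Tendsto u l (𝓝 b)) : Tendsto (fun x => gradient W (u x)) l (𝓝 0) := by
  have hdW : Continuous (fderiv ℝ W) := hW.contDiff.continuous_fderiv (by simp)
  have hc : Continuous (gradient W) :=
    (InnerProductSpace.toDual ℝ (RVec m)).symm.continuous.comp hdW
  have h0 : gradient W b = 0 := by
    have hmin : IsLocalMin W b := by
      refine Eventually.of_forall fun x => ?_
      rw [hW.right_eq_zero]; exact hW.nonneg x
    simp [gradient, hmin.fderiv_eq_zero]
  rw [← h0]
  exact (hc.tendsto b).comp hu

/-- A path that minimizes the action is a minimal heteroclinic. -/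
theorem Connects.mem_minimalHeteroclinics (hβ : 0 < β) (hW : IsDoubleWell W a b)
    (h : Connects a b u v w) (hmin : action β W u v w = infAction β W a b)
    (hfin : infAction β W a b ≠ ⊤) : u ∈ minimalHeteroclinics β W a b := by
  obtain ⟨z₂, z₃, h₂, h₃, h₄, hw⟩ := h.exists_regular hβ hW hmin hfin
  have h₁ := h.path.hasDerivAt
  have hufin : action β W u v w ≠ ⊤ := by rwa [hmin]
  have hu := h.path.continuous
  have hz₂ : Continuous z₂ := continuous_iff_continuousAt.2 fun x => (h₃ x).continuousAt
  have hz₃ : Continuous z₃ := continuous_iff_continuousAt.2 fun x => (h₄ x).continuousAt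
  have hgrad : Continuous fun x => gradient W (u x) := by
    have hdW : Continuous (fderiv ℝ W) := hW.contDiff.continuous_fderiv (by simp)
    exact (InnerProductSpace.toDual ℝ (RVec m)).symm.continuous.comp (hdW.comp hu)
  have d1 : iteratedDeriv 1 u = v := by
    rw [iteratedDeriv_one]; exact funext fun x => (h₁ x).deriv
  have d2 : iteratedDeriv 2 u = z₂ := by
    rw [iteratedDeriv_succ, d1]; exact funext fun x => (h₂ x).deriv
  have d3 : iteratedDeriv 3 u = z₃ := by
    rw [iteratedDeriv_succ, d2]; exact funext fun x => (h₃ x).deriv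
  have d4 : iteratedDeriv 4 u = fun x => β • z₂ x - gradient W (u x) := by
    rw [iteratedDeriv_succ, d3]; exact funext fun x => (h₄ x).deriv
  have hdu : deriv u = v := funext fun x => (h₁ x).deriv
  have hv2 := h.path.integrable_norm_sq_fst hβ hW.continuous hW.nonneg hufin
  have hw2 := h.path.integrable_norm_sq_snd hβ hW.continuous hW.nonneg hufin
  have hz2 : Integrable fun x => ‖z₂ x‖ ^ 2 := hw2.congr (hw.mono fun x hx => by simp only [hx])
  have hvtop : Tendsto v atTop (𝓝 0) := tendsto_zero_of_integrableOn_norm_sq (T := 0) h₂ hz₂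
    hv2.integrableOn hz2.integrableOn
  -- the reflected path
  have r₁ : ∀ x, HasDerivAt (fun x => -v (-x)) (z₂ (-x)) x := fun x => by
    simpa [Function.comp_def] using! ((h₂ (-x)).scomp x (hasDerivAt_neg x)).neg
  have r₂ : ∀ x, HasDerivAt (fun x => z₂ (-x)) (-z₃ (-x)) x := fun x => by
    simpa [Function.comp_def] using! (h₃ (-x)).scomp x (hasDerivAt_neg x)
  have r₃ : ∀ x, HasDerivAt (fun x => -z₃ (-x)) (β • z₂ (-x) - gradient W (u (-x))) x :=
    fun x => by simpa [Function.comp_def] using! ((h₄ (-x)).scomp x (hasDerivAt_neg x)).neg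
  have hvbot : Tendsto (fun x => -v (-x)) atTop (𝓝 0) :=
    tendsto_zero_of_integrableOn_norm_sq (T := 0) r₁ (by fun_prop)
      (by simpa using hv2.comp_neg.integrableOn) (hz2.comp_neg.integrableOn)
  obtain ⟨t₂, t₃⟩ := tendsto_deriv_zero_atTop hβ h₂ h₃ h₄ hvtop
    (hW.tendsto_gradient h.tendsto_atTop)
  obtain ⟨s₂, s₃⟩ := tendsto_deriv_zero_atTop hβ r₁ r₂ r₃ hvbot
    (hW.symm.tendsto_gradient (h.tendsto_atBot.comp tendsto_neg_atTop_atBot))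
  have hback : ∀ f : ℝ → RVec m, Tendsto (fun x => f (-x)) atTop (𝓝 0) →
      Tendsto f atBot (𝓝 0) := fun f hf => by
    simpa [Function.comp_def] using hf.comp tendsto_neg_atBot_atTop
  have hcd : ContDiff ℝ 4 u := by
    have : ContDiff ℝ ((4 : ℕ) : WithTop ℕ∞) u := by
      rw [contDiff_nat_iff_iteratedDeriv]
      refine ⟨fun k hk => ?_, fun k hk => ?_⟩
      · interval_cases k
        · simpa using hu
        · rw [d1]; exact h.path.continuous_deriv
        · rwa [d2]
        · rwa [d3]
        · rw [d4]; fun_prop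
      · interval_cases k
        · rw [iteratedDeriv_zero]; exact fun x => (h₁ x).differentiableAt
        · rw [d1]; exact fun x => (h₂ x).differentiableAt
        · rw [d2]; exact fun x => (h₃ x).differentiableAt
        · rw [d3]; exact fun x => (h₄ x).differentiableAt
    exact_mod_cast this
  refine ⟨⟨hcd, fun x => ?_, h.tendsto_atBot, h.tendsto_atTop, fun k hk1 hk3 => ?_,
    fun k hk1 hk3 => ?_⟩, ⟨?_, h.tendsto_atBot, h.tendsto_atTop⟩, fun p p₁ p₂ hadm => ?_⟩
  · rw [d4, d2]; simp
  · interval_cases k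
    · rw [d1]
      refine hback _ ?_
      simpa using hvbot.neg
    · rw [d2]; exact hback _ s₂
    · rw [d3]
      refine hback _ ?_
      simpa using s₃.neg
  · interval_cases k
    · rwa [d1]
    · rwa [d2]
    · rwa [d3]
  · rw [hdu, d2]
    exact .of_hasDerivAt h₁ h₂ hz₂
  · rw [hdu, d2]
    obtain ⟨q, hq, hpath⟩ := hadm.isH2loc.exists_isH2Path
    have e1 : action β W p p₁ p₂ = action β W p q p₂ :=
      lintegral_congr_ae (hq.mono fun x hx => by simp only [hx])
    have e2 : action β W u v z₂ = action β W u v w :=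
      lintegral_congr_ae (hw.mono fun x hx => by simp only [hx])
    rw [e1, e2, hmin]
    exact (Connects.mk hpath hadm.tendsto_atBot hadm.tendsto_atTop).infAction_le

/-- A minimal heteroclinic is a path that minimizes the action. -/
lemma connects_of_mem_minimalHeteroclinics {e : ℝ → RVec m}
    (he : e ∈ minimalHeteroclinics β W a b) :
    Connects a b e (deriv e) (iteratedDeriv 2 e) := by
  have hc : ContDiff ℝ 4 e := he.1.contDiff
  refine ⟨.of_hasDerivAt (fun x => (hc.differentiable (by simp) x).hasDerivAt) (fun x => ?_) ?_,
    he.1.tendsto_atBot, he.1.tendsto_atTop⟩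
  · have h1 : Differentiable ℝ (iteratedDeriv 1 e) :=
      hc.differentiable_iteratedDeriv 1 (by norm_num)
    have := (h1 x).hasDerivAt
    rwa [← iteratedDeriv_succ, iteratedDeriv_one] at this
  · exact hc.continuous_iteratedDeriv 2 (by norm_num)

lemma action_eq_infAction_of_mem (hβ : 0 < β) (hW : IsDoubleWell W a b)
    (hfin : infAction β W a b ≠ ⊤) {e : ℝ → RVec m} (he : e ∈ minimalHeteroclinics β W a b) :
    action β W e (deriv e) (iteratedDeriv 2 e) = infAction β W a b := by
  obtain ⟨u, v, w, h, hmin⟩ := hW.exists_minimizer hβ hfin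
  refine le_antisymm ?_ (connects_of_mem_minimalHeteroclinics he).infAction_le
  -- a minimizing path is an admissible competitor once `w` is replaced by its continuous version
  obtain ⟨z₂, z₃, h₂, h₃, -, hw⟩ := h.exists_regular hβ hW hmin hfin
  have hz₂ : Continuous z₂ := continuous_iff_continuousAt.2 fun x => (h₃ x).continuousAt
  have e2 : action β W u v z₂ = action β W u v w :=
    lintegral_congr_ae (hw.mono fun x hx => by simp only [hx])
  rw [← hmin, ← e2]
  exact he.2.2 u v z₂ ⟨.of_hasDerivAt h.path.hasDerivAt h₂ hz₂, h.tendsto_atBot, h.tendsto_atTop⟩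

end

/-! ### The perturbed Ginzburg–Landau potential -/

section

variable {ε : ℝ} {φ : ℝ → ℝ}

lemma norm_sq_eq_coords (u : RVec 2) : ‖u‖ ^ 2 = u 0 ^ 2 + u 1 ^ 2 := by
  simp [EuclideanSpace.norm_sq_eq, Fin.sum_univ_two]

lemma inner_eq_coords (u ν : RVec 2) : inner ℝ u ν = u 0 * ν 0 + u 1 * ν 1 := by
  simp [PiLp.inner_apply, Fin.sum_univ_two, mul_comm]

lemma IsCutoff.contDiff_glPotential (hφ : IsCutoff ε φ) : ContDiff ℝ 2 (glPotential φ) := by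
  have h1 : ContDiff ℝ 2 fun u : RVec 2 => ‖u‖ ^ 2 := contDiff_norm_sq ℝ
  have h2 : ContDiff ℝ 2 fun u : RVec 2 => u 1 := (coordL (m := 2) 1).contDiff
  have h3 : ContDiff ℝ 2 φ := contDiff_infty.1 hφ.contDiff 2
  exact (((h1.sub contDiff_const).pow 2).div_const 4).add ((h2.pow 2).mul (h3.comp h1))

lemma IsCutoff.glPotential_nonneg (hφ : IsCutoff ε φ) (u : RVec 2) : 0 ≤ glPotential φ u := by
  have := hφ.nonneg (‖u‖ ^ 2)
  unfold glPotential
  positivity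

lemma IsCutoff.le_glPotential (hφ : IsCutoff ε φ) (u : RVec 2) :
    (‖u‖ ^ 2 - 1) ^ 2 / 4 ≤ glPotential φ u := by
  have := hφ.nonneg (‖u‖ ^ 2)
  unfold glPotential
  have : 0 ≤ u 1 ^ 2 * φ (‖u‖ ^ 2) := by positivity
  linarith

/-- On the axis through the wells the potential does not depend on the cutoff. -/
lemma glPotential_axis (φ : ℝ → ℝ) (p : ℝ) : glPotential φ !₂[p, 0] = (p ^ 2 - 1) ^ 2 / 4 := by
  simp [glPotential, norm_sq_eq_coords]

lemma glPotential_eq_of_le (hφ : IsCutoff ε φ) {u : RVec 2} (hu : √(1 - ε / 2) ≤ ‖u‖ ^ 2) :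
    glPotential φ u = (‖u‖ ^ 2 - 1) ^ 2 / 4 + u 1 ^ 2 := by
  simp [glPotential, hφ.eq_one _ hu]

lemma hasDerivAt_line (u ν : RVec 2) (t : ℝ) : HasDerivAt (fun t : ℝ => u + t • ν) ν t := by
  simpa using ((hasDerivAt_id t).smul_const ν).const_add u

lemma hasDerivAt_comp_line {W : RVec 2 → ℝ} (hW : ContDiff ℝ 2 W) (u ν : RVec 2) :
    HasDerivAt (fun t : ℝ => W (u + t • ν)) (fderiv ℝ W u ν) 0 := by
  have hd : HasFDerivAt W (fderiv ℝ W u) (u + (0 : ℝ) • ν) := by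
    rw [zero_smul, add_zero]
    exact (hW.differentiable (by simp) u).hasFDerivAt
  exact hd.comp_hasDerivAt (0 : ℝ) (hasDerivAt_line u ν 0)

lemma hasDerivAt_fderiv_comp_line {W : RVec 2 → ℝ} (hW : ContDiff ℝ 2 W) (u ν : RVec 2) :
    HasDerivAt (fun t : ℝ => fderiv ℝ W (u + t • ν) ν) (fderiv ℝ (fderiv ℝ W) u ν ν) 0 := by
  have hd : HasFDerivAt (fderiv ℝ W) (fderiv ℝ (fderiv ℝ W) u) (u + (0 : ℝ) • ν) := by
    rw [zero_smul, add_zero]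
    exact ((hW.fderiv_right (m := 1) (by norm_num)).differentiable (by simp) u).hasFDerivAt
  have := hd.comp_hasDerivAt (0 : ℝ) (hasDerivAt_line u ν 0)
  simpa using! this.clm_apply (hasDerivAt_const (0 : ℝ) ν)

lemma fderiv_glPotential (hφ : IsCutoff ε φ) {u : RVec 2} (hu : √(1 - ε / 2) < ‖u‖ ^ 2)
    (ν : RVec 2) :
    fderiv ℝ (glPotential φ) u ν = (‖u‖ ^ 2 - 1) * inner ℝ u ν + 2 * u 1 * ν 1 := by
  have h1 := hasDerivAt_comp_line hφ.contDiff_glPotential u ν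
  have h2 : HasDerivAt (fun t : ℝ => (‖u + t • ν‖ ^ 2 - 1) ^ 2 / 4 + (u 1 + t * ν 1) ^ 2)
      ((‖u‖ ^ 2 - 1) * inner ℝ u ν + 2 * u 1 * ν 1) 0 := by
    have e1 := ((((hasDerivAt_line u ν 0).norm_sq.sub_const 1).pow 2).div_const 4)
    have e2 := (((hasDerivAt_id (0 : ℝ)).mul_const (ν 1)).const_add (u 1)).pow 2
    convert! e1.add e2 using 1
    simp; ring
  refine h1.unique (h2.congr_of_eventuallyEq ?_)
  have hc : Continuous fun t : ℝ => ‖u + t • ν‖ ^ 2 := by fun_prop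
  filter_upwards [hc.continuousAt.eventually (lt_mem_nhds (by simpa using hu))] with t ht
  rw [glPotential_eq_of_le hφ (le_of_lt ht)]
  simp

lemma hessian_glPotential (hφ : IsCutoff ε φ) {u : RVec 2} (hu : √(1 - ε / 2) < ‖u‖ ^ 2)
    (ν : RVec 2) : iteratedFDeriv ℝ 2 (glPotential φ) u ![ν, ν] =
      (‖u‖ ^ 2 - 1) * ‖ν‖ ^ 2 + 2 * inner ℝ u ν ^ 2 + 2 * ν 1 ^ 2 := by
  rw [iteratedFDeriv_two_apply]
  simp only [Matrix.cons_val_zero, Matrix.cons_val_one]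
  have h1 := hasDerivAt_fderiv_comp_line hφ.contDiff_glPotential u ν
  have h2 : HasDerivAt (fun t : ℝ => (‖u + t • ν‖ ^ 2 - 1) * inner ℝ (u + t • ν) ν +
      2 * (u 1 + t * ν 1) * ν 1)
      ((‖u‖ ^ 2 - 1) * ‖ν‖ ^ 2 + 2 * inner ℝ u ν ^ 2 + 2 * ν 1 ^ 2) 0 := by
    have e1 := ((hasDerivAt_line u ν 0).norm_sq.sub_const 1).mul
      ((hasDerivAt_line u ν 0).inner ℝ (hasDerivAt_const 0 ν))
    have e2 := ((((hasDerivAt_id (0 : ℝ)).mul_const (ν 1)).const_add (u 1)).const_mul 2).mul_const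
      (ν 1)
    convert! e1.add e2 using 1
    simp
    ring
  refine h1.unique (h2.congr_of_eventuallyEq ?_)
  have hc : Continuous fun t : ℝ => ‖u + t • ν‖ ^ 2 := by fun_prop
  filter_upwards [hc.continuousAt.eventually (lt_mem_nhds (by simpa using hu))] with t ht
  rw [fderiv_glPotential hφ ht]
  simp

lemma sqrt_one_sub_lt_one {t : ℝ} (ht : 0 < t) : √(1 - t) < 1 := by
  rw [Real.sqrt_lt' one_pos]; linarith

/-- The Hessian is bounded below near a point `(σ, 0)`, `σ = ±1`. -/
lemma le_hessian_glPotential (hφ : IsCutoff ε φ) {r σ : ℝ} (hr0 : 0 ≤ r) (hr : r ≤ 1 / 8)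
    (hrε : √(1 - ε / 2) < (1 - r) ^ 2) (hσ : σ ^ 2 = 1) {u ν : RVec 2}
    (hu : ‖u - !₂[σ, 0]‖ ≤ r) (hν : ‖ν‖ = 1) :
    1 / 2 ≤ iteratedFDeriv ℝ 2 (glPotential φ) u ![ν, ν] := by
  set a : RVec 2 := !₂[σ, 0]
  have ha : ‖a‖ = 1 := by
    have : ‖a‖ ^ 2 = 1 := by simp [a, norm_sq_eq_coords, hσ]
    exact (pow_eq_one_iff_of_nonneg (norm_nonneg a) two_ne_zero).1 this
  have hun : 1 - r ≤ ‖u‖ := by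
    have := norm_sub_norm_le a u
    rw [norm_sub_rev, ha] at this
    linarith
  have hun2 : (1 - r) ^ 2 ≤ ‖u‖ ^ 2 := pow_le_pow_left₀ (by linarith) hun 2
  rw [hessian_glPotential hφ (hrε.trans_le hun2), hν]
  have hin : inner ℝ u ν = σ * ν 0 + inner ℝ (u - a) ν := by
    rw [inner_sub_left, inner_eq_coords a ν]
    simp [a]
  have hsm : |inner ℝ (u - a) ν| ≤ r := by
    have := abs_real_inner_le_norm (u - a) ν
    rw [hν, mul_one] at this
    exact this.trans hu
  have hν2 : ν 0 ^ 2 + ν 1 ^ 2 = 1 := by rw [← norm_sq_eq_coords, hν]; norm_num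
  set y := inner ℝ (u - a) ν
  have hy2 : y ^ 2 ≤ r ^ 2 := sq_le_sq' (abs_le.1 hsm).1 (abs_le.1 hsm).2
  rw [hin]
  have e1 : (σ * ν 0) ^ 2 = ν 0 ^ 2 := by rw [mul_pow, hσ, one_mul]
  have e2 : (σ * ν 0) ^ 2 / 2 - y ^ 2 ≤ (σ * ν 0 + y) ^ 2 := by
    nlinarith [sq_nonneg (σ * ν 0 + 2 * y)]
  nlinarith [sq_nonneg (ν 0), sq_nonneg (ν 1)]

lemma norm_wellMinus : ‖wellMinus‖ = 1 := by
  have : ‖wellMinus‖ ^ 2 = 1 := by simp [wellMinus, norm_sq_eq_coords]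
  exact (pow_eq_one_iff_of_nonneg (norm_nonneg _) two_ne_zero).1 this

lemma wellMinus_ne_wellPlus : wellMinus ≠ wellPlus := fun h => by
  have := congrArg (fun u : RVec 2 => u 0) h
  simp [wellMinus, wellPlus] at this
  norm_num at this

theorem isDoubleWell_glPotential (hε : 0 < ε) (hφ : IsCutoff ε φ) :
    IsDoubleWell (glPotential φ) wellMinus wellPlus where
  contDiff := hφ.contDiff_glPotential
  nonneg := hφ.glPotential_nonneg
  ne := wellMinus_ne_wellPlus
  zero_iff u := by
    constructor
    · intro h
      have h1 := hφ.le_glPotential u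
      have h2 : ‖u‖ ^ 2 = 1 := by nlinarith [sq_nonneg (‖u‖ ^ 2 - 1)]
      rw [glPotential_eq_of_le hφ (by rw [h2]; exact (sqrt_one_sub_lt_one (by linarith)).le), h2]
        at h
      have h3 : u 1 = 0 := by
        have : u 1 ^ 2 = 0 := by linarith
        simpa using this
      rw [norm_sq_eq_coords, h3] at h2
      have h4 : u 0 = 1 ∨ u 0 = -1 := by
        exact sq_eq_sq_iff_eq_or_eq_neg.1 (by linarith)
      rcases h4 with h4 | h4
      · right; ext i; fin_cases i <;> simp [wellPlus, h3, h4]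
      · left; ext i; fin_cases i <;> simp [wellMinus, h3, h4]
    · rintro (rfl | rfl)
      · simp [wellMinus, glPotential_axis]
      · simp [wellPlus, glPotential_axis]
  hessian := by
    have hlt : √(1 - ε / 2) < 1 := sqrt_one_sub_lt_one (by linarith)
    have h0 := Real.sqrt_nonneg (1 - ε / 2)
    set d := 1 - √(1 - ε / 2)
    have hd : 0 < d := by simp only [d]; linarith
    refine ⟨min (1 / 8) (d / 4), by positivity, 1 / 2, by norm_num, fun u hu ν hν => ?_⟩
    have hr : min (1 / 8) (d / 4) ≤ d / 4 := min_le_right _ _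
    have hr8 : min (1 / 8) (d / 4) ≤ 1 / 8 := min_le_left _ _
    have hrpos : 0 < min (1 / 8) (d / 4) := by positivity
    have hrε : √(1 - ε / 2) < (1 - min (1 / 8) (d / 4)) ^ 2 := by
      have : √(1 - ε / 2) = 1 - d := by simp only [d]; ring
      rw [this]; nlinarith
    rcases hu with hu | hu
    · exact le_hessian_glPotential hφ hrpos.le hr8 hrε (by norm_num : (-1 : ℝ) ^ 2 = 1) hu hν
    · exact le_hessian_glPotential hφ hrpos.le hr8 hrε (by norm_num : (1 : ℝ) ^ 2 = 1) hu hν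
  liminf_pos := by
    refine lt_of_lt_of_le zero_lt_one (le_liminf_of_le (by isBoundedDefault) ?_)
    filter_upwards [eventually_cobounded_le_norm (2 : ℝ)] with u hu
    have h1 := hφ.le_glPotential u
    have h2 : (4 : ℝ) ≤ ‖u‖ ^ 2 := by nlinarith
    exact_mod_cast (by nlinarith : (1 : ℝ) ≤ glPotential φ u)

end

/-! ### Energy bounds -/

section

variable {β ε : ℝ} {φ : ℝ → ℝ} {u v w : ℝ → RVec 2}

/-- A lower bound for the cost of entering the disc of radius `1 / 2`, which does not depend on the
cutoff: a path has to cross an annulus of width `1 / 4`, where the potential is at least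
`(1 - (3 / 4)²)² / 4 = 49 / 1024`. -/
def originCost (β : ℝ) : ℝ := √(2 * β * (49 / 1024)) * (1 / 4)

lemma originCost_pos (hβ : 0 < β) : 0 < originCost β := by unfold originCost; positivity

/-- Connections of small action stay outside the disc of radius `1 / 2`. -/
lemma Connects.half_le_norm (hβ : 0 < β) (hφ : IsCutoff ε φ)
    (h : Connects wellMinus wellPlus u v w)
    (hact : action β (glPotential φ) u v w < ENNReal.ofReal (originCost β)) (x : ℝ) :
    1 / 2 ≤ ‖u x‖ := by
  by_contra! hn
  have hlim : Tendsto (fun y => ‖u y‖) atBot (𝓝 1) := by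
    simpa [norm_wellMinus] using h.tendsto_atBot.norm
  obtain ⟨y, hy, hyx⟩ := ((hlim.eventually (lt_mem_nhds (by norm_num : (3 / 4 : ℝ) < 1))).and
    (eventually_le_atBot x)).exists
  obtain ⟨s, t, -, hst, -, hs, ht, hz⟩ := exists_crossing (f := fun z => -‖u z‖)
    (p := -(3 / 4)) (q := -(1 / 2)) h.path.continuous.norm.neg hyx (by norm_num)
    (by linarith) (by linarith)
  have hcost := h.path.crossing_cost_le (β := β) (c := 49 / 1024) (W := glPotential φ) hβ
    (by norm_num) hst (fun z hzm => by
      have h1 := (hz z hzm).1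
      have h2 := hφ.le_glPotential (u z)
      have h3 : ‖u z‖ ^ 2 ≤ 9 / 16 := by nlinarith [norm_nonneg (u z)]
      nlinarith)
  refine absurd (lt_of_le_of_lt (hcost.trans (setLIntegral_energyDensity_le ..)) hact)
    (not_lt.2 (ENNReal.ofReal_le_ofReal ?_))
  unfold originCost
  gcongr
  have := norm_sub_norm_le (u s) (u t)
  rw [norm_sub_rev] at this
  linarith

/-- Half a turn at constant radius `ρ`, in time `1 / ε`. On the circle the cutoff vanishes and the
potential is `O(ε²)`; so are the squares of the speed and of the acceleration, and the total cost is
`O(ε)`. -/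
lemma exists_half_turn (hβ : 0 < β) (hε : 0 < ε) (hε1 : ε < 1) (hφ : IsCutoff ε φ) {ρ : ℝ}
    (hρ0 : 0 ≤ ρ) (hρ : ρ ^ 2 = √(1 - ε)) :
    ∃ p q r, IsH2Path p q r ∧ p 0 = !₂[-ρ, 0] ∧ q 0 = 0 ∧ p ε⁻¹ = !₂[ρ, 0] ∧ q ε⁻¹ = 0 ∧
      ∫⁻ x in Ioc 0 ε⁻¹, energyDensity β (glPotential φ) p q r x ≤
        ENNReal.ofReal ((4609 + 32 * β) * ε) := by
  set k := Real.pi * ε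
  have hk0 : 0 < k := by positivity
  have hk4 : k ≤ 4 * ε := by
    simp only [k]; gcongr; exact Real.pi_le_four
  have hs1 : √(1 - ε) < 1 := sqrt_one_sub_lt_one hε
  have hsε : 1 - ε ≤ √(1 - ε) := by
    refine Real.le_sqrt_of_sq_le ?_
    nlinarith
  have hρ1 : ρ ≤ 1 := by nlinarith
  set θ : ℝ → ℝ := fun x => Real.pi / 2 * (1 + Real.cos (k * x))
  set θ' : ℝ → ℝ := fun x => -(Real.pi / 2 * k) * Real.sin (k * x)
  set θ'' : ℝ → ℝ := fun x => -(Real.pi / 2 * k ^ 2) * Real.cos (k * x)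
  have hθ : ∀ x, HasDerivAt θ (θ' x) x := fun x => by
    have e := (((Real.hasDerivAt_cos (k * x)).comp x
      ((hasDerivAt_id x).const_mul k)).const_add 1).const_mul (Real.pi / 2)
    convert! e using 1
    simp only [θ']; ring
  have hθ' : ∀ x, HasDerivAt θ' (θ'' x) x := fun x => by
    have e := ((Real.hasDerivAt_sin (k * x)).comp x
      ((hasDerivAt_id x).const_mul k)).const_mul (-(Real.pi / 2 * k))
    convert! e using 1
    simp only [θ'']; ring
  set c : ℝ → RVec 2 := fun t => !₂[Real.cos t, Real.sin t]
  set n : ℝ → RVec 2 := fun t => !₂[-Real.sin t, Real.cos t]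
  have hto : ∀ {f g f' g' : ℝ → ℝ}, (∀ x, HasDerivAt f (f' x) x) → (∀ x, HasDerivAt g (g' x) x) →
      ∀ x, HasDerivAt (fun x => (!₂[f x, g x] : RVec 2)) !₂[f' x, g' x] x := by
    intro f g f' g' hf hg x
    have h1 : HasDerivAt (fun x => ![f x, g x]) ![f' x, g' x] x := by
      rw [hasDerivAt_pi]
      intro i
      fin_cases i
      · exact hf x
      · exact hg x
    exact (PiLp.continuousLinearEquiv 2 ℝ (fun _ : Fin 2 => ℝ)).symm.hasFDerivAt.comp_hasDerivAt
      x h1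
  have hc : ∀ t, HasDerivAt c (n t) t := hto Real.hasDerivAt_cos Real.hasDerivAt_sin
  have hn : ∀ t, HasDerivAt n (-c t) t := fun t => by
    have : -c t = !₂[-Real.cos t, -Real.sin t] := by ext i; fin_cases i <;> simp [c]
    rw [this]
    exact hto (fun t => (Real.hasDerivAt_sin t).neg) Real.hasDerivAt_cos t
  have hcn : ∀ t, ‖c t‖ = 1 := fun t => by
    have : ‖c t‖ ^ 2 = 1 := by simp [c, norm_sq_eq_coords]
    exact (pow_eq_one_iff_of_nonneg (norm_nonneg _) two_ne_zero).1 this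
  have hnn : ∀ t, ‖n t‖ = 1 := fun t => by
    have : ‖n t‖ ^ 2 = 1 := by simp [n, norm_sq_eq_coords]
    exact (pow_eq_one_iff_of_nonneg (norm_nonneg _) two_ne_zero).1 this
  have hcc : Continuous c := continuous_iff_continuousAt.2 fun t => (hc t).continuousAt
  have hnc : Continuous n := continuous_iff_continuousAt.2 fun t => (hn t).continuousAt
  set P : ℝ → RVec 2 := fun x => ρ • c (θ x)
  set Q : ℝ → RVec 2 := fun x => ρ • (θ' x • n (θ x))
  set S : ℝ → RVec 2 := fun x => ρ • (θ' x • (θ' x • -c (θ x)) + θ'' x • n (θ x))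
  have hP : ∀ x, HasDerivAt P (Q x) x := fun x => ((hc (θ x)).scomp x (hθ x)).const_smul ρ
  have hQ : ∀ x, HasDerivAt Q (S x) x := fun x =>
    ((hθ' x).smul ((hn (θ x)).scomp x (hθ x))).const_smul ρ
  have hθc : Continuous θ := by fun_prop
  have hθ'c : Continuous θ' := by fun_prop
  have hθ''c : Continuous θ'' := by fun_prop
  have hkε : k * ε⁻¹ = Real.pi := by simp only [k]; field_simp
  refine ⟨P, Q, S, .of_hasDerivAt hP hQ (by fun_prop), ?_, ?_, ?_, ?_, ?_⟩
  · have : θ 0 = Real.pi := by simp [θ]; ring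
    ext i; fin_cases i <;> simp [P, c, this]
  · simp [Q, θ']
  · have : θ ε⁻¹ = 0 := by simp [θ, hkε]
    ext i; fin_cases i <;> simp [P, c, this]
  · simp [Q, θ', hkε]
  · have hpi : Real.pi / 2 ≤ 2 := by linarith [Real.pi_le_four]
    have hb1 : ∀ x, |θ' x| ≤ 8 * ε := fun x => by
      simp only [θ', abs_mul, abs_neg]
      rw [abs_of_pos (by positivity : 0 < Real.pi / 2), abs_of_pos hk0]
      calc Real.pi / 2 * k * |Real.sin (k * x)| ≤ 2 * (4 * ε) * 1 := by
            gcongr; exact Real.abs_sin_le_one _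
        _ = 8 * ε := by ring
    have hb2 : ∀ x, |θ'' x| ≤ 32 * ε ^ 2 := fun x => by
      simp only [θ'', abs_mul, abs_neg]
      rw [abs_of_pos (by positivity : 0 < Real.pi / 2), abs_of_pos (by positivity : 0 < k ^ 2)]
      calc Real.pi / 2 * k ^ 2 * |Real.cos (k * x)| ≤ 2 * (4 * ε) ^ 2 * 1 := by
            gcongr; exact Real.abs_cos_le_one _
        _ = 32 * ε ^ 2 := by ring
    have hpt : ∀ x, energyDensity β (glPotential φ) P Q S x ≤
        ENNReal.ofReal ((4609 + 32 * β) * ε ^ 2) := fun x => by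
      have hQn : ‖Q x‖ ≤ 8 * ε := by
        simp only [Q, norm_smul, hnn, mul_one, Real.norm_eq_abs, abs_of_nonneg hρ0]
        calc ρ * |θ' x| ≤ 1 * (8 * ε) := by gcongr; exact hb1 x
          _ = 8 * ε := by ring
      have hSn : ‖S x‖ ≤ 96 * ε ^ 2 := by
        simp only [S]
        rw [norm_smul, Real.norm_of_nonneg hρ0]
        calc ρ * ‖θ' x • (θ' x • -c (θ x)) + θ'' x • n (θ x)‖
            ≤ 1 * (|θ' x| * |θ' x| + |θ'' x|) := by
              gcongr
              refine (norm_add_le _ _).trans (le_of_eq ?_)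
              simp [norm_smul, hcn, hnn]
          _ ≤ 1 * ((8 * ε) * (8 * ε) + 32 * ε ^ 2) := by
              gcongr
              · exact hb1 x
              · exact hb1 x
              · exact hb2 x
          _ = 96 * ε ^ 2 := by ring
      have hPn : ‖P x‖ ^ 2 = √(1 - ε) := by
        simp only [P, norm_smul, hcn, mul_one, Real.norm_eq_abs, sq_abs, hρ]
      have hWP : glPotential φ (P x) ≤ ε ^ 2 / 4 := by
        rw [glPotential, hPn, hφ.eq_zero _ le_rfl]
        nlinarith
      refine ENNReal.ofReal_le_ofReal ?_
      have f1 : ‖S x‖ ^ 2 ≤ (96 * ε ^ 2) ^ 2 := by gcongr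
      have f2 : β / 2 * ‖Q x‖ ^ 2 ≤ β / 2 * (8 * ε) ^ 2 := by gcongr
      have f3 : ε ^ 2 * ε ^ 2 ≤ ε ^ 2 * 1 := by
        gcongr; nlinarith
      nlinarith
    calc ∫⁻ x in Ioc 0 ε⁻¹, energyDensity β (glPotential φ) P Q S x
        ≤ ∫⁻ _ in Ioc 0 ε⁻¹, ENNReal.ofReal ((4609 + 32 * β) * ε ^ 2) :=
          lintegral_mono fun x => hpt x
      _ = ENNReal.ofReal ((4609 + 32 * β) * ε ^ 2 * ε⁻¹) := by
          rw [setLIntegral_const, Real.volume_Ioc, sub_zero, ← ENNReal.ofReal_mul (by positivity)]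
      _ = ENNReal.ofReal ((4609 + 32 * β) * ε) := by
          congr 1; field_simp

lemma setLIntegral_energyDensity_comp_neg {W : RVec 2 → ℝ} {p q r : ℝ → RVec 2} :
    ∫⁻ x in Iic 0, energyDensity β W (fun x => p (-x)) (fun x => -q (-x)) (fun x => r (-x)) x =
      ∫⁻ x in Ioi 0, energyDensity β W p q r x := by
  rw [← setLIntegral_congr Iio_ae_eq_Iic]
  have := (Measure.measurePreserving_neg (volume : Measure ℝ)).setLIntegral_comp_preimage_emb
    (MeasurableEquiv.neg ℝ).measurableEmbedding (energyDensity β W p q r) (Ioi 0)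
  rw [← this]
  simp [energyDensity]

lemma setLIntegral_energyDensity_glue_le {W : RVec 2 → ℝ} {p q r p' q' r' : ℝ → RVec 2}
    {s T : ℝ} (hsT : s ≤ T) :
    ∫⁻ x in Ioi s, energyDensity β W (fun x => if x ≤ T then p x else p' x)
      (fun x => if x ≤ T then q x else q' x) (fun x => if x ≤ T then r x else r' x) x ≤
      (∫⁻ x in Ioc s T, energyDensity β W p q r x) + ∫⁻ x in Ioi T, energyDensity β W p' q' r' x := by
  rw [← Ioc_union_Ioi_eq_Ioi hsT]
  refine (lintegral_union_le _ _ _).trans (le_of_eq ?_)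
  congr 1
  · refine setLIntegral_congr_fun measurableSet_Ioc fun x hx => ?_
    simp [energyDensity, (mem_Ioc.1 hx).2]
  · refine setLIntegral_congr_fun measurableSet_Ioi fun x hx => ?_
    simp [energyDensity, not_le.2 (mem_Ioi.1 hx)]

/-- Upper bound for the minimal action: move along the axis to the edge of the support of the
cutoff, make a slow half turn there, and move along the axis to the other well. -/
lemma infAction_glPotential_le (hβ : 0 < β) (hε : 0 < ε) (hε1 : ε < 1) (hφ : IsCutoff ε φ) :
    infAction β (glPotential φ) wellMinus wellPlus ≤
      ENNReal.ofReal ((4800 + 50 * β) * ε) := by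
  set ρ := √(√(1 - ε))
  have hρ : ρ ^ 2 = √(1 - ε) := Real.sq_sqrt (Real.sqrt_nonneg _)
  have hρ0 : 0 ≤ ρ := Real.sqrt_nonneg _
  have hs1 : √(1 - ε) < 1 := sqrt_one_sub_lt_one hε
  have hsε : 1 - ε ≤ √(1 - ε) := by
    refine Real.le_sqrt_of_sq_le ?_
    nlinarith
  have hρ1 : ρ ≤ 1 := by nlinarith
  have hρε : 1 - ρ ≤ ε := by nlinarith
  obtain ⟨p, q, r, hp, hp0, hq0, hpT, hqT, hpc⟩ := exists_half_turn hβ hε hε1 hφ hρ0 hρ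
  have hdW := isDoubleWell_glPotential hε hφ
  have hMW : ∀ c ∈ Icc (0 : ℝ) 1, ∀ σ : ℝ, σ ^ 2 = 1 →
      ((σ * (1 - c * (1 - ρ))) ^ 2 - 1) ^ 2 / 4 ≤ ε ^ 2 / 4 := by
    intro c hc σ hσ
    rw [mul_pow, hσ, one_mul]
    have h1 : ρ ≤ 1 - c * (1 - ρ) := by nlinarith [hc.2]
    have h2 : 1 - c * (1 - ρ) ≤ 1 := by nlinarith [hc.1]
    have h3 : ρ ^ 2 ≤ (1 - c * (1 - ρ)) ^ 2 := by gcongr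
    have h4 : (1 - c * (1 - ρ)) ^ 2 ≤ 1 := by nlinarith
    nlinarith
  have haxis : ∀ x : ℝ, ‖(!₂[x, 0] : RVec 2)‖ = |x| := fun x => by
    have h1 : ‖(!₂[x, 0] : RVec 2)‖ ^ 2 = |x| ^ 2 := by simp [norm_sq_eq_coords]
    exact (pow_left_inj₀ (norm_nonneg _) (abs_nonneg _) two_ne_zero).1 h1
  obtain ⟨p₁, q₁, r₁, hp₁, hp₁0, hq₁0, hp₁lim, hc₁⟩ := exists_hermite (W := glPotential φ)
    (b := wellPlus) (δ := ε) (M := ε ^ 2 / 4) hβ ε⁻¹ (z := !₂[ρ, 0]) (y := 0)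
    (by
      have : (!₂[ρ, 0] : RVec 2) - wellPlus = !₂[ρ - 1, 0] := by
        ext i; fin_cases i <;> simp [wellPlus]
      rw [this, haxis, abs_of_nonpos (by linarith)]; linarith)
    (by simpa using hε.le) hdW.right_eq_zero
    (fun c hc d _ => by
      have : wellPlus + (c • (!₂[ρ, 0] - wellPlus) + d • (0 : RVec 2)) =
          !₂[1 * (1 - c * (1 - ρ)), 0] := by
        ext i; fin_cases i <;> simp [wellPlus]; ring
      rw [this, glPotential_axis]
      exact hMW c hc 1 (by norm_num))
  obtain ⟨p₂, q₂, r₂, hp₂, hp₂0, hq₂0, hp₂lim, hc₂⟩ := exists_hermite (W := glPotential φ)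
    (b := wellMinus) (δ := ε) (M := ε ^ 2 / 4) hβ 0 (z := !₂[-ρ, 0]) (y := 0)
    (by
      have : (!₂[-ρ, 0] : RVec 2) - wellMinus = !₂[1 - ρ, 0] := by
        ext i; fin_cases i <;> simp [wellMinus]; ring
      rw [this, haxis, abs_of_nonneg (by linarith)]; linarith)
    (by simpa using hε.le) hdW.left_eq_zero
    (fun c hc d _ => by
      have : wellMinus + (c • (!₂[-ρ, 0] - wellMinus) + d • (0 : RVec 2)) =
          !₂[-1 * (1 - c * (1 - ρ)), 0] := by
        ext i; fin_cases i <;> simp [wellMinus]; ring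
      rw [this, glPotential_axis]
      exact hMW c hc (-1) (by norm_num))
  have hT : 0 < ε⁻¹ := inv_pos.2 hε
  have hr := hp.glue hp₁ (s := ε⁻¹) (hpT.trans hp₁0.symm) (hqT.trans hq₁0.symm)
  have hl := hp₂.comp_neg
  have hpath := hl.glue hr (s := 0) (by simp [hT.le, hp₂0, hp0]) (by simp [hT.le, hq₂0, hq0])
  refine (Connects.infAction_le ⟨hpath, ?_, ?_⟩).trans ?_
  · refine tendsto_const_nhds.congr' ?_
    filter_upwards [eventually_le_atBot (-1)] with x hx
    rw [if_pos (by linarith), hp₂lim _ (by linarith)]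
  · refine tendsto_const_nhds.congr' ?_
    filter_upwards [eventually_ge_atTop (ε⁻¹ + 1)] with x hx
    rw [if_neg (by linarith), if_neg (by linarith), hp₁lim _ hx]
  · rw [action_glue]
    refine (add_le_add ((setLIntegral_energyDensity_comp_neg ..).le.trans hc₂)
      ((setLIntegral_energyDensity_glue_le hT.le).trans (add_le_add hpc hc₁))).trans ?_
    rw [← ENNReal.ofReal_add (by positivity) (by positivity),
      ← ENNReal.ofReal_add (by positivity) (by positivity)]
    refine ENNReal.ofReal_le_ofReal ?_
    have h1 : ε ^ 2 ≤ ε := by nlinarith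
    have h2 : β * ε ^ 2 ≤ β * ε := by gcongr
    nlinarith

end

/-! ### The polar angle -/

section

variable {e e' v : ℝ → RVec 2} {θ θ' : ℝ → ℝ} {θm θp θm' θp' : ℝ}

/-- A `C¹` planar curve that avoids the origin has a continuous polar angle: the imaginary part of
the complex logarithm obtained by integrating the logarithmic derivative. -/
lemma exists_continuous_angle (hd : ∀ x, HasDerivAt e (v x) x) (hv : Continuous v)
    (h0 : ∀ x, e x ≠ 0) :
    ∃ θ : ℝ → ℝ, Continuous θ ∧
      ∀ x, e x = !₂[‖e x‖ * Real.cos (θ x), ‖e x‖ * Real.sin (θ x)] := by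
  have he : Continuous e := continuous_iff_continuousAt.2 fun x => (hd x).continuousAt
  have hcoord : ∀ (i : Fin 2) (x : ℝ), HasDerivAt (fun x => e x i) (v x i) x := fun i x =>
    (coordL (m := 2) i).hasFDerivAt.comp_hasDerivAt x (hd x)
  set z : ℝ → ℂ := fun x => (e x 0 : ℂ) + (e x 1 : ℂ) * Complex.I
  set z' : ℝ → ℂ := fun x => (v x 0 : ℂ) + (v x 1 : ℂ) * Complex.I
  have hz : ∀ x, HasDerivAt z (z' x) x := fun x =>
    (hcoord 0 x).ofReal_comp.add ((hcoord 1 x).ofReal_comp.mul_const Complex.I)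
  have hzre : ∀ x, (z x).re = e x 0 := fun x => by simp [z]
  have hzim : ∀ x, (z x).im = e x 1 := fun x => by simp [z]
  have hz0 : ∀ x, z x ≠ 0 := fun x hx => h0 x <| by
    have h1 := hzre x
    have h2 := hzim x
    rw [hx] at h1 h2
    ext i; fin_cases i
    · simpa using h1.symm
    · simpa using h2.symm
  have hzn : ∀ x, ‖z x‖ = ‖e x‖ := fun x => by
    refine (pow_left_inj₀ (norm_nonneg _) (norm_nonneg _) two_ne_zero).1 ?_
    rw [norm_sq_eq_coords, ← Complex.normSq_eq_norm_sq, Complex.normSq_apply, hzre, hzim]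
    ring
  have hzc : Continuous z := continuous_iff_continuousAt.2 fun x => (hz x).continuousAt
  have hz'c : Continuous z' := by fun_prop
  have hg : Continuous fun x => z' x / z x := hz'c.div hzc hz0
  set L : ℝ → ℂ := fun x => Complex.log (z 0) + ∫ t in (0 : ℝ)..x, z' t / z t
  have hL : ∀ x, HasDerivAt L (z' x / z x) x := fun x =>
    (hg.integral_hasStrictDerivAt 0 x).hasDerivAt.const_add _
  have hLc : Continuous L := continuous_iff_continuousAt.2 fun x => (hL x).continuousAt
  have hconst : ∀ x, z x * Complex.exp (-L x) = 1 := fun x => by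
    have hder : ∀ x, HasDerivAt (fun x => z x * Complex.exp (-L x)) 0 x := fun x => by
      convert! (hz x).mul (hL x).neg.cexp using 1
      have := hz0 x
      field_simp
      ring
    rw [is_const_of_deriv_eq_zero (fun x => (hder x).differentiableAt) (fun x => (hder x).deriv) x 0]
    simp only [L, intervalIntegral.integral_same, add_zero]
    rw [Complex.exp_neg, Complex.exp_log (hz0 0), mul_inv_cancel₀ (hz0 0)]
  have hexp : ∀ x, z x = Complex.exp (L x) := fun x => by
    have := hconst x
    rw [Complex.exp_neg] at this
    exact (mul_inv_eq_one₀ (Complex.exp_ne_zero _)).1 this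
  refine ⟨fun x => (L x).im, Complex.continuous_im.comp hLc, fun x => ?_⟩
  have hn : ‖e x‖ = Real.exp (L x).re := by rw [← hzn, hexp, Complex.norm_exp]
  ext i; fin_cases i
  · simp [hn, ← hzre, hexp, Complex.exp_re]
  · simp [hn, ← hzim, hexp, Complex.exp_im]

/-- If `cos α > 0` on a preconnected set then `α` stays within `π / 2` of one multiple of `2π`. -/
lemma exists_abs_sub_lt_of_cos_pos {α : ℝ → ℝ} {S : Set ℝ} (hS : IsPreconnected S)
    (hne : S.Nonempty) (hα : ContinuousOn α S) (hcos : ∀ x ∈ S, 0 < Real.cos (α x)) :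
    ∃ k : ℤ, ∀ x ∈ S, |α x - k * (2 * Real.pi)| < Real.pi / 2 := by
  obtain ⟨x₀, hx₀⟩ := hne
  have hpi := Real.pi_pos
  set k := round (α x₀ / (2 * Real.pi))
  have hk : |α x₀ - k * (2 * Real.pi)| ≤ Real.pi := by
    have h1 := abs_sub_round (α x₀ / (2 * Real.pi))
    have h2 : α x₀ - k * (2 * Real.pi) =
        (α x₀ / (2 * Real.pi) - round (α x₀ / (2 * Real.pi))) * (2 * Real.pi) := by
      simp only [k]; field_simp
    rw [h2, abs_mul, abs_of_pos (by positivity : 0 < 2 * Real.pi)]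
    nlinarith
  have hcos' : ∀ x ∈ S, 0 < Real.cos |α x - k * (2 * Real.pi)| := fun x hx => by
    rw [Real.cos_abs, Real.cos_sub_int_mul_two_pi]
    exact hcos x hx
  refine ⟨k, fun x hx => ?_⟩
  by_contra! hge
  have hx₀lt : |α x₀ - k * (2 * Real.pi)| < Real.pi / 2 := by
    by_contra! h
    exact (hcos' x₀ hx₀).not_ge (Real.cos_nonpos_of_pi_div_two_le_of_le h (by linarith))
  obtain ⟨y, hy, hyv⟩ := hS.intermediate_value hx₀ hx
    (f := fun x => |α x - k * (2 * Real.pi)|) (hα.sub continuousOn_const).abs ⟨hx₀lt.le, hge⟩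
  have := hcos' y hy
  simp only at hyv
  rw [hyv, Real.cos_pi_div_two] at this
  exact lt_irrefl _ this

/-- A continuous angle converges, not only modulo `2π`, when its cosine tends to `1`. -/
lemma exists_tendsto_of_cos_tendsto_one {α : ℝ → ℝ} (hα : Continuous α)
    (h : Tendsto (fun x => Real.cos (α x)) atTop (𝓝 1)) : ∃ c, Tendsto α atTop (𝓝 c) := by
  obtain ⟨X, hX⟩ := eventually_atTop.1 (h.eventually (lt_mem_nhds zero_lt_one))
  obtain ⟨k, hk⟩ := exists_abs_sub_lt_of_cos_pos isPreconnected_Ici nonempty_Ici hα.continuousOn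
    (S := Ici X) hX
  refine ⟨k * (2 * Real.pi), tendsto_iff_norm_sub_tendsto_zero.2 ?_⟩
  have h1 : Tendsto (fun x => Real.arccos (Real.cos (α x))) atTop (𝓝 0) := by
    simpa [Function.comp_def] using (Real.continuous_arccos.tendsto 1).comp h
  refine h1.congr' ?_
  filter_upwards [eventually_ge_atTop X] with x hx
  have := hk x hx
  rw [← Real.cos_sub_int_mul_two_pi _ k, ← Real.cos_abs, Real.norm_eq_abs,
    Real.arccos_cos (abs_nonneg _) (by linarith [Real.pi_pos])]

lemma norm_wellPlus : ‖wellPlus‖ = 1 := by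
  have : ‖wellPlus‖ ^ 2 = 1 := by simp [wellPlus, norm_sq_eq_coords]
  exact (pow_eq_one_iff_of_nonneg (norm_nonneg _) two_ne_zero).1 this

lemma cos_eq_div {e : RVec 2} {θ : ℝ} (h0 : e ≠ 0)
    (h : e = !₂[‖e‖ * Real.cos θ, ‖e‖ * Real.sin θ]) : Real.cos θ = e 0 / ‖e‖ := by
  have h1 := congrArg (fun u : RVec 2 => u 0) h
  simp only [Matrix.cons_val_zero] at h1
  rw [h1, mul_div_cancel_left₀ _ (norm_ne_zero_iff.2 h0)]

lemma tendsto_cos_of_tendsto {l : Filter ℝ} {a : RVec 2} (ha : ‖a‖ = 1) (h0 : ∀ x, e x ≠ 0)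
    (hp : ∀ x, e x = !₂[‖e x‖ * Real.cos (θ x), ‖e x‖ * Real.sin (θ x)])
    (hl : Tendsto e l (𝓝 a)) : Tendsto (fun x => Real.cos (θ x)) l (𝓝 (a 0)) := by
  have h1 : Tendsto (fun x => e x 0) l (𝓝 (a 0)) :=
    ((coordL (m := 2) 0).continuous.tendsto a).comp hl
  have h2 := h1.div hl.norm (by rw [ha]; exact one_ne_zero)
  rw [ha, div_one] at h2
  exact h2.congr fun x => (cos_eq_div (h0 x) (hp x)).symm

lemma HasAngle.cos_right (h : HasAngle e θ θm θp) (hl : Tendsto e atTop (𝓝 wellPlus)) :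
    Real.cos θp = 1 := by
  have := tendsto_nhds_unique ((Real.continuous_cos.tendsto _).comp h.tendsto_atTop)
    (tendsto_cos_of_tendsto norm_wellPlus h.ne_zero h.polar hl)
  simpa [wellPlus] using this

lemma HasAngle.cos_left (h : HasAngle e θ θm θp) (hl : Tendsto e atBot (𝓝 wellMinus)) :
    Real.cos θm = -1 := by
  have := tendsto_nhds_unique ((Real.continuous_cos.tendsto _).comp h.tendsto_atBot)
    (tendsto_cos_of_tendsto norm_wellMinus h.ne_zero h.polar hl)
  simpa [wellMinus] using this

/-- A connection that avoids the origin turns in one of the two directions: its angle has limits,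
which are different modulo `2π`. -/
lemma Connects.turns {w : ℝ → RVec 2} (h : Connects wellMinus wellPlus e v w)
    (h0 : ∀ x, e x ≠ 0) : TurnsCounterclockwise e ∨ TurnsClockwise e := by
  obtain ⟨θ, hθ, hp⟩ := exists_continuous_angle h.path.hasDerivAt h.path.continuous_deriv h0
  obtain ⟨θp, hθp⟩ := exists_tendsto_of_cos_tendsto_one hθ (by
    simpa [wellPlus] using tendsto_cos_of_tendsto norm_wellPlus h0 hp h.tendsto_atTop)
  obtain ⟨c, hc⟩ := exists_tendsto_of_cos_tendsto_one (α := fun x => θ (-x) - Real.pi)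
    (by fun_prop) (by
      have h1 := (tendsto_cos_of_tendsto norm_wellMinus h0 hp h.tendsto_atBot).comp
        tendsto_neg_atTop_atBot
      simpa [wellMinus, Function.comp_def, Real.cos_sub_pi] using h1.neg)
  have hθm : Tendsto θ atBot (𝓝 (c + Real.pi)) := by
    have := (hc.comp tendsto_neg_atBot_atTop).add_const Real.pi
    simpa [Function.comp_def] using this
  have hang : HasAngle e θ (c + Real.pi) θp := ⟨h0, hθ, hp, hθm, hθp⟩
  have hne : c + Real.pi ≠ θp := fun heq => by
    have h1 := hang.cos_left h.tendsto_atBot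
    rw [heq, hang.cos_right h.tendsto_atTop] at h1
    norm_num at h1
  exact hne.lt_or_gt.imp (fun hlt => ⟨θ, _, _, hang, hlt⟩) (fun hlt => ⟨θ, _, _, hang, hlt⟩)

lemma eq_of_cos_eq_one {a b : ℝ} {k : ℤ} (h : |a - b - k * (2 * Real.pi)| ≤ Real.pi / 2)
    (hc : Real.cos (a - b) = 1) : a - b = k * (2 * Real.pi) := by
  have hpi := Real.pi_pos
  rw [abs_le] at h
  rw [← Real.cos_sub_int_mul_two_pi _ k,
    Real.cos_eq_one_iff_of_lt_of_lt (by linarith) (by linarith)] at hc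
  linarith

/-- Two connections between the wells that are in the same open half plane at each time have the
same total variation of the angle. -/
lemma HasAngle.sub_eq_sub (h : HasAngle e θ θm θp) (h' : HasAngle e' θ' θm' θp')
    (hm : Tendsto e atBot (𝓝 wellMinus)) (hm' : Tendsto e' atBot (𝓝 wellMinus))
    (hp : Tendsto e atTop (𝓝 wellPlus)) (hp' : Tendsto e' atTop (𝓝 wellPlus))
    (hin : ∀ x, 0 < inner ℝ (e x) (e' x)) : θp - θm = θp' - θm' := by
  obtain ⟨k, hk⟩ := exists_abs_sub_lt_of_cos_pos (α := fun x => θ x - θ' x) isPreconnected_univ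
    univ_nonempty (h.continuous.sub h'.continuous).continuousOn (fun x _ => by
      have h1 := hin x
      rw [h.polar x, h'.polar x, inner_eq_coords] at h1
      have h2 : 0 < ‖e x‖ * ‖e' x‖ :=
        mul_pos (norm_pos_iff.2 (h.ne_zero x)) (norm_pos_iff.2 (h'.ne_zero x))
      rw [Real.cos_sub]
      refine (mul_pos_iff_of_pos_left h2).1 ?_
      simp only [Matrix.cons_val_zero, Matrix.cons_val_one] at h1
      linarith)
  -- the difference of the angles at either end is a multiple of `2π` within `π / 2` of `2πk`
  have hlim : ∀ {l : Filter ℝ} [l.NeBot] {a b : ℝ}, Tendsto θ l (𝓝 a) → Tendsto θ' l (𝓝 b) →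
      |a - b - k * (2 * Real.pi)| ≤ Real.pi / 2 := fun ha hb =>
    le_of_tendsto ((ha.sub hb).sub_const _).abs (Eventually.of_forall fun x => (hk x trivial).le)
  have sin0 : ∀ {t : ℝ}, Real.cos t ^ 2 = 1 → Real.sin t = 0 := fun {t} ht => by
    have := Real.sin_sq_add_cos_sq t
    exact (pow_eq_zero_iff two_ne_zero).1 (by linarith)
  have cp := h.cos_right hp
  have cp' := h'.cos_right hp'
  have cm := h.cos_left hm
  have cm' := h'.cos_left hm'
  have e1 := eq_of_cos_eq_one (hlim h.tendsto_atTop h'.tendsto_atTop)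
    (by rw [Real.cos_sub, cp, cp', sin0 (by rw [cp]; norm_num)]; norm_num)
  have e2 := eq_of_cos_eq_one (hlim h.tendsto_atBot h'.tendsto_atBot)
    (by rw [Real.cos_sub, cm, cm', sin0 (by rw [cm]; norm_num)]; norm_num)
  linarith

/-- Two connections that turn in opposite directions are at distance at least `1 / 2` at some time,
if one of them stays outside the disc of radius `1 / 2`. -/
lemma exists_half_le_norm_sub (h : TurnsCounterclockwise e) (h' : TurnsClockwise e')
    (hm : Tendsto e atBot (𝓝 wellMinus)) (hm' : Tendsto e' atBot (𝓝 wellMinus))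
    (hp : Tendsto e atTop (𝓝 wellPlus)) (hp' : Tendsto e' atTop (𝓝 wellPlus))
    (hn : ∀ x, 1 / 2 ≤ ‖e x‖) : ∃ x, 1 / 2 ≤ ‖e x - e' x‖ := by
  by_contra! hlt
  obtain ⟨θ, θm, θp, hang, hθ⟩ := h
  obtain ⟨θ', θm', θp', hang', hθ'⟩ := h'
  have := hang.sub_eq_sub hang' hm hm' hp hp' fun x => by
    have h1 := norm_sub_sq_real (e x) (e' x)
    nlinarith [hlt x, hn x, norm_nonneg (e x - e' x)]
  linarith

end

/-! ### The reflection about the axis through the wells -/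

/-- The reflection `(u₁, u₂) ↦ (u₁, -u₂)`. -/
def axisReflection : RVec 2 →L[ℝ] RVec 2 :=
  ContinuousLinearMap.id ℝ (RVec 2) - (2 : ℝ) • (coordL (m := 2) 1).smulRight !₂[0, 1]

lemma axisReflection_apply (u : RVec 2) : axisReflection u = !₂[u 0, -u 1] := by
  ext i
  fin_cases i
  · simp [axisReflection, coordL]
  · simp [axisReflection, coordL]; ring

lemma norm_axisReflection (u : RVec 2) : ‖axisReflection u‖ = ‖u‖ := by
  refine (pow_left_inj₀ (norm_nonneg _) (norm_nonneg _) two_ne_zero).1 ?_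
  simp [norm_sq_eq_coords, axisReflection_apply]

lemma glPotential_axisReflection (φ : ℝ → ℝ) (u : RVec 2) :
    glPotential φ (axisReflection u) = glPotential φ u := by
  rw [glPotential, norm_axisReflection, axisReflection_apply, glPotential]
  simp

lemma Connects.axisReflection {u v w : ℝ → RVec 2} (h : Connects wellMinus wellPlus u v w) :
    Connects wellMinus wellPlus (fun x => axisReflection (u x)) (fun x => axisReflection (v x))
      (fun x => axisReflection (w x)) := by
  have hm : _root_.axisReflection wellMinus = wellMinus := by simp [axisReflection_apply, wellMinus]
  have hp : _root_.axisReflection wellPlus = wellPlus := by simp [axisReflection_apply, wellPlus]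
  refine ⟨h.path.map _, ?_, ?_⟩
  · simpa [hm, Function.comp_def] using (_root_.axisReflection.continuous.tendsto _).comp h.tendsto_atBot
  · simpa [hp, Function.comp_def] using (_root_.axisReflection.continuous.tendsto _).comp h.tendsto_atTop

lemma action_axisReflection (β : ℝ) (φ : ℝ → ℝ) (u v w : ℝ → RVec 2) :
    action β (glPotential φ) (fun x => axisReflection (u x)) (fun x => axisReflection (v x))
      (fun x => axisReflection (w x)) = action β (glPotential φ) u v w := by
  simp only [action, norm_axisReflection, glPotential_axisReflection]

lemma HasAngle.axisReflection {e : ℝ → RVec 2} {θ : ℝ → ℝ} {θm θp : ℝ} (h : HasAngle e θ θm θp) :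
    HasAngle (fun x => axisReflection (e x)) (fun x => -θ x) (-θm) (-θp) where
  ne_zero x hx := h.ne_zero x (by rw [← norm_eq_zero, ← norm_axisReflection, hx, norm_zero])
  continuous := h.continuous.neg
  polar x := by
    have h1 := congrArg _root_.axisReflection (h.polar x)
    rw [norm_axisReflection, h1, axisReflection_apply]
    simp
  tendsto_atBot := h.tendsto_atBot.neg
  tendsto_atTop := h.tendsto_atTop.neg

/-! ### Distances between connecting paths -/

section

variable {β : ℝ} {W : RVec m → ℝ} {a b : RVec m} {u v w p q r : ℝ → RVec m}

lemma Connects.exists_integrableOn_norm_sub_sq (hW : IsDoubleWell W a b) (hβ : 0 < β)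
    (h : Connects a b u v w) (h' : Connects a b p q r) (hfin : action β W u v w ≠ ⊤)
    (hfin' : action β W p q r ≠ ⊤) : ∃ T, IntegrableOn (fun x => ‖u x - p x‖ ^ 2) (Ioi T) := by
  obtain ⟨T, hT⟩ := h.exists_integrableOn_norm_sq hW hβ hfin
  obtain ⟨T', hT'⟩ := h'.exists_integrableOn_norm_sq hW hβ hfin'
  have i1 : IntegrableOn (fun x => ‖u x - b‖ ^ 2) (Ioi (max T T')) :=
    hT.mono_set (Ioi_subset_Ioi (le_max_left _ _))
  have i2 : IntegrableOn (fun x => ‖p x - b‖ ^ 2) (Ioi (max T T')) :=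
    hT'.mono_set (Ioi_subset_Ioi (le_max_right _ _))
  have hc : Continuous fun x => ‖u x - p x‖ ^ 2 :=
    (h.path.continuous.sub h'.path.continuous).norm.pow 2
  refine ⟨max T T', Integrable.mono' ((i1.const_mul 2).add (i2.const_mul 2))
    hc.aestronglyMeasurable (Eventually.of_forall fun x => ?_)⟩
  rw [Real.norm_of_nonneg (by positivity)]
  have h1 : ‖u x - p x‖ ≤ ‖u x - b‖ + ‖p x - b‖ := by
    rw [← norm_sub_rev b (p x)]
    exact norm_sub_le_norm_sub_add_norm_sub _ _ _
  have h2 : ‖u x - p x‖ ^ 2 ≤ (‖u x - b‖ + ‖p x - b‖) ^ 2 := by gcongr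
  simp only [Pi.add_apply]
  nlinarith [sq_nonneg (‖u x - b‖ - ‖p x - b‖)]

lemma Connects.memLp_sub (hW : IsDoubleWell W a b) (hβ : 0 < β)
    (h : Connects a b u v w) (h' : Connects a b p q r) (hfin : action β W u v w ≠ ⊤)
    (hfin' : action β W p q r ≠ ⊤) : MemLp (u - p) 2 volume := by
  have hc : Continuous (u - p) := h.path.continuous.sub h'.path.continuous
  rw [memLp_two_iff_integrable_sq_norm hc.aestronglyMeasurable]
  obtain ⟨T, hT⟩ := h.exists_integrableOn_norm_sub_sq hW hβ h' hfin hfin'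
  obtain ⟨T', hT'⟩ := h.comp_neg.exists_integrableOn_norm_sub_sq hW.symm hβ h'.comp_neg
    (by rwa [action_comp_neg]) (by rwa [action_comp_neg])
  have hB : IntegrableOn (fun x => ‖u x - p x‖ ^ 2) (Iio (-T')) := by
    have h1 := (Measure.measurePreserving_neg (volume : Measure ℝ)).integrableOn_comp_preimage
      (MeasurableEquiv.neg ℝ).measurableEmbedding (f := fun x => ‖u (-x) - p (-x)‖ ^ 2)
      (s := Ioi T')
    have h2 := h1.2 hT'
    simpa [Function.comp_def] using h2
  have hM : IntegrableOn (fun x => ‖u x - p x‖ ^ 2) (Icc (-T') T) :=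
    (hc.norm.pow 2).continuousOn.integrableOn_compact isCompact_Icc
  rw [← integrableOn_univ]
  refine ((hB.union hM).union hT).mono_set fun x _ => ?_
  rcases lt_or_ge x (-T') with h1 | h1
  · exact .inl (.inl h1)
  · rcases le_or_gt x T with h2 | h2
    · exact .inl (.inr ⟨h1, h2⟩)
    · exact .inr h2

/-- Paths of bounded action are equicontinuous. -/
lemma IsH2Path.norm_sub_le (hW : IsDoubleWell W a b) (hβ : 0 < β) (h : IsH2Path u v w)
    {K : ℝ} (hK : 0 < K) (hact : action β W u v w ≤ ENNReal.ofReal K) {x y : ℝ}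
    (hxy : |y - x| ≤ β / (128 * K)) : ‖u y - u x‖ ≤ 1 / 8 := by
  have hfin := ne_top_of_le_ne_top ENNReal.ofReal_ne_top hact
  have h1 := h.integral_norm_sq_fst_le hβ hW.continuous hW.nonneg hK.le hact
  rw [h.sub_eq_integral]
  -- this choice of the parameter makes both terms of the bound at most `1 / 16`
  have hl : 0 < β / (32 * K) := by positivity
  refine (norm_intervalIntegral_le h.continuous_deriv.aestronglyMeasurable
    (h.integrable_norm_sq_fst hβ hW.continuous hW.nonneg hfin) hl x y).trans ?_
  have h2 : |y - x| / (4 * (β / (32 * K))) ≤ 1 / 16 := by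
    rw [div_le_iff₀ (by positivity)]
    refine hxy.trans (le_of_eq ?_)
    field_simp; norm_num
  have h3 : β / (32 * K) * ∫ t, ‖v t‖ ^ 2 ≤ 1 / 16 := by
    rw [div_mul_eq_mul_div, div_le_iff₀ (by positivity)]
    linarith
  linarith

/-- Two paths of bounded action that are apart at one time are apart in `L²`, since by
equicontinuity they are apart on an interval of fixed length. -/
lemma IsH2Path.le_eLpNorm_sub (hW : IsDoubleWell W a b) (hβ : 0 < β) (h : IsH2Path u v w)
    (h' : IsH2Path p q r) {K : ℝ} (hK : 0 < K) (hact : action β W u v w ≤ ENNReal.ofReal K)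
    (hact' : action β W p q r ≤ ENNReal.ofReal K) {x : ℝ} (hx : 1 / 2 ≤ ‖u x - p x‖) :
    ‖(1 / 4 : ℝ)‖ₑ * ENNReal.ofReal (β / (128 * K)) ^ (1 / (2 : ℝ≥0∞).toReal) ≤
      eLpNorm (u - p) 2 volume := by
  have hind := eLpNorm_indicator_const (μ := volume) (c := (1 / 4 : ℝ)) (p := 2)
    (measurableSet_Icc (a := x) (b := x + β / (128 * K))) (by simp) (by simp)
  rw [Real.volume_Icc, add_sub_cancel_left] at hind
  rw [← hind]
  refine eLpNorm_mono fun y => ?_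
  by_cases hy : y ∈ Icc x (x + β / (128 * K))
  · rw [indicator_of_mem hy, Pi.sub_apply, Real.norm_of_nonneg (by norm_num)]
    have hxy : |y - x| ≤ β / (128 * K) := by
      rw [abs_of_nonneg (by linarith [hy.1])]; linarith [hy.2]
    have h1 := h.norm_sub_le hW hβ hK hact hxy
    have h2 := h'.norm_sub_le hW hβ hK hact' hxy
    have h3 : u x - p x = (u y - p y) - (u y - u x) + (p y - p x) := by abel
    have h4 := norm_add_le ((u y - p y) - (u y - u x)) (p y - p x)
    have h5 := _root_.norm_sub_le (u y - p y) (u y - u x)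
    rw [← h3] at h4
    linarith
  · rw [indicator_of_notMem hy, norm_zero]
    exact norm_nonneg _

end

/-! ### The separation condition -/

theorem lemma2p5 (β : ℝ) (hβ : 0 < β) :
    ∃ ε₀ : ℝ, 0 < ε₀ ∧ ε₀ ≤ 1 ∧
      ∀ (ε : ℝ) (φ : ℝ → ℝ), 0 < ε → ε < 1 → IsCutoff ε φ →
        IsDoubleWell (glPotential φ) wellMinus wellPlus ∧
        (ε < ε₀ →
          SeparatedInto
            (minimalHeteroclinics β (glPotential φ) wellMinus wellPlus)
            {e ∈ minimalHeteroclinics β (glPotential φ) wellMinus wellPlus |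
              TurnsCounterclockwise e}
            {e ∈ minimalHeteroclinics β (glPotential φ) wellMinus wellPlus |
              TurnsClockwise e}) := by
  have hK : 0 < originCost β := originCost_pos hβ
  -- below this threshold the minimal action is less than the cost of approaching the origin
  refine ⟨min 1 (originCost β / (4800 + 50 * β)), by positivity, min_le_left _ _,
    fun ε φ hε hε1 hφ => ⟨isDoubleWell_glPotential hε hφ, fun hlt => ?_⟩⟩
  have hW := isDoubleWell_glPotential hε hφ
  have hinf : infAction β (glPotential φ) wellMinus wellPlus < ENNReal.ofReal (originCost β) := by
    refine (infAction_glPotential_le hβ hε hε1 hφ).trans_lt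
      ((ENNReal.ofReal_lt_ofReal_iff hK).2 ?_)
    have := (lt_div_iff₀ (by positivity)).1 (hlt.trans_le (min_le_right _ _))
    linarith
  have hfin : infAction β (glPotential φ) wellMinus wellPlus ≠ ⊤ := hinf.ne_top
  set F := minimalHeteroclinics β (glPotential φ) wellMinus wellPlus
  have hact : ∀ e ∈ F, action β (glPotential φ) e (deriv e) (iteratedDeriv 2 e) <
      ENNReal.ofReal (originCost β) := fun e he => by
    rwa [action_eq_infAction_of_mem hβ hW hfin he]
  have hconn : ∀ e ∈ F, Connects wellMinus wellPlus e (deriv e) (iteratedDeriv 2 e) :=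
    fun e he => connects_of_mem_minimalHeteroclinics he
  have hhalf : ∀ e ∈ F, ∀ x, 1 / 2 ≤ ‖e x‖ := fun e he =>
    (hconn e he).half_le_norm hβ hφ (hact e he)
  have hturn : ∀ e ∈ F, TurnsCounterclockwise e ∨ TurnsClockwise e := fun e he =>
    (hconn e he).turns fun x hx => by
      have := hhalf e he x
      rw [hx, norm_zero] at this
      norm_num at this
  have hrefl : ∀ e ∈ F, (fun x => axisReflection (e x)) ∈ F := fun e he =>
    (hconn e he).axisReflection.mem_minimalHeteroclinics hβ hW
      (by rw [action_axisReflection, action_eq_infAction_of_mem hβ hW hfin he]) hfin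
  obtain ⟨u, v, w, hu, humin⟩ := hW.exists_minimizer hβ hfin
  have huF : u ∈ F := hu.mem_minimalHeteroclinics hβ hW humin hfin
  refine ⟨?_, ?_, ?_, ?_, ?_⟩
  · ext e
    constructor
    · intro he
      exact (hturn e he).imp (fun h => ⟨he, h⟩) (fun h => ⟨he, h⟩)
    · rintro (h | h) <;> exact h.1
  · rcases hturn u huF with h | ⟨θ, θm, θp, h, hlt'⟩
    · exact ⟨u, huF, h⟩
    · exact ⟨_, hrefl u huF, _, _, _, h.axisReflection, neg_lt_neg hlt'⟩
  · rcases hturn u huF with ⟨θ, θm, θp, h, hlt'⟩ | h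
    · exact ⟨_, hrefl u huF, _, _, _, h.axisReflection, neg_lt_neg hlt'⟩
    · exact ⟨u, huF, h⟩
  · rintro e ⟨he, -⟩ e' ⟨he', -⟩
    exact (hconn e he).memLp_sub hW hβ (hconn e' he') (hact e he).ne_top (hact e' he').ne_top
  · have hpos : 0 < ‖(1 / 4 : ℝ)‖ₑ *
        ENNReal.ofReal (β / (128 * originCost β)) ^ (1 / (2 : ℝ≥0∞).toReal) := by
      refine ENNReal.mul_pos (by simp) (ENNReal.rpow_pos ?_ ENNReal.ofReal_ne_top).ne'
      exact ENNReal.ofReal_pos.2 (by positivity)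
    refine hpos.trans_le (le_iInf₂ fun e he => le_iInf₂ fun e' he' => ?_)
    have c := hconn e he.1
    have c' := hconn e' he'.1
    obtain ⟨x, hx⟩ := exists_half_le_norm_sub he.2 he'.2 c.tendsto_atBot c'.tendsto_atBot
      c.tendsto_atTop c'.tendsto_atTop (hhalf e he.1)
    exact c.path.le_eLpNorm_sub hW hβ c'.path hK (hact e he.1).le (hact e' he'.1).le hx

end
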